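/- For a finite simple graph $G=(V,E)$ with $n$ vertices, $m$ edges and maximum degree $\Delta$, let $w(e)=\min\{\mathrm d(u),\mathrm d(v)\}$ for an edge $e=(u,v)$, let $w(G)=\sum_{e\in E}w(e)$, and let $\alpha$ be the arboricity of $G$, i.e. the least integer with $m_S\le\alpha(n_S-1)$ for every nonempty $S\subseteq V$, where $m_S$ and $n_S$ are the numbers of edges and vertices of $G[S]$. A partial $(\Delta+1)$-coloring $\chi$ assigns to each edge a color in $\{1,\dots,\Delta+1\}$ or leaves it uncolored, such that distinct colored edges that share an endpoint have distinct colors; a color is missing at $v$ if no edge at $v$ has it. Algorithm Color-Edges starts from the empty partial $(\Delta+1)$-coloring and, as long as there are uncolored edges, performs the following round (Color-One-Edge). 1. Choose a uniformly random uncolored edge $e$, and let $u$ be an endpoint of $e$ of smaller degree and $x_0$ the other one. 2. Build a fan $(u,x_0,\dots,x_t)$: repeatedly pick a color $c_1$ missing at the last leaf $x_t$; if $c_1$ is missing at $u$, or if the edge at $u$ of color $c_1$ is $(u,x_j)$ for some $1\le j\le t$, stop; otherwise append the other endpoint of that edge as a new leaf $x_{t+1}$. 3. Choose a uniformly random color $c_0$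 missing at $u$, and compute the maximal path $P$ that starts at $u$ and whose edges have the colors $c_0,c_1$. 4. If $c_1$ is missing at $u$, put $q=t$. Otherwise exchange the two colors on $P$, and put $q=j-1$ if the other endpoint of $P$ is not $x_{j-1}$, and $q=t$ if it is. Then shift the fan from $x_q$ (give $(u,x_{i-1})$ the color of $(u,x_i)$ for $i=1,\dots,q$ and uncolor $(u,x_q)$) and give $(u,x_q)$ the color $c_1$. Implement the algorithm on a random access machine whose input is a list of the edges of $G$ and whose elementary operations (reading and writing words, incrementing, subtracting and comparing them, drawing a uniformly random element of $\{0,\dots,k\}$ for a word $k$) take constant time. The colors missing at $v$ that are at most $\mathrm d(v)+1$ are kept in a list, from which the colors $c_1$ are picked; the uncolored edges are kept in an array; a table gives for $v$ and $c$ the edge at $v$ of color $c$; and the random missing color $c_0$ at $u$ is found by listing all missing colors if $\mathrm d(u)>\Delta/2$, and otherwise by sampling from $\{1,\dots,\Delta+1\}$ until a missing color is found. Then the algorithm halts almost surely, and whenever it halts, it has computed a proper $(\Delta+1)$-edge-coloring of $G$ in which all edges are colored. Moreover, there is an absolute constant $C$ such that for every graph $G$ with at least one edge the expected running time (including the set-up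 of the data structures) is at most $C\,w(G)\log n$, where $w(G)\log n\le C\,m\alpha\log n$; in particular the expected running time is $O(w(G)\log n)=O(m\alpha\log n)$. -/

import Mathlib

/-! ## Graph notions -/

namespace ColorEdges

/-- The weight `w(e) = min {d(u), d(v)}` of an edge `e = (u, v)`. -/
def edgeWeight {V : Type*} [Fintype V] (G : SimpleGraph V) [DecidableRel G.Adj] : Sym2 V → ℕ :=
  Sym2.lift ⟨fun u v => min (G.degree u) (G.degree v), fun _ _ => min_comm _ _⟩

/-- The weight `w(G)` of a graph: the sum of the weights of its edges. -/
def graphWeight {V : Type*} [Fintype V] [DecidableEq V] (G : SimpleGraph V)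
    [DecidableRel G.Adj] : ℕ :=
  ∑ e ∈ G.edgeFinset, edgeWeight G e

/-- The number `m_S` of edges of the subgraph induced by the vertex set `S`. -/
noncomputable def inducedEdges {V : Type*} (G : SimpleGraph V) (S : Finset V) : ℕ :=
  Set.ncard {e : Sym2 V | e ∈ G.edgeSet ∧ ∀ v ∈ e, v ∈ S}

/-- The arboricity: the least natural number `α` with `m_S / (n_S - 1) ≤ α` for all vertex
sets `S` with `n_S ≥ 2` vertices.  (For `n_S ≤ 1` we have `m_S = 0`, and the inequality below is
void.) -/
noncomputable def arboricity {V : Type*} (G : SimpleGraph V) : ℕ :=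
  sInf {α : ℕ | ∀ S : Finset V, inducedEdges G S ≤ α * (S.card - 1)}

/-! ## A randomized random access machine

The machine has finitely many named registers (`Var`) and finitely many named arrays (`Arr`), whose
cells are addressed by two words; one-dimensional arrays use the second address `0`.
The only arithmetic is successor and (truncated) subtraction, so no word ever exceeds the
largest word seen before by more than one: words of a run of polynomial length on a polynomially
bounded memory have `O(log n)` bits. -/

/-- Registers. -/
inductive Var
  /-- the number of edges (input) -/
  | m
  /-- the maximum degree -/
  | maxDeg
  /-- the number of uncolored edges -/
  | l
  /-- the edge that is being colored -/
  | e
  /-- its endpoint of smaller degree, the center of the fan -/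
  | u
  /-- the fan has the leaves `x_0, …, x_t` -/
  | t
  /-- flag: the fan is primed -/
  | primed
  | c0 | c1
  /-- the length of the path computed so far -/
  | len
  /-- the current last vertex of the path, and the color by which to leave it -/
  | y | yc
  /-- the fan is shifted from leaf `x_q` -/
  | q
  /-- auxiliary registers -/
  | i | k | r | x | f | g | c | z | last
  deriving DecidableEq

/-- Arrays. -/
inductive Arr
  /-- `ends[e][0]`, `ends[e][1]`: the two endpoints of edge `e` (input) -/
  | ends
  /-- `color[e]`: the color of edge `e`, with `0` for "uncolored" -/
  | color
  /-- `deg[v]`: the degree of `v` -/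
  | deg
  /-- `tab[v][c]`: the edge at `v` of color `c`, if there is one (otherwise, an arbitrary word) -/
  | tab
  /-- `free[v][0], …, free[v][cnt[v]-1]`: list of all colors in `{1, …, d(v)+1}` missing at `v` -/
  | free
  | cnt
  /-- `pos[v][c]`: position of color `c` in that list -/
  | pos
  /-- `un[0], …, un[l-1]`: the uncolored edges -/
  | un
  /-- `ind[e]`: position of the uncolored edge `e` in `un` -/
  | ind
  /-- `fan[i]`: the edge from the center to the leaf `x_i` of the fan -/
  | fan
  /-- `fpos[f]`: the position of edge `f` in the fan, if it is there -/
  | fpos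
  /-- `path[i]`, `pnew[i]`: the `i`-th edge of the path, and its color after a flip -/
  | path | pnew
  /-- auxiliary array of missing colors -/
  | aux
  deriving DecidableEq

/-- Word expressions: constants, registers, array cells, successor and truncated subtraction. -/
inductive Expr
  | lit (k : ℕ)
  | var (v : Var)
  | cell (a : Arr) (i j : Expr)
  | succ (p : Expr)
  | sub (p q : Expr)

/-- Tests. -/
inductive Test
  | le (p q : Expr)
  | eq (p q : Expr)
  | not (b : Test)
  | and (b d : Test)
  | or (b d : Test)

/-- Programs.  `rand v p` stores in register `v` a uniformly random element of `{0, …, p}`,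
independent of everything before. -/
inductive Cmd
  | set (v : Var) (p : Expr)
  | store (a : Arr) (i j : Expr) (p : Expr)
  | rand (v : Var) (p : Expr)
  | seq (P Q : Cmd)
  | ite (b : Test) (P Q : Cmd)
  | skip
  | loop (b : Test) (P : Cmd)

/-- Memory contents. -/
structure State where
  var : Var → ℕ
  arr : Arr → ℕ → ℕ → ℕ

def Expr.eval (s : State) : Expr → ℕ
  | .lit k => k
  | .var v => s.var v
  | .cell a i j => s.arr a (i.eval s) (j.eval s)
  | .succ p => p.eval s + 1
  | .sub p q => p.eval s - q.eval s

def Test.holds (s : State) : Test → Bool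
  | .le p q => decide (p.eval s ≤ q.eval s)
  | .eq p q => decide (p.eval s = q.eval s)
  | .not b => !(b.holds s)
  | .and b d => b.holds s && d.holds s
  | .or b d => b.holds s || d.holds s

/-- Write the word `w` into register `v`. -/
def State.setVar (s : State) (v : Var) (w : ℕ) : State :=
  ⟨Function.update s.var v w, s.arr⟩

/-- Write the word `w` into the cell `a[i][j]`. -/
def State.setCell (s : State) (a : Arr) (i j w : ℕ) : State :=
  ⟨s.var, Function.update s.arr a
    (Function.update (s.arr a) i (Function.update (s.arr a i) j w))⟩

/-- A configuration: the stack of programs that remain to be executed, and the memory.  The machine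
has halted when the stack is empty. -/
abbrev Config := List Cmd × State

/-- One step of the machine.  Executing an assignment, drawing a random word, evaluating the test of
a branch or of a loop, entering a sequence: each of these is one step. -/
noncomputable def step : Config → PMF Config
  | ([], s) => PMF.pure ([], s)
  | (.set v p :: K, s) => PMF.pure (K, s.setVar v (p.eval s))
  | (.store a i j p :: K, s) => PMF.pure (K, s.setCell a (i.eval s) (j.eval s) (p.eval s))
  | (.rand v p :: K, s) =>
      (PMF.uniformOfFintype (Fin (p.eval s + 1))).map fun w => (K, s.setVar v w)
  | (.seq P Q :: K, s) => PMF.pure (P :: Q :: K, s)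
  | (.ite b P Q :: K, s) => PMF.pure ((if b.holds s then P else Q) :: K, s)
  | (.skip :: K, s) => PMF.pure (K, s)
  | (.loop b P :: K, s) => PMF.pure (if b.holds s then P :: .loop b P :: K else K, s)

/-- The distribution of the configuration after `t` steps of program `P` from memory `s`. -/
noncomputable def configAfter (P : Cmd) (s : State) : ℕ → PMF Config
  | 0 => PMF.pure ([P], s)
  | t + 1 => (configAfter P s t).bind step

/-- The expected number `𝔼[T] = ∑ₜ ℙ(T > t)` of steps until program `P` halts, when started with
memory `s`. -/
noncomputable def expectedTime (P : Cmd) (s : State) : ENNReal :=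
  ∑' t : ℕ, (configAfter P s t).toOuterMeasure {κ | κ.1 ≠ []}

/-! ## Algorithm Color-Edges -/

infixr:60 ";;" => Cmd.seq

/-- `a[i]` for a one-dimensional array. -/
abbrev cell1 (a : Arr) (i : Expr) : Expr := .cell a i (.lit 0)

/-- `a[i] ← p` for a one-dimensional array. -/
abbrev store1 (a : Arr) (i p : Expr) : Cmd := .store a i (.lit 0) p

abbrev Expr.pred (p : Expr) : Expr := .sub p (.lit 1)

/-- `p < q` -/
abbrev Test.lt (p q : Expr) : Test := .le (.succ p) q

/-- Is there an edge of color `c ≥ 1` at the vertex `v`?  The entry `tab[v][c]` is only a hint: it is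
checked to be an edge at `v` of color `c`.  So the table needs no initialization. -/
def hasColor (v c : Expr) : Test :=
  .and (.lt (.cell .tab v c) (.var .m)) <|
  .and (.eq (cell1 .color (.cell .tab v c)) c) <|
  .or (.eq (.cell .ends (.cell .tab v c) (.lit 0)) v)
    (.eq (.cell .ends (.cell .tab v c) (.lit 1)) v)

/-- `w ←` the endpoint of edge `f` other than `v`. -/
def otherEnd (w : Var) (f v : Expr) : Cmd :=
  .ite (.eq (.cell .ends f (.lit 0)) v)
    (.set w (.cell .ends f (.lit 1)))
    (.set w (.cell .ends f (.lit 0)))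

/-- Color `c` stops being missing at vertex `z`: delete it from the list of `z`. -/
def dropMissing : Cmd :=
  .ite (.le (.var .c) (.succ (cell1 .deg (.var .z))))
    (.set .k (.cell .pos (.var .z) (.var .c)) ;;
     store1 .cnt (.var .z) (cell1 .cnt (.var .z)).pred ;;
     .set .last (.cell .free (.var .z) (cell1 .cnt (.var .z))) ;;
     .store .free (.var .z) (.var .k) (.var .last) ;;
     .store .pos (.var .z) (.var .last) (.var .k))
    .skip

/-- Color `c` becomes missing at vertex `z`: append it to the list of `z`. -/
def addMissing : Cmd :=
  .ite (.le (.var .c) (.succ (cell1 .deg (.var .z))))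
    (.store .free (.var .z) (cell1 .cnt (.var .z)) (.var .c) ;;
     .store .pos (.var .z) (.var .c) (cell1 .cnt (.var .z)) ;;
     store1 .cnt (.var .z) (.succ (cell1 .cnt (.var .z))))
    .skip

/-- `χ(g) ← c`, for an uncolored edge `g`. -/
def assignColor : Cmd :=
  store1 .color (.var .g) (.var .c) ;;
  .set .z (.cell .ends (.var .g) (.lit 0)) ;;
  .store .tab (.var .z) (.var .c) (.var .g) ;;
  dropMissing ;;
  .set .z (.cell .ends (.var .g) (.lit 1)) ;;
  .store .tab (.var .z) (.var .c) (.var .g) ;;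
  dropMissing ;;
  .set .k (cell1 .ind (.var .g)) ;;
  .set .l (Expr.var .l).pred ;;
  .set .last (cell1 .un (.var .l)) ;;
  store1 .un (.var .k) (.var .last) ;;
  store1 .ind (.var .last) (.var .k)

/-- Uncolor the colored edge `g`; its old color is left in register `c`. -/
def removeColor : Cmd :=
  .set .c (cell1 .color (.var .g)) ;;
  store1 .color (.var .g) (.lit 0) ;;
  .set .z (.cell .ends (.var .g) (.lit 0)) ;;
  addMissing ;;
  .set .z (.cell .ends (.var .g) (.lit 1)) ;;
  addMissing ;;
  store1 .un (.var .l) (.var .g) ;;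
  store1 .ind (.var .g) (.var .l) ;;
  .set .l (.succ (.var .l))

/-- Make-Primed-Fan: computes a fan with center `u`, first edge `e`, primed by the color `c1`. -/
def makePrimedFan : Cmd :=
  store1 .fan (.lit 0) (.var .e) ;;
  store1 .fpos (.var .e) (.lit 0) ;;
  .set .t (.lit 0) ;;
  .set .primed (.lit 0) ;;
  .loop (.eq (.var .primed) (.lit 0))
    (otherEnd .x (cell1 .fan (.var .t)) (.var .u) ;;
     -- pick a color missing at the last leaf
     .set .c1 (.cell .free (.var .x) (.lit 0)) ;;
     .ite (.not (hasColor (.var .u) (.var .c1)))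
       (.set .primed (.lit 1))
       (.set .f (.cell .tab (.var .u) (.var .c1)) ;;
        .ite (.and (.le (cell1 .fpos (.var .f)) (.var .t))
            (.eq (cell1 .fan (cell1 .fpos (.var .f))) (.var .f)))
          (.set .primed (.lit 1))
          (.set .t (.succ (.var .t)) ;;
           store1 .fan (.var .t) (.var .f) ;;
           store1 .fpos (.var .f) (.var .t))))

/-- `c0 ←` a uniformly random color missing at `u`.  If `d(u) > Δ/2`, by listing all missing colors;
otherwise by sampling colors until a missing one is found. -/
def randomMissingColor : Cmd :=
  .ite (.lt (.sub (.var .maxDeg) (cell1 .deg (.var .u))) (cell1 .deg (.var .u)))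
    (.set .k (.lit 0) ;;
     .set .c (.lit 1) ;;
     .loop (.le (.var .c) (.succ (.var .maxDeg)))
       (.ite (.not (hasColor (.var .u) (.var .c)))
          (store1 .aux (.var .k) (.var .c) ;;
           .set .k (.succ (.var .k)))
          .skip ;;
        .set .c (.succ (.var .c))) ;;
     .rand .r (Expr.var .k).pred ;;
     .set .c0 (cell1 .aux (.var .r)))
    (.rand .r (.var .maxDeg) ;;
     .set .c0 (.succ (.var .r)) ;;
     .loop (hasColor (.var .u) (.var .c0))
       (.rand .r (.var .maxDeg) ;;
        .set .c0 (.succ (.var .r))))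

/-- Compute the maximal `(c0, c1)`-alternating path that starts at `u`.  Its other endpoint is left
in register `y`. -/
def alternatingPath : Cmd :=
  .set .y (.var .u) ;;
  .set .yc (.var .c1) ;;
  .set .len (.lit 0) ;;
  .loop (hasColor (.var .y) (.var .yc))
    (.set .f (.cell .tab (.var .y) (.var .yc)) ;;
     .ite (.eq (.var .yc) (.var .c1)) (.set .yc (.var .c0)) (.set .yc (.var .c1)) ;;
     store1 .path (.var .len) (.var .f) ;;
     store1 .pnew (.var .len) (.var .yc) ;;
     .set .len (.succ (.var .len)) ;;
     otherEnd .x (.var .f) (.var .y) ;;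
     .set .y (.var .x))

/-- Flip the computed path: uncolor its edges, then give them their new colors. -/
def flipPath : Cmd :=
  .set .i (.lit 0) ;;
  .loop (.lt (.var .i) (.var .len))
    (.set .g (cell1 .path (.var .i)) ;;
     removeColor ;;
     .set .i (.succ (.var .i))) ;;
  .set .i (.lit 0) ;;
  .loop (.lt (.var .i) (.var .len))
    (.set .g (cell1 .path (.var .i)) ;;
     .set .c (cell1 .pnew (.var .i)) ;;
     assignColor ;;
     .set .i (.succ (.var .i)))

/-- Shift the fan from the leaf `x_q`. -/
def shiftFan : Cmd :=
  .set .i (.lit 0) ;;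
  .loop (.lt (.var .i) (.var .q))
    (.set .g (cell1 .fan (.succ (.var .i))) ;;
     removeColor ;;
     .set .g (cell1 .fan (.var .i)) ;;
     assignColor ;;
     .set .i (.succ (.var .i)))

/-- Extend-Coloring. -/
def extendColoring : Cmd :=
  .ite (.not (hasColor (.var .u) (.var .c1)))
    (.set .q (.var .t))
    -- `q ← j - 1`, where `x_j` is the leaf whose edge has color `c1`
    (.set .q (cell1 .fpos (.cell .tab (.var .u) (.var .c1))).pred ;;
     flipPath ;;
     otherEnd .x (cell1 .fan (.var .q)) (.var .u) ;;
     .ite (.eq (.var .y) (.var .x)) (.set .q (.var .t)) .skip) ;;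
  shiftFan ;;
  .set .g (cell1 .fan (.var .q)) ;;
  .set .c (.var .c1) ;;
  assignColor

/-- Color-One-Edge: choose a uniformly random uncolored edge `e`, and color it from its endpoint `u`
of smaller degree. -/
def colorOneEdge : Cmd :=
  .rand .r (Expr.var .l).pred ;;
  .set .e (cell1 .un (.var .r)) ;;
  .ite (.le (cell1 .deg (.cell .ends (.var .e) (.lit 0)))
      (cell1 .deg (.cell .ends (.var .e) (.lit 1))))
    (.set .u (.cell .ends (.var .e) (.lit 0)))
    (.set .u (.cell .ends (.var .e) (.lit 1))) ;;
  makePrimedFan ;;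
  randomMissingColor ;;
  alternatingPath ;;
  extendColoring

/-- First visit of vertex `z` by the set-up: degree `0`, list of missing colors `1`. -/
def resetVertex : Cmd :=
  store1 .deg (.var .z) (.lit 0) ;;
  .store .free (.var .z) (.lit 0) (.lit 1) ;;
  .store .pos (.var .z) (.lit 1) (.lit 0) ;;
  store1 .cnt (.var .z) (.lit 1)

/-- Count one more edge at vertex `z`: increment its degree `d`, and append the color `d + 1` to its
list of missing colors. -/
def countAtVertex : Cmd :=
  store1 .deg (.var .z) (.succ (cell1 .deg (.var .z))) ;;
  .set .c (.succ (cell1 .deg (.var .z))) ;;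
  addMissing ;;
  .ite (.lt (.var .maxDeg) (cell1 .deg (.var .z))) (.set .maxDeg (cell1 .deg (.var .z))) .skip

/-- Set up the data structures for the empty coloring. -/
def emptyColoring : Cmd :=
  .set .i (.lit 0) ;;
  .loop (.lt (.var .i) (.var .m))
    (.set .z (.cell .ends (.var .i) (.lit 0)) ;;
     resetVertex ;;
     .set .z (.cell .ends (.var .i) (.lit 1)) ;;
     resetVertex ;;
     .set .i (.succ (.var .i))) ;;
  .set .maxDeg (.lit 0) ;;
  .set .i (.lit 0) ;;
  .loop (.lt (.var .i) (.var .m))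
    (.set .z (.cell .ends (.var .i) (.lit 0)) ;;
     countAtVertex ;;
     .set .z (.cell .ends (.var .i) (.lit 1)) ;;
     countAtVertex ;;
     store1 .color (.var .i) (.lit 0) ;;
     store1 .un (.var .i) (.var .i) ;;
     store1 .ind (.var .i) (.var .i) ;;
     .set .i (.succ (.var .i))) ;;
  .set .l (.var .m)

/-- Color-Edges, started with the empty coloring: as long as there are uncolored edges, perform
Color-One-Edge. -/
def colorEdges : Cmd :=
  emptyColoring ;;
  .loop (.not (.eq (.var .l) (.lit 0))) colorOneEdge

/-! ## Input and output -/

/-- A list of the `m` edges of `G`, in any order, each with its endpoints in any order. -/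
structure EdgeList {n : ℕ} (G : SimpleGraph (Fin n)) (m : ℕ) where
  ends : Fin m → Fin n × Fin n
  edge : Fin m ≃ G.edgeSet
  edge_eq : ∀ i, (edge i : Sym2 (Fin n)) = s((ends i).1, (ends i).2)

/-- The memory `s` holds the edge list `L`.  All other memory contents are arbitrary. -/
def EdgeList.IsInput {n m : ℕ} {G : SimpleGraph (Fin n)} (L : EdgeList G m) (s : State) : Prop :=
  s.var .m = m ∧ ∀ i : Fin m,
    s.arr .ends i 0 = ((L.ends i).1 : ℕ) ∧ s.arr .ends i 1 = ((L.ends i).2 : ℕ)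

/-- The array `color` in the memory `s` describes a proper edge coloring of `G` by `{1, …, k}`: all
edges are colored, and distinct edges that share an endpoint have distinct colors (a proper vertex
coloring of the line graph). -/
def EdgeList.IsProperColoring {n m : ℕ} {G : SimpleGraph (Fin n)} (L : EdgeList G m) (k : ℕ)
    (s : State) : Prop :=
  ∃ χ : G.lineGraph.Coloring (Finset.Icc 1 k), ∀ i : Fin m,
    s.arr .color i 0 = (χ (L.edge i) : ℕ)

end ColorEdges

/-!
The expected running time is handled by the transformer `ert`: `ert P f s` is the expected number of
steps of the program `P` from memory `s`, plus the expected value of `f` at the final memory. It is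
defined by recursion on programs, with a least fixed point for a loop, and the machine loses
exactly one unit of it per step in expectation (`one_add_expect_step`). Hence it bounds
`expectedTime` (`expectedTime_le_ert`), and a final memory at which `f` is infinite is never reached
if `ert P f s` is finite (`lt_top_of_mem_support`). So a single bound for `ert`, with a cost `f` that
vanishes at proper colorings and is infinite elsewhere, yields correctness, termination and the
running time.

A round is correct by Vizing's argument (`Repr.runs_extendColoring`): the exchange of colors on the
alternating path makes `c₁` missing at the center, and either the whole fan, or its part up to the
leaf before the edge of color `c₁`, is still a fan whose last leaf misses `c₁`. Each round lowers the
number of uncolored edges by one.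

Let `W` be the weight of the graph, and consider a round with `l` uncolored edges. Its cost is at
most proportional to the degree of the center plus the length of the alternating path; finding a
random missing color fits into this, for either the degree is more than half of the maximum degree,
or at least half of all colors are missing. The degrees of the centers of all uncolored edges add
up to at most `W`. For the paths, count the triples of a center `u`, a color `c₀` missing at `u` and a
color `c₁`: an edge `e` is an inner edge of the path of at most `2 * w(e)` triples, as the path can be
traced back from `e`, its direction on `e` and its other color, which both ends of `e` have
(`sum_innerLen_le`). So all these paths together have at most `2 * W` inner edges. Given the edge that
is colored, hence `u` and `c₁`, the color `c₀` is uniform among the colors missing at `u`, and these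
are more than the uncolored edges at `u`; thus the expected path lengths for the different uncolored
edges add up to at most `2 * l + 2 * W` (`sum_expected_pathLen_le`). Averaging over the `l` uncolored
edges, the round costs `O(W / l)` in expectation (`Repr.ert_colorOneEdge_le`), and the harmonic sum
over `l = m, …, 1` gives `O(W log m) = O(W log n)`.

Finally `W ≤ 2 * m * α` for the arboricity `α` (`graphWeight_le_arboricity`): the edges of weight more
than `t` are induced by the vertices of degree more than `t`, so they are at most `α` times as many;
now sum over `t`.

The numerical constants are step counts of the programs, generously rounded up.
-/

/-! ### Expected cost of programs -/

namespace ColorEdges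

open scoped ENNReal

/-- The expected cost of a program, as a transformer of final costs: `ert P f s` is the expected
number of steps of `P` from memory `s`, plus the expected value of the cost `f` of the final memory.
A loop is the least fixed point of its unrolling. -/
noncomputable def ert : Cmd → (State → ℝ≥0∞) →o (State → ℝ≥0∞)
  | .set v p =>
    ⟨fun f s => 1 + f (s.setVar v (p.eval s)), fun _ _ h _ => add_le_add_right (h _) 1⟩
  | .store a i j p =>
    ⟨fun f s => 1 + f (s.setCell a (i.eval s) (j.eval s) (p.eval s)),
      fun _ _ h _ => add_le_add_right (h _) 1⟩
  | .rand v p =>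
    ⟨fun f s => 1 + (∑ w : Fin (p.eval s + 1), f (s.setVar v w)) / ((p.eval s + 1 : ℕ) : ℝ≥0∞),
      fun _ _ h _ => add_le_add_right
        (ENNReal.div_le_div_right (Finset.sum_le_sum fun _ _ => h _) _) 1⟩
  | .seq P Q =>
    ⟨fun f s => 1 + ert P (ert Q f) s,
      fun _ _ h s => add_le_add_right ((ert P).mono ((ert Q).mono h) s) 1⟩
  | .ite b P Q =>
    ⟨fun f s => 1 + if b.holds s then ert P f s else ert Q f s, fun f g h s => by
      have h1 := (ert P).mono h s
      have h2 := (ert Q).mono h s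
      refine add_le_add_right ?_ 1
      split_ifs <;> assumption⟩
  | .skip => ⟨fun f s => 1 + f s, fun _ _ h _ => add_le_add_right (h _) 1⟩
  | .loop b P =>
    ⟨fun f => OrderHom.lfp
      ⟨fun X s => 1 + if b.holds s then ert P X s else f s, fun X Y h s => by
        have h1 := (ert P).mono h s
        refine add_le_add_right ?_ 1
        split_ifs <;> [exact h1; exact le_rfl]⟩,
      fun f g h => OrderHom.lfp.mono fun X s => by
        have h1 := h s
        refine add_le_add_right ?_ 1
        split_ifs <;> [exact le_rfl; exact h1]⟩

theorem ert_set (v : Var) (p : Expr) (f : State → ℝ≥0∞) (s : State) :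
    ert (.set v p) f s = 1 + f (s.setVar v (p.eval s)) := rfl

theorem ert_rand (v : Var) (p : Expr) (f : State → ℝ≥0∞) (s : State) :
    ert (.rand v p) f s =
      1 + (∑ w ∈ Finset.range (p.eval s + 1), f (s.setVar v w)) / ((p.eval s + 1 : ℕ) : ℝ≥0∞) := by
  rw [← Fin.sum_univ_eq_sum_range (fun w => f (s.setVar v w))]
  rfl

theorem ert_seq (P Q : Cmd) (f : State → ℝ≥0∞) (s : State) :
    ert (P ;; Q) f s = 1 + ert P (ert Q f) s := rfl

theorem ert_ite (b : Test) (P Q : Cmd) (f : State → ℝ≥0∞) (s : State) :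
    ert (.ite b P Q) f s = 1 + if b.holds s then ert P f s else ert Q f s := rfl

theorem ert_loop (b : Test) (P : Cmd) (f : State → ℝ≥0∞) (s : State) :
    ert (.loop b P) f s =
      1 + if b.holds s then ert P (ert (.loop b P) f) s else f s :=
  (congrFun (OrderHom.map_lfp (⟨fun X s => 1 + if b.holds s then ert P X s else f s, _⟩ :
    (State → ℝ≥0∞) →o (State → ℝ≥0∞))) s).symm

/-- Park induction: a function that does not increase under unrolling bounds the cost of the
loop. -/
theorem ert_loop_le {b : Test} {P : Cmd} {f I : State → ℝ≥0∞}
    (h : ∀ s, 1 + (if b.holds s then ert P I s else f s) ≤ I s) : ert (.loop b P) f ≤ I :=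
  OrderHom.lfp_le _ h

/-! ### Adequacy of the cost transformer -/

/-- Expected value of a cost under a probability mass function. -/
noncomputable def expect {α : Type*} (p : PMF α) (g : α → ℝ≥0∞) : ℝ≥0∞ := ∑' a, p a * g a

theorem expect_pure {α : Type*} (a : α) (g : α → ℝ≥0∞) : expect (PMF.pure a) g = g a := by
  rw [expect, tsum_eq_single a] <;> simp +contextual [PMF.pure_apply]

theorem expect_bind {α β : Type*} (p : PMF α) (k : α → PMF β) (g : β → ℝ≥0∞) :
    expect (p.bind k) g = expect p fun a => expect (k a) g := by
  simp only [expect, PMF.bind_apply, ← ENNReal.tsum_mul_right, ← ENNReal.tsum_mul_left]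
  rw [ENNReal.tsum_comm]
  simp only [mul_assoc]

theorem expect_map {α β : Type*} (p : PMF α) (k : α → β) (g : β → ℝ≥0∞) :
    expect (p.map k) g = expect p (g ∘ k) := by
  rw [PMF.map, expect_bind]
  simp only [Function.comp, expect_pure]
  rfl

theorem expect_uniform_fin (k : ℕ) (g : Fin (k + 1) → ℝ≥0∞) :
    expect (PMF.uniformOfFintype (Fin (k + 1))) g = (∑ w, g w) / ((k + 1 : ℕ) : ℝ≥0∞) := by
  simp only [expect, PMF.uniformOfFintype_apply, Fintype.card_fin, tsum_fintype]
  rw [← Finset.mul_sum, mul_comm, div_eq_mul_inv]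

/-- The expected cost of the programs on a stack. -/
noncomputable def stackErt (f : State → ℝ≥0∞) : List Cmd → State → ℝ≥0∞
  | [] => f
  | P :: K => ert P (stackErt f K)

/-- The cost of a configuration drops by one in each step of a machine that has not halted. -/
theorem one_add_expect_step (f : State → ℝ≥0∞) (κ : Config) :
    (if κ.1 ≠ [] then 1 else 0) + expect (step κ) (fun κ' => stackErt f κ'.1 κ'.2) =
      stackErt f κ.1 κ.2 := by
  obtain ⟨_ | ⟨P, K⟩, s⟩ := κ
  · simp [step, expect_pure]
  · cases P with
    | rand v p =>
      have h (g : ℕ → ℝ≥0∞) :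
          expect (do let w ← PMF.uniformOfFintype (Fin (p.eval s + 1)); pure (w : ℕ)) g =
            (∑ w : Fin (p.eval s + 1), g w) / ((p.eval s + 1 : ℕ) : ℝ≥0∞) :=
        (expect_map _ (fun w : Fin (p.eval s + 1) => (w : ℕ)) g).trans (expect_uniform_fin _ _)
      simp only [step, expect_map, h, ne_eq, reduceCtorEq, not_false_eq_true, if_true]
      rfl
    | ite b P Q =>
      simp only [step, expect_pure, ne_eq, reduceCtorEq, not_false_eq_true, if_true, stackErt,
        ert_ite]
      split_ifs <;> rfl
    | loop b P =>
      simp only [step, expect_pure, ne_eq, reduceCtorEq, not_false_eq_true, if_true, stackErt]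
      rw [ert_loop]
      split_ifs <;> rfl
    | _ => simp only [step, expect_pure, ne_eq, reduceCtorEq, not_false_eq_true, if_true]; rfl

/-- The number of steps spent so far plus the cost that is still to come is preserved in
expectation. -/
theorem sum_add_expect_configAfter (f : State → ℝ≥0∞) (P : Cmd) (s : State) (N : ℕ) :
    (∑ t ∈ Finset.range N, (configAfter P s t).toOuterMeasure {κ | κ.1 ≠ []}) +
      expect (configAfter P s N) (fun κ => stackErt f κ.1 κ.2) = ert P f s := by
  induction N with
  | zero => simp [configAfter, expect_pure, stackErt]
  | succ N ih =>
    rw [Finset.sum_range_succ, ← ih, configAfter, expect_bind, add_assoc]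
    congr 1
    rw [PMF.toOuterMeasure_apply, expect, expect, ← ENNReal.tsum_add]
    refine tsum_congr fun κ => ?_
    rw [← one_add_expect_step f κ, mul_add]
    congr 1
    by_cases h : κ.1 = [] <;> simp [h]

theorem expectedTime_le_ert (f : State → ℝ≥0∞) (P : Cmd) (s : State) :
    expectedTime P s ≤ ert P f s := by
  rw [expectedTime, ENNReal.tsum_eq_iSup_nat]
  exact iSup_le fun N => le_self_add.trans_eq (sum_add_expect_configAfter f P s N)

/-- A final memory of infinite cost is never reached by a program of finite expected cost. -/
theorem lt_top_of_mem_support {f : State → ℝ≥0∞} {P : Cmd} {s : State} (h : ert P f s < ⊤)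
    {t : ℕ} {s' : State} (hs : ([], s') ∈ (configAfter P s t).support) : f s' < ⊤ := by
  rw [← sum_add_expect_configAfter f P s t] at h
  have h1 : expect (configAfter P s t) (fun κ => stackErt f κ.1 κ.2) ≠ ⊤ :=
    (le_add_self.trans_lt h).ne
  by_contra h2
  have h3 := ENNReal.ne_top_of_tsum_ne_top h1 ([], s')
  rw [PMF.mem_support_iff] at hs
  simp only [stackErt, not_lt, top_le_iff] at h2 h3
  rw [h2] at h3
  exact h3 (ENNReal.mul_top hs)

/-! ### Deterministic programs -/

/-- Programs without loops and random words. -/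
def Cmd.Straight : Cmd → Prop
  | .set .. | .store .. | .skip => True
  | .seq P Q => P.Straight ∧ Q.Straight
  | .ite _ P Q => P.Straight ∧ Q.Straight
  | .rand .. | .loop .. => False

/-- The memory after a straight-line program. -/
def Cmd.exec : Cmd → State → State
  | .set v p, s => s.setVar v (p.eval s)
  | .store a i j p, s => s.setCell a (i.eval s) (j.eval s) (p.eval s)
  | .seq P Q, s => Q.exec (P.exec s)
  | .ite b P Q, s => if b.holds s then P.exec s else Q.exec s
  | .skip, s | .rand .., s | .loop .., s => s

theorem Cmd.exec_seq (P Q : Cmd) (s : State) : (P ;; Q).exec s = Q.exec (P.exec s) := rfl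

theorem Cmd.exec_set (v : Var) (p : Expr) (s : State) :
    (Cmd.set v p).exec s = s.setVar v (p.eval s) := rfl

theorem Cmd.exec_store (a : Arr) (i j p : Expr) (s : State) :
    (Cmd.store a i j p).exec s = s.setCell a (i.eval s) (j.eval s) (p.eval s) := rfl

theorem Cmd.exec_ite_true {b : Test} {P Q : Cmd} {s : State} (h : b.holds s = true) :
    (Cmd.ite b P Q).exec s = P.exec s := if_pos h

theorem Cmd.exec_ite_false {b : Test} {P Q : Cmd} {s : State} (h : ¬ b.holds s = true) :
    (Cmd.ite b P Q).exec s = Q.exec s := if_neg h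

/-- A bound for the number of steps of a straight-line program. -/
def Cmd.size : Cmd → ℕ
  | .seq P Q => 1 + P.size + Q.size
  | .ite _ P Q => 1 + max P.size Q.size
  | _ => 1

theorem ert_straight : ∀ {P : Cmd}, P.Straight → ∀ (f : State → ℝ≥0∞) (s : State),
    ert P f s ≤ (P.size : ℝ≥0∞) + f (P.exec s)
  | .set .., _, f, s | .store .., _, f, s | .skip, _, f, s => by
    simp only [Cmd.size, Nat.cast_one]; exact le_rfl
  | .seq P Q, h, f, s => by
    rw [ert_seq]
    calc 1 + ert P (ert Q f) s ≤ 1 + ((P.size : ℝ≥0∞) + ert Q f (P.exec s)) := by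
            gcongr; exact ert_straight h.1 _ _
      _ ≤ 1 + ((P.size : ℝ≥0∞) + ((Q.size : ℝ≥0∞) + f (Q.exec (P.exec s)))) := by
            gcongr; exact ert_straight h.2 _ _
      _ = _ := by simp only [Cmd.size, Cmd.exec]; push_cast; ring
  | .ite b P Q, h, f, s => by
    rw [ert_ite]
    simp only [Cmd.size, Cmd.exec]
    push_cast
    rw [add_assoc]
    gcongr
    split_ifs
    · exact (ert_straight h.1 f s).trans (by gcongr; exact le_max_left _ _)
    · exact (ert_straight h.2 f s).trans (by gcongr; exact le_max_right _ _)

/-- From memory `s`, the program `P` ends almost surely in one particular memory, which satisfies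
`Q`, and takes at most `N` steps in expectation.  The final memory does not depend on the cost `f`;
so running `P` costs no more than `N`, whatever is to be paid afterwards. -/
def Runs (P : Cmd) (s : State) (N : ℕ) (Q : State → Prop) : Prop :=
  ∃ s', Q s' ∧ ∀ f : State → ℝ≥0∞, ert P f s ≤ (N : ℝ≥0∞) + f s'

theorem Runs.straight {P : Cmd} {s : State} {N : ℕ} {Q : State → Prop} (h : P.Straight)
    (hQ : Q (P.exec s)) (hN : P.size ≤ N) : Runs P s N Q :=
  ⟨_, hQ, fun f => (ert_straight h f s).trans (by gcongr)⟩

theorem Runs.mono {P : Cmd} {s : State} {N N' : ℕ} {Q Q' : State → Prop} (h : Runs P s N Q)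
    (hN : N ≤ N') (hQ : ∀ s', Q s' → Q' s') : Runs P s N' Q' := by
  obtain ⟨s', h1, h2⟩ := h
  exact ⟨s', hQ _ h1, fun f => (h2 f).trans (by gcongr)⟩

theorem Runs.seq {P P' : Cmd} {s : State} {N N' : ℕ} {Q R : State → Prop} (h : Runs P s N Q)
    (h' : ∀ s', Q s' → Runs P' s' N' R) : Runs (P ;; P') s (1 + N + N') R := by
  obtain ⟨s1, h1, h2⟩ := h
  obtain ⟨s2, h3, h4⟩ := h' s1 h1
  refine ⟨s2, h3, fun f => ?_⟩
  rw [ert_seq]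
  calc 1 + ert P (ert P' f) s ≤ 1 + ((N : ℝ≥0∞) + ((N' : ℝ≥0∞) + f s2)) := by
        gcongr; exact (h2 _).trans (by gcongr; exact h4 f)
    _ = _ := by push_cast; ring

theorem Runs.exec_seq {P P' : Cmd} {s : State} {N' k : ℕ} {R : State → Prop} (h : P.Straight)
    (hk : P.size ≤ k) (h' : Runs P' (P.exec s) N' R) : Runs (P ;; P') s (1 + k + N') R :=
  Runs.seq (Q := fun s' => s' = P.exec s) (Runs.straight h rfl hk) fun _ hs => hs ▸ h'

theorem Runs.set_seq {v : Var} {p : Expr} {P : Cmd} {s : State} {N : ℕ} {R : State → Prop}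
    (h : Runs P (s.setVar v (p.eval s)) N R) : Runs (.set v p ;; P) s (2 + N) R :=
  Runs.exec_seq (k := 1) trivial le_rfl h

theorem Runs.store_seq {a : Arr} {i j p : Expr} {P : Cmd} {s : State} {N : ℕ} {R : State → Prop}
    (h : Runs P (s.setCell a (i.eval s) (j.eval s) (p.eval s)) N R) :
    Runs (.store a i j p ;; P) s (2 + N) R :=
  Runs.exec_seq (k := 1) trivial le_rfl h

theorem Runs.ite_true {b : Test} {P P' : Cmd} {s : State} {N : ℕ} {Q : State → Prop}
    (hb : b.holds s = true) (h : Runs P s N Q) : Runs (.ite b P P') s (1 + N) Q := by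
  obtain ⟨s1, h1, h2⟩ := h
  refine ⟨s1, h1, fun f => ?_⟩
  rw [ert_ite, if_pos hb]
  push_cast
  rw [add_assoc]
  gcongr
  exact h2 f

theorem Runs.ite_false {b : Test} {P P' : Cmd} {s : State} {N : ℕ} {Q : State → Prop}
    (hb : b.holds s = false) (h : Runs P' s N Q) : Runs (.ite b P P') s (1 + N) Q := by
  obtain ⟨s1, h1, h2⟩ := h
  refine ⟨s1, h1, fun f => ?_⟩
  rw [ert_ite, if_neg (by simp [hb])]
  push_cast
  rw [add_assoc]
  gcongr
  exact h2 f

/-- The loop rule for a bounded number of iterations: the invariant `I j` holds after `j`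
iterations, of which there are at most `L`. -/
theorem Runs.loop {b : Test} {P : Cmd} {N L : ℕ} {Q : State → Prop} {I : ℕ → State → Prop}
    (hI : ∀ j s, j ≤ L → I j s →
      (b.holds s = false ∧ Q s) ∨
        (b.holds s = true ∧ j < L ∧ Runs P s N (I (j + 1)))) {s : State} (h0 : I 0 s) :
    Runs (.loop b P) s (1 + L * (N + 1)) Q := by
  suffices h : ∀ k j s, j + k = L → I j s → Runs (.loop b P) s (1 + k * (N + 1)) Q from
    h L 0 s (Nat.zero_add L) h0
  intro k
  induction k with
  | zero =>
    intro j s hj hs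
    rcases hI j s (by omega) hs with ⟨hb, hQ⟩ | ⟨_, hj', _⟩
    · refine ⟨s, hQ, fun f => ?_⟩
      rw [ert_loop, if_neg (by simp [hb])]
      simp
    · omega
  | succ k ih =>
    intro j s hj hs
    rcases hI j s (by omega) hs with ⟨hb, hQ⟩ | ⟨hb, _, hr⟩
    · refine ⟨s, hQ, fun f => ?_⟩
      rw [ert_loop, if_neg (by simp [hb])]
      gcongr
      exact_mod_cast Nat.le_add_right 1 _
    · obtain ⟨s1, h1, h2⟩ := hr
      obtain ⟨s2, h3, h4⟩ := ih (j + 1) s1 (by omega) h1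
      refine ⟨s2, h3, fun f => ?_⟩
      rw [ert_loop, if_pos hb]
      calc 1 + ert P (ert (.loop b P) f) s
          ≤ 1 + ((N : ℝ≥0∞) + (((1 + k * (N + 1) : ℕ) : ℝ≥0∞) + f s2)) := by
            gcongr; exact (h2 _).trans (by gcongr; exact h4 f)
        _ = _ := by push_cast; ring

/-- The cost of a program that starts with a deterministic part. -/
theorem Runs.ert_seq_le {P P' : Cmd} {s : State} {N : ℕ} {Q : State → Prop} (h : Runs P s N Q)
    {f : State → ℝ≥0∞} {b : ℝ≥0∞} (h' : ∀ s', Q s' → ert P' f s' ≤ b) :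
    ert (P ;; P') f s ≤ ((1 + N : ℕ) : ℝ≥0∞) + b := by
  obtain ⟨s1, h1, h2⟩ := h
  rw [ert_seq]
  push_cast
  rw [add_assoc]
  gcongr
  exact (h2 _).trans (by gcongr; exact h' _ h1)

theorem Runs.ert_le {P : Cmd} {s : State} {N : ℕ} {Q : State → Prop} (h : Runs P s N Q)
    {f : State → ℝ≥0∞} {b : ℝ≥0∞} (h' : ∀ s', Q s' → f s' ≤ b) :
    ert P f s ≤ (N : ℝ≥0∞) + b := by
  obtain ⟨s1, h1, h2⟩ := h
  exact (h2 _).trans (by gcongr; exact h' _ h1)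

/-! ### Reading and writing memory -/

@[simp] theorem State.setVar_var (s : State) (v v' : Var) (w : ℕ) :
    (s.setVar v w).var v' = if v' = v then w else s.var v' := by
  simp [State.setVar, Function.update_apply]

@[simp] theorem State.setVar_arr (s : State) (v : Var) (w : ℕ) : (s.setVar v w).arr = s.arr := rfl

@[simp] theorem State.setCell_var (s : State) (a : Arr) (i j w : ℕ) :
    (s.setCell a i j w).var = s.var := rfl

@[simp] theorem State.setCell_arr_ne (s : State) {a a' : Arr} (i j w : ℕ) (h : a' ≠ a) :
    (s.setCell a i j w).arr a' = s.arr a' := by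
  simp [State.setCell, h]

@[simp] theorem State.setCell_arr_self (s : State) (a : Arr) (i j w i' j' : ℕ) :
    (s.setCell a i j w).arr a i' j' = if i' = i ∧ j' = j then w else s.arr a i' j' := by
  by_cases h : i' = i
  · subst h; simp [State.setCell, Function.update_apply]
  · simp [State.setCell, h]

theorem Test.holds_le {s : State} {p q : Expr} :
    (Test.le p q).holds s = true ↔ p.eval s ≤ q.eval s := decide_eq_true_iff

theorem Test.holds_eq {s : State} {p q : Expr} :
    (Test.eq p q).holds s = true ↔ p.eval s = q.eval s := decide_eq_true_iff

theorem Test.holds_not {s : State} {b : Test} :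
    (Test.not b).holds s = true ↔ ¬ b.holds s = true := by simp [Test.holds]

theorem Test.holds_and {s : State} {b d : Test} :
    (Test.and b d).holds s = true ↔ b.holds s = true ∧ d.holds s = true := Bool.and_eq_true_iff

theorem Test.holds_or {s : State} {b d : Test} :
    (Test.or b d).holds s = true ↔ b.holds s = true ∨ d.holds s = true := Bool.or_eq_true_iff

theorem Test.holds_lt {s : State} {p q : Expr} :
    (Test.lt p q).holds s = true ↔ p.eval s < q.eval s := decide_eq_true_iff

/-- The memories `s` and `s'` agree outside the registers `A` and the arrays `B`. -/
def Frame (A : List Var) (B : List Arr) (s s' : State) : Prop :=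
  (∀ v, v ∉ A → s'.var v = s.var v) ∧ ∀ a, a ∉ B → s'.arr a = s.arr a

theorem Frame.refl (A : List Var) (B : List Arr) (s : State) : Frame A B s s :=
  ⟨fun _ _ => rfl, fun _ _ => rfl⟩

theorem Frame.trans {A : List Var} {B : List Arr} {s s' s'' : State} (h : Frame A B s s')
    (h' : Frame A B s' s'') : Frame A B s s'' :=
  ⟨fun v hv => (h'.1 v hv).trans (h.1 v hv), fun a ha => (h'.2 a ha).trans (h.2 a ha)⟩

theorem Frame.mono {A A' : List Var} {B B' : List Arr} {s s' : State} (h : Frame A B s s')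
    (hA : A ⊆ A') (hB : B ⊆ B') : Frame A' B' s s' :=
  ⟨fun v hv => h.1 v fun h' => hv (hA h'), fun a ha => h.2 a fun h' => ha (hB h')⟩

theorem Frame.setVar {A : List Var} {B : List Arr} {s s' : State} (h : Frame A B s s') {v : Var}
    (hv : v ∈ A) (w : ℕ) : Frame A B s (s'.setVar v w) :=
  ⟨fun v' hv' => by
    rw [State.setVar_var, if_neg (by rintro rfl; exact hv' hv), h.1 v' hv'], h.2⟩

theorem Frame.setCell {A : List Var} {B : List Arr} {s s' : State} (h : Frame A B s s') {a : Arr}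
    (ha : a ∈ B) (i j w : ℕ) : Frame A B s (s'.setCell a i j w) :=
  ⟨h.1, fun a' ha' => by
    rw [State.setCell_arr_ne _ _ _ _ (by rintro rfl; exact ha' ha), h.2 a' ha']⟩

/-- The registers and arrays that a straight-line program writes. -/
def Cmd.writes : Cmd → List Var × List Arr
  | .set v _ | .rand v _ => ([v], [])
  | .store a _ _ _ => ([], [a])
  | .seq P Q | .ite _ P Q => (P.writes.1 ++ Q.writes.1, P.writes.2 ++ Q.writes.2)
  | .skip => ([], [])
  | .loop _ P => P.writes

theorem Cmd.frame_exec : ∀ (P : Cmd) (s : State), Frame P.writes.1 P.writes.2 s (P.exec s)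
  | .set v p, s => (Frame.refl _ _ s).setVar (by simp [writes]) _
  | .store a i j p, s => (Frame.refl _ _ s).setCell (by simp [writes]) _ _ _
  | .skip, s | .rand .., s | .loop .., s => Frame.refl _ _ s
  | .seq P Q, s => by
    refine ((P.frame_exec s).mono ?_ ?_).trans ((Q.frame_exec (P.exec s)).mono ?_ ?_) <;>
      simp [writes]
  | .ite b P Q, s => by
    simp only [exec]
    split_ifs
    · exact (P.frame_exec s).mono (by simp [writes]) (by simp [writes])
    · exact (Q.frame_exec s).mono (by simp [writes]) (by simp [writes])

end ColorEdges

/-! ### Partial edge colorings of a graph given by an edge list -/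

namespace ColorEdges

/-- A finite simple graph without isolated vertices: the edges are the numbers below `m`, and the
vertices are the ends of edges.  The values of `fst` and `snd` at other numbers are irrelevant. -/
structure IndexedGraph where
  m : ℕ
  fst : ℕ → ℕ
  snd : ℕ → ℕ
  fst_ne_snd : ∀ e < m, fst e ≠ snd e
  simple : ∀ e < m, ∀ f < m, ∀ u v, u ≠ v → (u = fst e ∨ u = snd e) → (v = fst e ∨ v = snd e) →
    (u = fst f ∨ u = snd f) → (v = fst f ∨ v = snd f) → e = f

namespace IndexedGraph

variable (H : IndexedGraph)

/-- The vertex `v` is an end of the edge `e`. -/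
abbrev Inc (e v : ℕ) : Prop := v = H.fst e ∨ v = H.snd e

/-- The end of the edge `e` other than `v`. -/
def other (e v : ℕ) : ℕ := if H.fst e = v then H.snd e else H.fst e

/-- The number of edges at `v`. -/
def deg (v : ℕ) : ℕ := ((Finset.range H.m).filter fun e => H.Inc e v).card

/-- The maximum degree; it is `0` if there are no edges. -/
def maxDeg : ℕ := (Finset.range H.m).sup fun e => max (H.deg (H.fst e)) (H.deg (H.snd e))

/-- The end of smaller degree of an edge. -/
def center (e : ℕ) : ℕ := if H.deg (H.fst e) ≤ H.deg (H.snd e) then H.fst e else H.snd e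

/-- The sum of the minima of the degrees of the two ends over all edges. -/
def weight : ℕ := ∑ e ∈ Finset.range H.m, min (H.deg (H.fst e)) (H.deg (H.snd e))

/-- The vertices: the ends of edges. -/
def verts : Finset ℕ := (Finset.range H.m).image H.fst ∪ (Finset.range H.m).image H.snd

variable {H}

theorem mem_verts {v : ℕ} : v ∈ H.verts ↔ ∃ e < H.m, H.Inc e v := by
  simp only [verts, Finset.mem_union, Finset.mem_image, Finset.mem_range, Inc]
  grind

theorem inc_other {e v : ℕ} : H.Inc e (H.other e v) := by
  unfold other Inc; split_ifs <;> simp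

theorem other_ne {e v : ℕ} (he : e < H.m) : H.other e v ≠ v := by
  have := H.fst_ne_snd e he
  unfold other; grind

theorem other_other {e v : ℕ} (h : H.Inc e v) : H.other e (H.other e v) = v := by
  unfold other; grind

theorem eq_or_eq_other {e v w : ℕ} (h : H.Inc e v) (hw : H.Inc e w) : w = v ∨ w = H.other e v := by
  unfold other; grind

theorem inc_center {e : ℕ} : H.Inc e (H.center e) := by
  unfold center Inc; split_ifs <;> simp

theorem deg_center (e : ℕ) : H.deg (H.center e) = min (H.deg (H.fst e)) (H.deg (H.snd e)) := by
  unfold center; split_ifs <;> omega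

theorem deg_le_maxDeg (v : ℕ) : H.deg v ≤ H.maxDeg := by
  by_cases h : ∃ e < H.m, H.Inc e v
  · obtain ⟨e, he, hv⟩ := h
    have := Finset.le_sup (f := fun e => max (H.deg (H.fst e)) (H.deg (H.snd e)))
      (Finset.mem_range.2 he)
    rw [maxDeg]
    rcases hv with rfl | rfl <;> simp at this <;> omega
  · have : H.deg v = 0 := by
      rw [deg, Finset.card_eq_zero, Finset.filter_eq_empty_iff]
      intro e he hv
      exact h ⟨e, Finset.mem_range.1 he, hv⟩
    omega

theorem deg_pos {e v : ℕ} (he : e < H.m) (hv : H.Inc e v) : 0 < H.deg v :=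
  Finset.card_pos.2 ⟨e, Finset.mem_filter.2 ⟨Finset.mem_range.2 he, hv⟩⟩

theorem m_le_weight : H.m ≤ H.weight := by
  have h : ∑ _e ∈ Finset.range H.m, 1 ≤ H.weight := Finset.sum_le_sum fun e he =>
    le_min (deg_pos (Finset.mem_range.1 he) (Or.inl rfl))
      (deg_pos (Finset.mem_range.1 he) (Or.inr rfl))
  simpa using h

/-- Distinct edges at a vertex `v` are at most `deg v` in number. -/
theorem le_deg_of_injOn {v k : ℕ} {f : ℕ → ℕ} (hf : ∀ i < k, f i < H.m ∧ H.Inc (f i) v)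
    (hinj : ∀ j < k, ∀ i < j, f i ≠ f j) : k ≤ H.deg v := by
  have h := Finset.card_le_card_of_injOn (s := Finset.range k)
    (t := (Finset.range H.m).filter fun e => H.Inc e v) f
    (fun i hi => by
      have := hf i (by simpa using hi)
      simpa using this)
    (fun i hi j hj hij => by
      simp only [Finset.coe_range, Set.mem_Iio] at hi hj
      rcases lt_trichotomy i j with h | h | h
      · exact absurd hij (hinj j hj i h)
      · exact h
      · exact absurd hij.symm (hinj i hi j h))
  simpa [deg] using h

variable (H)

/-- In the partial coloring `col`, in which `0` means "uncolored", some edge at `v` has the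
color `c`. -/
def Has (col : ℕ → ℕ) (v c : ℕ) : Prop := ∃ e < H.m, H.Inc e v ∧ col e = c

/-- `col` is a proper partial edge coloring with the colors `1, …, maxDeg + 1`. -/
structure Proper (col : ℕ → ℕ) : Prop where
  le : ∀ e < H.m, col e ≤ H.maxDeg + 1
  inj : ∀ v e f, e < H.m → f < H.m → H.Inc e v → H.Inc f v → col e = col f → col e ≠ 0 → e = f

open Classical in
/-- The colors missing at `v`. -/
noncomputable def missing (col : ℕ → ℕ) (v : ℕ) : Finset ℕ :=
  (Finset.Icc 1 (H.maxDeg + 1)).filter fun c => ¬ H.Has col v c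

/-- The uncolored edges. -/
def uncolored (col : ℕ → ℕ) : Finset ℕ := (Finset.range H.m).filter fun e => col e = 0

variable {H} {col : ℕ → ℕ}

theorem mem_missing {v c : ℕ} :
    c ∈ H.missing col v ↔ (1 ≤ c ∧ c ≤ H.maxDeg + 1) ∧ ¬ H.Has col v c := by
  simp [missing]

theorem Proper.update_zero (h : H.Proper col) (g : ℕ) : H.Proper (Function.update col g 0) where
  le e he := by
    have := h.le e he
    simp only [Function.update_apply]; split_ifs <;> omega
  inj v e f he hf hev hfv := by
    have := h.inj v e f he hf hev hfv
    simp only [Function.update_apply]; grind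

theorem Proper.update (h : H.Proper col) {g c : ℕ} (hc : c ≤ H.maxDeg + 1)
    (hm : ∀ v, H.Inc g v → ¬ H.Has col v c) : H.Proper (Function.update col g c) where
  le e he := by
    have := h.le e he
    simp only [Function.update_apply]; split_ifs <;> omega
  inj v e f he hf hev hfv := by
    have h1 := h.inj v e f he hf hev hfv
    have h2 := hm v
    have h3 : col e = c → H.Has col v c := fun h => ⟨e, he, hev, h⟩
    have h4 : col f = c → H.Has col v c := fun h => ⟨f, hf, hfv, h⟩
    simp only [Function.update_apply]
    by_cases e = g <;> by_cases f = g <;> grind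

theorem has_update {g c c' v : ℕ} (hg : g < H.m) (h0 : col g = 0) (hc' : 1 ≤ c') :
    H.Has (Function.update col g c) v c' ↔ H.Has col v c' ∨ (H.Inc g v ∧ c' = c) := by
  constructor
  · rintro ⟨e, he, hev, h⟩
    by_cases heg : e = g
    · subst heg; right; exact ⟨hev, by simpa using h.symm⟩
    · left; exact ⟨e, he, hev, by simpa [heg] using h⟩
  · rintro (⟨e, he, hev, h⟩ | ⟨hev, rfl⟩)
    · have heg : e ≠ g := by rintro rfl; omega
      exact ⟨e, he, hev, by simpa [heg] using h⟩
    · exact ⟨g, hg, hev, by simp⟩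

theorem has_update_zero (hp : H.Proper col) {g c' v : ℕ} (hg : g < H.m) (hc' : 1 ≤ c') :
    H.Has (Function.update col g 0) v c' ↔ H.Has col v c' ∧ ¬ (H.Inc g v ∧ c' = col g) := by
  constructor
  · rintro ⟨e, he, hev, h⟩
    have heg : e ≠ g := by rintro rfl; simp at h; omega
    simp only [ne_eq, heg, not_false_eq_true, Function.update_of_ne] at h
    refine ⟨⟨e, he, hev, h⟩, fun h' => heg ?_⟩
    exact hp.inj v e g he hg hev h'.1 (by omega) (by omega)
  · rintro ⟨⟨e, he, hev, h⟩, hn⟩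
    have heg : e ≠ g := by rintro rfl; exact hn ⟨hev, h.symm⟩
    exact ⟨e, he, hev, by simpa [heg] using h⟩

open Classical in
theorem card_has_le (v : ℕ) (A : Finset ℕ) (hA : 0 ∉ A) :
    (A.filter fun c => H.Has col v c).card ≤
      ((Finset.range H.m).filter fun e => H.Inc e v ∧ col e ≠ 0).card := by
  refine (Finset.card_le_card ?_).trans (Finset.card_image_le (f := col))
  intro c hc
  obtain ⟨hcA, e, he, hev, rfl⟩ := Finset.mem_filter.1 hc
  refine Finset.mem_image.2 ⟨e, Finset.mem_filter.2 ⟨Finset.mem_range.2 he, hev, ?_⟩, rfl⟩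
  rintro h; rw [h] at hcA; exact hA hcA

theorem card_colored_add_card_uncolored (v : ℕ) :
    ((Finset.range H.m).filter fun e => H.Inc e v ∧ col e ≠ 0).card +
      ((Finset.range H.m).filter fun e => H.Inc e v ∧ col e = 0).card = H.deg v := by
  rw [deg]
  have h := Finset.card_filter_add_card_filter_not (fun e => col e ≠ 0)
    (s := (Finset.range H.m).filter fun e => H.Inc e v)
  rw [Finset.filter_filter, Finset.filter_filter] at h
  simpa only [not_not, ne_eq] using h

open Classical in
theorem card_has_le_deg (v : ℕ) (A : Finset ℕ) (hA : 0 ∉ A) :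
    (A.filter fun c => H.Has col v c).card ≤ H.deg v :=
  (card_has_le v A hA).trans
    (Nat.le_add_right _ _ |>.trans (card_colored_add_card_uncolored (col := col) v).le)

/-- One of the first `deg v + 1` colors is missing at `v`. -/
theorem exists_missing (col : ℕ → ℕ) (v : ℕ) :
    ∃ c, (1 ≤ c ∧ c ≤ H.deg v + 1) ∧ ¬ H.Has col v c := by
  classical
  by_contra! h
  have h1 := card_has_le_deg (H := H) (col := col) v (Finset.Icc 1 (H.deg v + 1)) (by simp)
  rw [Finset.filter_true_of_mem fun c hc => h c (Finset.mem_Icc.1 hc)] at h1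
  simp at h1

/-- There are more missing colors than uncolored edges at every vertex. -/
theorem card_uncolored_lt_card_missing (col : ℕ → ℕ) (v : ℕ) :
    ((Finset.range H.m).filter fun e => H.Inc e v ∧ col e = 0).card < (H.missing col v).card := by
  classical
  have h1 := card_has_le (H := H) (col := col) v (Finset.Icc 1 (H.maxDeg + 1)) (by simp)
  have h2 := card_colored_add_card_uncolored (H := H) (col := col) v
  have h3 := Finset.card_filter_add_card_filter_not (fun c => H.Has col v c)
    (s := Finset.Icc 1 (H.maxDeg + 1))
  have h4 := H.deg_le_maxDeg v
  rw [Nat.card_Icc] at h3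
  rw [missing]
  omega

theorem maxDeg_lt_card_missing_add_deg (col : ℕ → ℕ) (v : ℕ) :
    H.maxDeg + 1 ≤ (H.missing col v).card + H.deg v := by
  classical
  have h1 := card_has_le_deg (H := H) (col := col) v (Finset.Icc 1 (H.maxDeg + 1)) (by simp)
  have h3 := Finset.card_filter_add_card_filter_not (fun c => H.Has col v c)
    (s := Finset.Icc 1 (H.maxDeg + 1))
  rw [Nat.card_Icc] at h3
  rw [missing]
  omega

/-! ### Alternating paths -/

open Classical in
/-- The edge of color `c` at `v`, if there is one, and `0` otherwise. -/
noncomputable def edgeAt (H : IndexedGraph) (col : ℕ → ℕ) (v c : ℕ) : ℕ :=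
  if h : H.Has col v c then h.choose else 0

theorem edgeAt_spec {v c : ℕ} (h : H.Has col v c) :
    H.edgeAt col v c < H.m ∧ H.Inc (H.edgeAt col v c) v ∧ col (H.edgeAt col v c) = c := by
  rw [edgeAt, dif_pos h]; exact h.choose_spec

/-- The colors of the edges of an alternating path, which begins with color `c₁`. -/
def alt (c₀ c₁ i : ℕ) : ℕ := if i % 2 = 0 then c₁ else c₀

theorem alt_zero (c₀ c₁ : ℕ) : alt c₀ c₁ 0 = c₁ := rfl

theorem alt_add_two (c₀ c₁ i : ℕ) : alt c₀ c₁ (i + 2) = alt c₀ c₁ i := by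
  simp [alt]

theorem alt_cases (c₀ c₁ i : ℕ) : alt c₀ c₁ i = c₁ ∧ alt c₀ c₁ (i + 1) = c₀ ∨
    alt c₀ c₁ i = c₀ ∧ alt c₀ c₁ (i + 1) = c₁ := by
  rcases Nat.mod_two_eq_zero_or_one i with h | h
  · left; exact ⟨by simp [alt, h], by simp [alt, Nat.add_mod, h]⟩
  · right; exact ⟨by simp [alt, h], by simp [alt, Nat.add_mod, h]⟩

/-- The vertices of the alternating path that leaves `u` by its edge of color `c₁`.  They are
meaningful up to the index `pathLen`. -/
noncomputable def walk (H : IndexedGraph) (col : ℕ → ℕ) (u c₀ c₁ : ℕ) : ℕ → ℕ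
  | 0 => u
  | i + 1 => H.other (H.edgeAt col (walk H col u c₀ c₁ i) (alt c₀ c₁ i)) (walk H col u c₀ c₁ i)

/-- The edges of the alternating path. -/
noncomputable def walkEdge (H : IndexedGraph) (col : ℕ → ℕ) (u c₀ c₁ i : ℕ) : ℕ :=
  H.edgeAt col (H.walk col u c₀ c₁ i) (alt c₀ c₁ i)

/-- The number of edges of the maximal alternating path. -/
noncomputable def pathLen (H : IndexedGraph) (col : ℕ → ℕ) (u c₀ c₁ : ℕ) : ℕ :=
  sInf {i | ¬ H.Has col (H.walk col u c₀ c₁ i) (alt c₀ c₁ i)}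

theorem walk_succ (u c₀ c₁ i : ℕ) : H.walk col u c₀ c₁ (i + 1) =
    H.other (H.walkEdge col u c₀ c₁ i) (H.walk col u c₀ c₁ i) := rfl

variable {u c₀ c₁ : ℕ}

theorem has_walk {i : ℕ} (hi : i < H.pathLen col u c₀ c₁) :
    H.Has col (H.walk col u c₀ c₁ i) (alt c₀ c₁ i) := by
  have := Nat.notMem_of_lt_sInf hi
  simpa using this

section Distinct

variable (hp : H.Proper col) (h0 : ¬ H.Has col u c₀) (hc₀ : c₀ ≠ 0) (hc₁ : c₁ ≠ 0) {L : ℕ}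
  (hL : ∀ i < L, H.Has col (H.walk col u c₀ c₁ i) (alt c₀ c₁ i))

include hL

theorem walkEdge_spec {i : ℕ} (hi : i < L) : H.walkEdge col u c₀ c₁ i < H.m ∧
    H.Inc (H.walkEdge col u c₀ c₁ i) (H.walk col u c₀ c₁ i) ∧
    H.Inc (H.walkEdge col u c₀ c₁ i) (H.walk col u c₀ c₁ (i + 1)) ∧
    col (H.walkEdge col u c₀ c₁ i) = alt c₀ c₁ i :=
  have h := edgeAt_spec (hL i hi)
  ⟨h.1, h.2.1, inc_other, h.2.2⟩

include hp h0 hc₀ hc₁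

/-- The vertices of an alternating path are distinct. -/
theorem walk_ne (j : ℕ) (hj : j ≤ L) : ∀ i < j, H.walk col u c₀ c₁ i ≠ H.walk col u c₀ c₁ j := by
  induction j using Nat.strong_induction_on with
  | _ j ih =>
  intro i hi heq
  obtain ⟨j, rfl⟩ : ∃ k, j = k + 1 := ⟨j - 1, by omega⟩
  have h01 : c₀ ≠ c₁ := by
    rintro rfl
    exact h0 (by simpa [walk, alt] using hL 0 (by omega))
  obtain ⟨g1, g2, g3, g4⟩ := walkEdge_spec hL (i := j) (by omega)
  have hij : i ≠ j := by
    rintro rfl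
    rw [walk_succ] at heq
    exact other_ne g1 heq.symm
  -- the edge that closes the cycle has the color of the edge before or after the vertex `i`
  have hg : H.Inc (H.walkEdge col u c₀ c₁ j) (H.walk col u c₀ c₁ i) := heq ▸ g3
  have hne (k l : ℕ) (hk : k < l) (hl : l ≤ j) : H.walk col u c₀ c₁ k ≠ H.walk col u c₀ c₁ l :=
    ih l (by omega) (by omega) k hk
  have h00 (k : ℕ) : alt c₀ c₁ k ≠ 0 := by
    rcases alt_cases c₀ c₁ k with h | h <;> omega
  by_cases hcol : alt c₀ c₁ j = alt c₀ c₁ i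
  · obtain ⟨e1, e2, e3, e4⟩ := walkEdge_spec hL (i := i) (by omega)
    have hE : H.walkEdge col u c₀ c₁ j = H.walkEdge col u c₀ c₁ i :=
      hp.inj _ _ _ g1 e1 hg e2 (by omega) (by rw [g4]; exact h00 j)
    rw [hE] at g2
    rcases eq_or_eq_other e2 g2 with h | h
    · exact hne i j (by omega) le_rfl h.symm
    · rw [← walk_succ] at h
      rcases lt_or_eq_of_le (show i + 1 ≤ j by omega) with h' | h'
      · exact hne _ _ h' le_rfl h.symm
      · subst h'
        rcases alt_cases c₀ c₁ i with h | h <;> omega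
  · rcases i with _ | i
    · refine h0 ⟨_, g1, hg, ?_⟩
      rw [g4]
      rcases alt_cases c₀ c₁ j with h | h <;> simp_all [alt_zero]
    · obtain ⟨e1, e2, e3, e4⟩ := walkEdge_spec hL (i := i) (by omega)
      have hcol' : alt c₀ c₁ j = alt c₀ c₁ i := by
        rcases alt_cases c₀ c₁ j with h | h <;> rcases alt_cases c₀ c₁ i with h' | h' <;> omega
      have hE : H.walkEdge col u c₀ c₁ j = H.walkEdge col u c₀ c₁ i :=
        hp.inj _ _ _ g1 e1 hg e3 (by omega) (by rw [g4]; exact h00 j)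
      rw [hE] at g2
      rcases eq_or_eq_other e2 g2 with h | h
      · exact hne _ _ (by omega) le_rfl h.symm
      · rw [← walk_succ] at h
        exact hne _ _ (by omega) le_rfl h.symm

theorem walkEdge_ne (j : ℕ) (hj : j < L) :
    ∀ i < j, H.walkEdge col u c₀ c₁ i ≠ H.walkEdge col u c₀ c₁ j := by
  intro i hi heq
  obtain ⟨-, e2, -, -⟩ := walkEdge_spec hL (i := i) (by omega)
  obtain ⟨-, g2, -, -⟩ := walkEdge_spec hL hj
  rw [heq] at e2
  rcases eq_or_eq_other g2 e2 with h | h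
  · exact walk_ne hp h0 hc₀ hc₁ hL j (by omega) i hi h
  · rw [← walk_succ] at h
    exact walk_ne hp h0 hc₀ hc₁ hL (j + 1) (by omega) i (by omega) h

theorem le_m_of_forall_has : L ≤ H.m := by
  have h := Finset.card_le_card_of_injOn (s := Finset.range L) (t := Finset.range H.m)
    (H.walkEdge col u c₀ c₁)
    (fun i hi => by
      have := (walkEdge_spec hL (i := i) (by simpa using hi)).1
      simpa using this)
    (fun i hi j hj hij => by
      simp only [Finset.coe_range, Set.mem_Iio] at hi hj
      have h1 := walkEdge_ne hp h0 hc₀ hc₁ hL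
      rcases lt_trichotomy i j with h | h | h
      · exact absurd hij (h1 j hj i h)
      · exact h
      · exact absurd hij.symm (h1 i hi j h))
  simpa using h

end Distinct

section Flip

variable (hp : H.Proper col) (h0 : ¬ H.Has col u c₀) (hc₀ : c₀ ≠ 0) (hc₁ : c₁ ≠ 0)

include hp h0 hc₀ hc₁

/-- The alternating path is finite, since its edges are distinct; so the infimum that defines its
length is attained. -/
theorem not_has_walk_pathLen :
    ¬ H.Has col (H.walk col u c₀ c₁ (H.pathLen col u c₀ c₁))
      (alt c₀ c₁ (H.pathLen col u c₀ c₁)) := by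
  refine Nat.sInf_mem (s := {i | ¬ H.Has col (H.walk col u c₀ c₁ i) (alt c₀ c₁ i)}) ?_
  by_contra h
  rw [Set.not_nonempty_iff_eq_empty, Set.eq_empty_iff_forall_notMem] at h
  have := le_m_of_forall_has (L := H.m + 1) hp h0 hc₀ hc₁ fun i _ => by simpa using h i
  omega

/-- All edges of the two colors at a vertex of the path belong to the path. -/
theorem exists_walkEdge_eq {k h : ℕ} (hk : k ≤ H.pathLen col u c₀ c₁) (hh : h < H.m)
    (hi : H.Inc h (H.walk col u c₀ c₁ k)) (hc : col h = c₀ ∨ col h = c₁) :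
    ∃ i < H.pathLen col u c₀ c₁, h = H.walkEdge col u c₀ c₁ i := by
  have hL := fun i (hi : i < H.pathLen col u c₀ c₁) => has_walk hi
  by_cases hck : col h = alt c₀ c₁ k
  · rcases lt_or_eq_of_le hk with hk' | hk'
    · obtain ⟨e1, e2, e3, e4⟩ := walkEdge_spec hL hk'
      exact ⟨k, hk', hp.inj _ _ _ hh e1 hi e2 (by omega) (by omega)⟩
    · refine absurd (show H.Has col _ _ from ⟨h, hh, hi, hck⟩) ?_
      rw [hk']
      exact not_has_walk_pathLen hp h0 hc₀ hc₁
  · rcases k with _ | k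
    · refine absurd ⟨h, hh, hi, ?_⟩ h0
      rw [alt_zero] at hck
      omega
    · obtain ⟨e1, e2, e3, e4⟩ := walkEdge_spec hL (i := k) (by omega)
      refine ⟨k, by omega, hp.inj _ _ _ hh e1 hi e3 ?_ (by omega)⟩
      rcases alt_cases c₀ c₁ k with h' | h' <;> omega

omit hp h0 hc₀ hc₁

open Classical in
/-- The coloring in which the two colors are exchanged on the path. -/
noncomputable def flip (H : IndexedGraph) (col : ℕ → ℕ) (u c₀ c₁ : ℕ) (e : ℕ) : ℕ :=
  if ∃ i < H.pathLen col u c₀ c₁, e = H.walkEdge col u c₀ c₁ i then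
    if col e = c₀ then c₁ else c₀
  else col e

theorem flip_of_not {e : ℕ} (h : ¬ ∃ i < H.pathLen col u c₀ c₁, e = H.walkEdge col u c₀ c₁ i) :
    H.flip col u c₀ c₁ e = col e := if_neg h

theorem flip_of_mem {e : ℕ} (h : ∃ i < H.pathLen col u c₀ c₁, e = H.walkEdge col u c₀ c₁ i) :
    H.flip col u c₀ c₁ e = if col e = c₀ then c₁ else c₀ := if_pos h

theorem flip_walkEdge {i : ℕ} (h : i < H.pathLen col u c₀ c₁) (h01 : c₀ ≠ c₁) :
    H.flip col u c₀ c₁ (H.walkEdge col u c₀ c₁ i) = alt c₀ c₁ (i + 1) := by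
  rw [flip_of_mem ⟨i, h, rfl⟩, (walkEdge_spec (fun _ h => has_walk h) h).2.2.2]
  rcases alt_cases c₀ c₁ i with h | h
  · rw [h.1, h.2, if_neg h01.symm]
  · rw [h.1, h.2, if_pos rfl]

theorem col_walkEdge_cases {e : ℕ}
    (h : ∃ i < H.pathLen col u c₀ c₁, e = H.walkEdge col u c₀ c₁ i) : col e = c₀ ∨ col e = c₁ := by
  obtain ⟨i, hi, rfl⟩ := h
  rw [(walkEdge_spec (fun _ h => has_walk h) hi).2.2.2]
  rcases alt_cases c₀ c₁ i with h | h <;> simp [h.1]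

/-- The ends of the edges of the path are vertices of the path. -/
theorem exists_walk_eq {e v : ℕ}
    (h : ∃ i < H.pathLen col u c₀ c₁, e = H.walkEdge col u c₀ c₁ i) (hv : H.Inc e v) :
    ∃ k ≤ H.pathLen col u c₀ c₁, v = H.walk col u c₀ c₁ k := by
  obtain ⟨i, hi, rfl⟩ := h
  obtain ⟨-, e2, -, -⟩ := walkEdge_spec (fun _ h => has_walk h) hi
  rcases eq_or_eq_other e2 hv with h | h
  · exact ⟨i, hi.le, h⟩
  · exact ⟨i + 1, hi, h⟩

/-- The exchange concerns only the two colors. -/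
theorem not_has_flip_of_ne {v c : ℕ} (hn₀ : c ≠ c₀) (hn₁ : c ≠ c₁) (h : ¬ H.Has col v c) :
    ¬ H.Has (H.flip col u c₀ c₁) v c := by
  rintro ⟨e, he, hev, hc⟩
  by_cases hP : ∃ i < H.pathLen col u c₀ c₁, e = H.walkEdge col u c₀ c₁ i
  · rw [flip_of_mem hP] at hc
    split_ifs at hc <;> omega
  · rw [flip_of_not hP] at hc
    exact h ⟨e, he, hev, hc⟩

/-- A vertex that misses `c₁` and is no end of the path is not on the path, and still misses `c₁`
after the exchange. -/
theorem not_has_flip_of_ne_ends {v : ℕ} (hu : v ≠ u)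
    (hv : v ≠ H.walk col u c₀ c₁ (H.pathLen col u c₀ c₁)) (h : ¬ H.Has col v c₁) :
    ¬ H.Has (H.flip col u c₀ c₁) v c₁ := by
  rintro ⟨e, he, hev, hc⟩
  by_cases hP : ∃ i < H.pathLen col u c₀ c₁, e = H.walkEdge col u c₀ c₁ i
  · obtain ⟨k, hk, rfl⟩ := exists_walk_eq hP hev
    have hk0 : k ≠ 0 := by rintro rfl; exact hu rfl
    have hkL : k ≠ H.pathLen col u c₀ c₁ := by rintro rfl; exact hv rfl
    obtain ⟨k, rfl⟩ : ∃ i, k = i + 1 := ⟨k - 1, by omega⟩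
    have hL := fun i (hi : i < H.pathLen col u c₀ c₁) => has_walk hi
    obtain ⟨a1, a2, a3, a4⟩ := walkEdge_spec hL (i := k) (by omega)
    obtain ⟨b1, b2, b3, b4⟩ := walkEdge_spec hL (i := k + 1) (by omega)
    rcases alt_cases c₀ c₁ k with h' | h'
    · exact h ⟨_, a1, a3, by omega⟩
    · exact h ⟨_, b1, b2, by omega⟩
  · rw [flip_of_not hP] at hc
    exact h ⟨e, he, hev, hc⟩

theorem flip_eq_zero_iff (hc₀ : c₀ ≠ 0) (hc₁ : c₁ ≠ 0) {e : ℕ} :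
    H.flip col u c₀ c₁ e = 0 ↔ col e = 0 := by
  by_cases h : ∃ i < H.pathLen col u c₀ c₁, e = H.walkEdge col u c₀ c₁ i
  · have := col_walkEdge_cases h
    rw [flip_of_mem h]; split_ifs <;> omega
  · rw [flip_of_not h]

include hp h0 hc₀ hc₁

theorem Proper.flip (hle₀ : c₀ ≤ H.maxDeg + 1) (hle₁ : c₁ ≤ H.maxDeg + 1) :
    H.Proper (H.flip col u c₀ c₁) where
  le e he := by
    have := hp.le e he
    unfold IndexedGraph.flip; split_ifs <;> assumption
  inj v e f he hf hev hfv heq hne := by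
    have key : ∀ e f, e < H.m → f < H.m → H.Inc e v → H.Inc f v →
        (∃ i < H.pathLen col u c₀ c₁, e = H.walkEdge col u c₀ c₁ i) →
        H.flip col u c₀ c₁ e = H.flip col u c₀ c₁ f → e = f := by
      intro e f he hf hev hfv hP heq
      have hQ : ∃ i < H.pathLen col u c₀ c₁, f = H.walkEdge col u c₀ c₁ i := by
        by_contra hQ
        obtain ⟨k, hk, rfl⟩ := exists_walk_eq hP hev
        refine hQ (exists_walkEdge_eq hp h0 hc₀ hc₁ hk hf hfv ?_)
        rw [← flip_of_not hQ, ← heq, flip_of_mem hP]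
        split_ifs <;> simp
      have h1 := col_walkEdge_cases hP
      have h2 := col_walkEdge_cases hQ
      rw [flip_of_mem hP, flip_of_mem hQ] at heq
      refine hp.inj v e f he hf hev hfv ?_ (by omega)
      split_ifs at heq <;> omega
    by_cases hP : ∃ i < H.pathLen col u c₀ c₁, e = H.walkEdge col u c₀ c₁ i
    · exact key e f he hf hev hfv hP heq
    by_cases hQ : ∃ i < H.pathLen col u c₀ c₁, f = H.walkEdge col u c₀ c₁ i
    · exact (key f e hf he hfv hev hQ heq.symm).symm
    rw [flip_of_not hP] at heq hne
    rw [flip_of_not hQ] at heq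
    exact hp.inj v e f he hf hev hfv heq hne

/-- After the exchange, a vertex of the path that has missed `c₁` misses `c₀`. -/
theorem not_has_flip_walk₀ {k : ℕ} (hk : k ≤ H.pathLen col u c₀ c₁)
    (h : ¬ H.Has col (H.walk col u c₀ c₁ k) c₁) :
    ¬ H.Has (H.flip col u c₀ c₁) (H.walk col u c₀ c₁ k) c₀ := by
  rintro ⟨e, he, hev, hc⟩
  by_cases hP : ∃ i < H.pathLen col u c₀ c₁, e = H.walkEdge col u c₀ c₁ i
  · have := col_walkEdge_cases hP
    rw [flip_of_mem hP] at hc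
    refine h ⟨e, he, hev, ?_⟩
    split_ifs at hc <;> omega
  · refine hP (exists_walkEdge_eq hp h0 hc₀ hc₁ hk he hev (Or.inl ?_))
    rw [← hc, flip_of_not hP]

/-- The purpose of the exchange: afterwards, the center `u` misses `c₁` instead of `c₀`. -/
theorem not_has_flip_self : ¬ H.Has (H.flip col u c₀ c₁) u c₁ := by
  rintro ⟨e, he, hev, hc⟩
  by_cases hP : ∃ i < H.pathLen col u c₀ c₁, e = H.walkEdge col u c₀ c₁ i
  · have := col_walkEdge_cases hP
    rw [flip_of_mem hP] at hc
    refine h0 ⟨e, he, hev, ?_⟩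
    split_ifs at hc <;> omega
  · refine hP (exists_walkEdge_eq hp h0 hc₀ hc₁ (Nat.zero_le _) he hev (Or.inr ?_))
    rw [← hc, flip_of_not hP]

end Flip

/-! ### Fans -/

/-- The edges `f 0, …, f t` form a fan with center `u`: they are distinct edges at `u`, the first
one is uncolored, and the color of each other one is missing at the leaf of the preceding one. -/
structure Fan (H : IndexedGraph) (col : ℕ → ℕ) (u t : ℕ) (f : ℕ → ℕ) : Prop where
  inc : ∀ i ≤ t, f i < H.m ∧ H.Inc (f i) u
  ne : ∀ j ≤ t, ∀ i < j, f i ≠ f j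
  zero : col (f 0) = 0
  pos : ∀ i < t, col (f (i + 1)) ≠ 0
  miss : ∀ i < t, ¬ H.Has col (H.other (f i) u) (col (f (i + 1)))

/-- The coloring after the first `i` edges of the fan have received the colors of their
successors. -/
def shift (col f : ℕ → ℕ) : ℕ → ℕ → ℕ
  | 0 => col
  | i + 1 => Function.update (Function.update (shift col f i) (f (i + 1)) 0) (f i) (col (f (i + 1)))

section Fan

variable {t : ℕ} {f : ℕ → ℕ}

theorem Fan.mono (h : H.Fan col u t f) {q : ℕ} (hq : q ≤ t) : H.Fan col u q f where
  inc i hi := h.inc i (hi.trans hq)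
  ne j hj := h.ne j (hj.trans hq)
  zero := h.zero
  pos i hi := h.pos i (hi.trans_le hq)
  miss i hi := h.miss i (hi.trans_le hq)

theorem Fan.ne' (h : H.Fan col u t f) {i j : ℕ} (hi : i ≤ t) (hj : j ≤ t) (hij : i ≠ j) :
    f i ≠ f j := by
  rcases lt_or_gt_of_ne hij with h' | h'
  · exact h.ne j hj i h'
  · exact (h.ne i hi j h').symm

theorem Fan.lt_deg (h : H.Fan col u t f) : t < H.deg u :=
  le_deg_of_injOn (k := t + 1) (fun i hi => h.inc i (by omega)) (fun j hj => h.ne j (by omega))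

theorem Fan.shift_spec (h : H.Fan col u t f) {i : ℕ} (hi : i ≤ t) :
    (∀ k < i, shift col f i (f k) = col (f (k + 1))) ∧ shift col f i (f i) = 0 ∧
      ∀ e, (∀ k ≤ i, e ≠ f k) → shift col f i e = col e := by
  induction i with
  | zero => exact ⟨by simp, h.zero, fun _ _ => rfl⟩
  | succ i ih =>
    obtain ⟨h1, h2, h3⟩ := ih (by omega)
    refine ⟨fun k hk => ?_, ?_, fun e he => ?_⟩
    · rcases eq_or_ne k i with rfl | hki
      · simp [shift]
      · rw [shift, Function.update_of_ne (h.ne' (by omega) (by omega) hki),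
          Function.update_of_ne (h.ne' (by omega) (by omega) (by omega)), h1 k (by omega)]
    · rw [shift, Function.update_of_ne (h.ne' (by omega) (by omega) (by omega)),
        Function.update_self]
    · rw [shift, Function.update_of_ne (he i (by omega)), Function.update_of_ne (he _ le_rfl),
        h3 e fun k hk => he k (by omega)]

theorem Fan.shift_succ (h : H.Fan col u t f) {i : ℕ} (hi : i < t) :
    shift col f i (f (i + 1)) = col (f (i + 1)) :=
  (h.shift_spec hi.le).2.2 _ fun _ _ => h.ne' (by omega) (by omega) (by omega)

/-- Shifting does not create new colors at the leaf whose edge is uncolored: the edge of that leaf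
is its only edge in the fan. -/
theorem Fan.not_has_shift_leaf (h : H.Fan col u t f) {i c : ℕ} (hi : i ≤ t) (hc : c ≠ 0)
    (hm : ¬ H.Has col (H.other (f i) u) c) : ¬ H.Has (shift col f i) (H.other (f i) u) c := by
  rintro ⟨e, he, hev, hec⟩
  obtain ⟨-, h2, h3⟩ := h.shift_spec hi
  have hei : e ≠ f i := by rintro rfl; omega
  rw [h3 e] at hec
  · exact hm ⟨e, he, hev, hec⟩
  · rintro k hk rfl
    obtain ⟨k1, k2⟩ := h.inc k (by omega)
    obtain ⟨i1, i2⟩ := h.inc i hi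
    exact hei (H.simple _ k1 _ i1 u _ (other_ne i1).symm k2 hev i2 inc_other)

theorem Fan.not_has_shift_center (h : H.Fan col u t f) {i c : ℕ} (hi : i ≤ t) (hc : c ≠ 0)
    (hm : ¬ H.Has col u c) : ¬ H.Has (shift col f i) u c := by
  rintro ⟨e, he, hev, hec⟩
  obtain ⟨h1, h2, h3⟩ := h.shift_spec hi
  by_cases h' : ∃ k ≤ i, e = f k
  · obtain ⟨k, hk, rfl⟩ := h'
    rcases lt_or_eq_of_le hk with hk' | rfl
    · rw [h1 k hk'] at hec
      exact hm ⟨_, (h.inc (k + 1) (by omega)).1, (h.inc (k + 1) (by omega)).2, hec⟩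
    · omega
  · push Not at h'
    rw [h3 e h'] at hec
    exact hm ⟨e, he, hev, hec⟩

/-- Both ends of the edge `f i` miss the color of `f (i + 1)` once this edge has been uncolored. -/
theorem Fan.not_has_shift_update (h : H.Fan col u t f) {i : ℕ} (hi : i < t)
    (hp : H.Proper (shift col f i)) {v : ℕ} (hv : H.Inc (f i) v) :
    ¬ H.Has (Function.update (shift col f i) (f (i + 1)) 0) v (col (f (i + 1))) := by
  have h1 := h.inc (i + 1) hi
  have hpos := h.pos i hi
  rw [has_update_zero hp h1.1 (by omega), h.shift_succ hi]
  rintro ⟨h2, h3⟩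
  rcases eq_or_eq_other (h.inc i hi.le).2 hv with rfl | rfl
  · exact h3 ⟨h1.2, rfl⟩
  · exact h.not_has_shift_leaf hi.le hpos (h.miss i hi) h2

/-- A fan remains a fan under the exchange of colors, provided that a fan edge of color `c₁`, if
there is one, comes next after the leaf at which the path ends: there the exchange makes the new
color of that edge missing. -/
theorem Fan.flip (h : H.Fan col u t f) (hp : H.Proper col) (h0 : ¬ H.Has col u c₀) (hc₀ : c₀ ≠ 0)
    (hc₁ : c₁ ≠ 0)
    (hmiss : ∀ i < t, col (f (i + 1)) = c₁ →
      H.other (f i) u = H.walk col u c₀ c₁ (H.pathLen col u c₀ c₁)) :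
    H.Fan (H.flip col u c₀ c₁) u t f where
  inc := h.inc
  ne := h.ne
  zero := (flip_eq_zero_iff hc₀ hc₁).2 h.zero
  pos i hi := (flip_eq_zero_iff hc₀ hc₁).not.2 (h.pos i hi)
  miss i hi := by
    have h1 := h.inc (i + 1) hi
    have hne₀ : col (f (i + 1)) ≠ c₀ := fun hc => h0 ⟨_, h1.1, h1.2, hc⟩
    by_cases hc : col (f (i + 1)) = c₁
    · have hP : ∃ k < H.pathLen col u c₀ c₁, f (i + 1) = H.walkEdge col u c₀ c₁ k :=
        exists_walkEdge_eq hp h0 hc₀ hc₁ (k := 0) (Nat.zero_le _) h1.1 h1.2 (Or.inr hc)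
      have hm := h.miss i hi
      rw [flip_of_mem hP, if_neg hne₀]
      rw [hc, hmiss i hi hc] at hm
      rw [hmiss i hi hc]
      exact not_has_flip_walk₀ hp h0 hc₀ hc₁ le_rfl hm
    · rw [flip_of_not fun hP => (col_walkEdge_cases hP).elim hne₀ hc]
      exact not_has_flip_of_ne hne₀ hc (h.miss i hi)

end Fan

end IndexedGraph

end ColorEdges

/-! ### The total length of the alternating paths -/

namespace ColorEdges

namespace IndexedGraph

open scoped ENNReal

variable {H : IndexedGraph} {col : ℕ → ℕ}

/-- An alternating path can be traced back from any of its edges, a direction on that edge, and the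
other color: these determine the end at which it starts, and both colors. -/
theorem walk_trace_back (hp : H.Proper col) {u c₀ c₁ u' c₀' c₁' : ℕ} (h0 : ¬ H.Has col u c₀)
    (h0' : ¬ H.Has col u' c₀') (hc₀ : c₀ ≠ 0) (hc₁ : c₁ ≠ 0) (i i' : ℕ)
    (hi : i ≤ H.pathLen col u c₀ c₁) (hi' : i' ≤ H.pathLen col u' c₀' c₁')
    (hw : H.walk col u c₀ c₁ i = H.walk col u' c₀' c₁' i')
    (ha : alt c₀ c₁ i = alt c₀' c₁' i') (hb : alt c₀ c₁ (i + 1) = alt c₀' c₁' (i' + 1)) :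
    i = i' ∧ u = u' ∧ c₀ = c₀' ∧ c₁ = c₁' := by
  have hL := fun k (hk : k < H.pathLen col u c₀ c₁) => has_walk hk
  have hL' := fun k (hk : k < H.pathLen col u' c₀' c₁') => has_walk hk
  induction i generalizing i' with
  | zero =>
    rcases i' with _ | i'
    · exact ⟨rfl, hw, hb, ha⟩
    · obtain ⟨e1, e2, e3, e4⟩ := walkEdge_spec hL' (i := i') hi'
      rw [alt_add_two] at hb
      rw [← hw] at e3
      exact absurd ⟨_, e1, e3, e4.trans hb.symm⟩ h0
  | succ i ih =>
    obtain ⟨f1, f2, f3, f4⟩ := walkEdge_spec hL (i := i) hi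
    rw [alt_add_two] at hb
    rcases i' with _ | i'
    · rw [hw] at f3
      exact absurd ⟨_, f1, f3, f4.trans hb⟩ h0'
    · obtain ⟨e1, e2, e3, e4⟩ := walkEdge_spec hL' (i := i') hi'
      rw [alt_add_two] at hb
      have hne : alt c₀ c₁ i ≠ 0 := by rcases alt_cases c₀ c₁ i with h | h <;> omega
      have hE : H.walkEdge col u c₀ c₁ i = H.walkEdge col u' c₀' c₁' i' :=
        hp.inj _ _ _ f1 e1 f3 (hw ▸ e3) (by omega) (by omega)
      obtain ⟨r1, r2⟩ := ih i' (by omega) (by omega) (by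
        rw [← other_other f2, ← other_other e2, ← walk_succ, ← walk_succ, hw, hE]) hb ha
      exact ⟨by omega, r2⟩

/-- The total number of inner edges of the alternating paths that start at `u`, that is, of edges
other than the first and the last one. -/
noncomputable def innerLen (H : IndexedGraph) (col : ℕ → ℕ) (u : ℕ) : ℕ :=
  ∑ c₁ ∈ Finset.Icc 1 (H.maxDeg + 1), ∑ c₀ ∈ H.missing col u, (H.pathLen col u c₀ c₁ - 2)

open Classical in
/-- In each of its two directions, an edge `e` is an inner edge of at most
`min (deg (fst e)) (deg (snd e))` alternating paths: such a path is determined by its color other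
than that of `e`, and both ends of `e` have an edge of that color. -/
theorem sum_innerLen_le (hp : H.Proper col) (A : Finset ℕ) :
    ∑ u ∈ A, H.innerLen col u ≤ 2 * H.weight := by
  -- the inner edges of the paths: center, two colors, and the position of the edge on the path
  let S : Finset (Σ _ : ℕ, Σ _ : ℕ, Σ _ : ℕ, ℕ) :=
    A.sigma fun u => (Finset.Icc 1 (H.maxDeg + 1)).sigma fun c₁ => (H.missing col u).sigma fun c₀ =>
      Finset.Ico 1 (H.pathLen col u c₀ c₁ - 1)
  -- the edges, with a direction and a color that both ends have
  let T : Finset (Σ _ : ℕ, Σ _ : ℕ, ℕ) :=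
    (Finset.range H.m).sigma fun e => ({H.fst e, H.snd e} : Finset ℕ).sigma fun _ =>
      (Finset.Icc 1 (H.maxDeg + 1)).filter fun c => H.Has col (H.fst e) c ∧ H.Has col (H.snd e) c
  have hS : S.card = ∑ u ∈ A, H.innerLen col u := by
    simp only [S, Finset.card_sigma, innerLen, Nat.card_Ico, Nat.sub_sub, Nat.reduceAdd]
  have hT : T.card ≤ 2 * H.weight := by
    simp only [T, Finset.card_sigma, weight, Finset.mul_sum]
    refine Finset.sum_le_sum fun e _ => ?_
    rw [Finset.sum_const, smul_eq_mul]
    refine Nat.mul_le_mul Finset.card_le_two (le_min ?_ ?_)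
    · refine (Finset.card_le_card fun c hc => ?_).trans
        (card_has_le_deg (col := col) (H.fst e) (Finset.Icc 1 (H.maxDeg + 1)) (by simp))
      rw [Finset.mem_filter] at hc ⊢
      exact ⟨hc.1, hc.2.1⟩
    · refine (Finset.card_le_card fun c hc => ?_).trans
        (card_has_le_deg (col := col) (H.snd e) (Finset.Icc 1 (H.maxDeg + 1)) (by simp))
      rw [Finset.mem_filter] at hc ⊢
      exact ⟨hc.1, hc.2.2⟩
  rw [← hS]
  refine le_trans ?_ hT
  refine Finset.card_le_card_of_injOn
    (fun x => ⟨H.walkEdge col x.1 x.2.2.1 x.2.1 x.2.2.2, H.walk col x.1 x.2.2.1 x.2.1 x.2.2.2,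
      alt x.2.2.1 x.2.1 (x.2.2.2 + 1)⟩) ?_ ?_
  · rintro ⟨u, c₁, c₀, i⟩ hx
    simp only [S, Finset.coe_sigma, Set.mem_sigma_iff, Finset.mem_coe, Finset.mem_Icc,
      mem_missing, Finset.mem_Ico] at hx
    obtain ⟨-, h1, ⟨h2, h0⟩, h3, h4⟩ := hx
    have hL := fun k (hk : k < H.pathLen col u c₀ c₁) => has_walk hk
    obtain ⟨i, rfl⟩ : ∃ k, i = k + 1 := ⟨i - 1, by omega⟩
    obtain ⟨e1, e2, e3, e4⟩ := walkEdge_spec hL (i := i + 1) (by omega)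
    obtain ⟨p1, p2, p3, p4⟩ := walkEdge_spec hL (i := i) (by omega)
    obtain ⟨n1, n2, n3, n4⟩ := walkEdge_spec hL (i := i + 1 + 1) (by omega)
    have ha : H.Has col (H.walk col u c₀ c₁ (i + 1)) (alt c₀ c₁ (i + 1 + 1)) :=
      ⟨_, p1, p3, by rw [p4, alt_add_two]⟩
    have hb : H.Has col (H.walk col u c₀ c₁ (i + 1 + 1)) (alt c₀ c₁ (i + 1 + 1)) :=
      ⟨_, n1, n2, n4⟩
    have hne := other_ne e1 (v := H.walk col u c₀ c₁ (i + 1))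
    rw [← walk_succ] at hne
    simp only [T, Finset.coe_sigma, Set.mem_sigma_iff, Finset.mem_coe, Finset.mem_filter,
      Finset.mem_Icc, Finset.mem_range, Finset.mem_insert, Finset.mem_singleton]
    refine ⟨e1, e2, ?_, ?_⟩
    · rcases alt_cases c₀ c₁ (i + 1) with h | h <;> rw [h.2] <;> assumption
    · rcases e2 with h | h <;> rcases e3 with h' | h' <;> rw [h] at ha hne <;>
        rw [h'] at hb hne <;> first | exact absurd rfl hne | exact ⟨ha, hb⟩ | exact ⟨hb, ha⟩
  · rintro ⟨u, c₁, c₀, i⟩ hx ⟨u', c₁', c₀', i'⟩ hx' heq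
    simp only [S, Finset.coe_sigma, Set.mem_sigma_iff, Finset.mem_coe, Finset.mem_Icc,
      mem_missing, Finset.mem_Ico] at hx hx'
    obtain ⟨-, h1, ⟨h2, h0⟩, h3, h4⟩ := hx
    obtain ⟨-, h1', ⟨h2', h0'⟩, h3', h4'⟩ := hx'
    simp only [Sigma.mk.injEq, heq_eq_eq] at heq
    obtain ⟨g1, g2, g3⟩ := heq
    have ha : alt c₀ c₁ i = alt c₀' c₁' i' := by
      rw [← (walkEdge_spec (fun k hk => has_walk hk) (i := i)
          (show i < H.pathLen col u c₀ c₁ by omega)).2.2.2,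
        ← (walkEdge_spec (fun k hk => has_walk hk) (i := i')
          (show i' < H.pathLen col u' c₀' c₁' by omega)).2.2.2, g1]
    obtain ⟨rfl, rfl, rfl, rfl⟩ := walk_trace_back hp h0 h0' (by omega) (by omega) i i' (by omega)
      (by omega) g2 ha g3
    rfl

theorem mem_uncolored {e : ℕ} : e ∈ H.uncolored col ↔ e < H.m ∧ col e = 0 := by
  simp [uncolored]

/-- For random uncolored `e` and random missing `c₀`, the sum over `e` of the expected lengths of
the alternating paths. The colors `c₁ e` may depend on `e` arbitrarily, as a vertex `u` misses more
colors than there are uncolored edges at `u`. -/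
theorem sum_expected_pathLen_le (hp : H.Proper col) (c₁ : ℕ → ℕ)
    (hc₁ : ∀ e ∈ H.uncolored col, c₁ e ∈ Finset.Icc 1 (H.maxDeg + 1)) :
    ∑ e ∈ H.uncolored col, (∑ c₀ ∈ H.missing col (H.center e),
        (H.pathLen col (H.center e) c₀ (c₁ e) : ℝ≥0∞)) / (H.missing col (H.center e)).card ≤
      2 * (H.uncolored col).card + 2 * H.weight := by
  have hM (u : ℕ) : (H.missing col u).card ≠ 0 := by
    have := card_uncolored_lt_card_missing (H := H) col u
    omega
  have hM' (u : ℕ) : ((H.missing col u).card : ℝ≥0∞) ≠ 0 := by exact_mod_cast hM u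
  have hMt (u : ℕ) : ((H.missing col u).card : ℝ≥0∞) ≠ ⊤ := ENNReal.natCast_ne_top _
  calc _ ≤ ∑ e ∈ H.uncolored col, (2 + (H.innerLen col (H.center e) : ℝ≥0∞) /
          (H.missing col (H.center e)).card) := by
        refine Finset.sum_le_sum fun e he => ?_
        set u := H.center e
        have h1 : ∑ c₀ ∈ H.missing col u, H.pathLen col u c₀ (c₁ e) ≤
            2 * (H.missing col u).card + H.innerLen col u := by
          calc _ ≤ ∑ c₀ ∈ H.missing col u, (2 + (H.pathLen col u c₀ (c₁ e) - 2)) :=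
                Finset.sum_le_sum fun _ _ => by omega
            _ ≤ _ := by
                rw [Finset.sum_add_distrib, Finset.sum_const, smul_eq_mul, mul_comm]
                refine Nat.add_le_add_left ?_ _
                exact Finset.single_le_sum
                  (f := fun c₁ => ∑ c₀ ∈ H.missing col u, (H.pathLen col u c₀ c₁ - 2))
                  (fun _ _ => Nat.zero_le _) (hc₁ e he)
        rw [ENNReal.div_le_iff (hM' u) (hMt u), add_mul, ENNReal.div_mul_cancel (hM' u) (hMt u)]
        exact_mod_cast h1
    _ = 2 * (H.uncolored col).card + ∑ e ∈ H.uncolored col,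
          (H.innerLen col (H.center e) : ℝ≥0∞) / (H.missing col (H.center e)).card := by
        rw [Finset.sum_add_distrib, Finset.sum_const, nsmul_eq_mul, mul_comm]
    _ ≤ _ := by
        gcongr
        rw [← Finset.sum_fiberwise_of_maps_to (t := (H.uncolored col).image H.center)
          (fun e he => Finset.mem_image_of_mem _ he)]
        calc _ ≤ ∑ u ∈ (H.uncolored col).image H.center, (H.innerLen col u : ℝ≥0∞) := by
              refine Finset.sum_le_sum fun u _ => ?_
              rw [Finset.sum_congr rfl (g := fun _ =>
                (H.innerLen col u : ℝ≥0∞) / (H.missing col u).card)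
                (fun e he => by rw [(Finset.mem_filter.1 he).2]), Finset.sum_const, nsmul_eq_mul,
                ← mul_div_assoc, ENNReal.div_le_iff (hM' u) (hMt u), mul_comm]
              have h := card_uncolored_lt_card_missing (H := H) col u
              refine mul_le_mul' le_rfl (Nat.cast_le.2 ((Finset.card_le_card fun e he => ?_).trans
                h.le))
              simp only [Finset.mem_filter, mem_uncolored, Finset.mem_range] at he ⊢
              exact ⟨he.1.1, he.2 ▸ inc_center, he.1.2⟩
          _ ≤ _ := by exact_mod_cast sum_innerLen_le hp _

theorem sum_deg_center_le : ∑ e ∈ H.uncolored col, H.deg (H.center e) ≤ H.weight := by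
  simp only [deg_center]
  exact Finset.sum_le_sum_of_subset (Finset.filter_subset _ _)

end IndexedGraph

end ColorEdges

/-! ### Lists with deletion -/

namespace ColorEdges

/-- The array `list` holds, in its first `cnt` cells, the elements of the set `P`, and `pos` gives
the position of each of them. -/
structure Lists (P : ℕ → Prop) (cnt : ℕ) (list pos : ℕ → ℕ) : Prop where
  of_mem : ∀ c, P c → pos c < cnt ∧ list (pos c) = c
  of_lt : ∀ i < cnt, P (list i) ∧ pos (list i) = i

theorem Lists.congr {P Q : ℕ → Prop} {cnt : ℕ} {list pos : ℕ → ℕ} (h : Lists P cnt list pos)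
    (hPQ : ∀ c, P c ↔ Q c) : Lists Q cnt list pos := by
  rwa [show Q = P from funext fun c => propext (hPQ c).symm]

theorem Lists.delete {P : ℕ → Prop} {cnt : ℕ} {list pos : ℕ → ℕ} (h : Lists P cnt list pos) {c : ℕ}
    (hc : P c) : Lists (fun c' => P c' ∧ c' ≠ c) (cnt - 1)
      (Function.update list (pos c) (list (cnt - 1)))
      (Function.update pos (list (cnt - 1)) (pos c)) := by
  obtain ⟨h1, h2⟩ := h.of_mem c hc
  obtain ⟨h3, h4⟩ := h.of_lt (cnt - 1) (by omega)
  constructor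
  · rintro c' ⟨hP, hne⟩
    obtain ⟨h5, h6⟩ := h.of_mem c' hP
    simp only [Function.update_apply]
    grind
  · intro i hi
    obtain ⟨h5, h6⟩ := h.of_lt i (by omega)
    simp only [Function.update_apply]
    grind

theorem Lists.insert {P : ℕ → Prop} {cnt : ℕ} {list pos : ℕ → ℕ} (h : Lists P cnt list pos) {c : ℕ}
    (hc : ¬ P c) : Lists (fun c' => P c' ∨ c' = c) (cnt + 1)
      (Function.update list cnt c) (Function.update pos c cnt) := by
  constructor
  · rintro c' hP
    have := h.of_mem c'
    simp only [Function.update_apply]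
    grind
  · intro i hi
    have := h.of_lt i
    simp only [Function.update_apply]
    grind

/-! ### The data structures -/

open IndexedGraph

/-- The memory `s` represents the partial coloring `col` of the graph `H`.  Nothing is required of
the cells of `tab` for missing colors. -/
structure Repr (H : IndexedGraph) (col : ℕ → ℕ) (s : State) : Prop where
  proper : H.Proper col
  m : s.var .m = H.m
  maxDeg : s.var .maxDeg = H.maxDeg
  fst : ∀ e < H.m, s.arr .ends e 0 = H.fst e
  snd : ∀ e < H.m, s.arr .ends e 1 = H.snd e
  deg : ∀ v ∈ H.verts, s.arr .deg v 0 = H.deg v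
  color : ∀ e < H.m, s.arr .color e 0 = col e
  tab : ∀ e < H.m, col e ≠ 0 → ∀ v, H.Inc e v → s.arr .tab v (col e) = e
  free : ∀ v ∈ H.verts, Lists (fun c => (1 ≤ c ∧ c ≤ H.deg v + 1) ∧ ¬ H.Has col v c)
    (s.arr .cnt v 0) (s.arr .free v) (s.arr .pos v)
  un : Lists (fun e => e < H.m ∧ col e = 0) (s.var .l) (fun i => s.arr .un i 0)
    (fun e => s.arr .ind e 0)

variable {H : IndexedGraph} {col : ℕ → ℕ} {s s' : State}

theorem Repr.frame (h : Repr H col s) {A : List Var} {B : List Arr} (hf : Frame A B s s')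
    (hA : ∀ v ∈ [Var.m, .maxDeg, .l], v ∉ A)
    (hB : ∀ a ∈ [Arr.ends, .color, .deg, .tab, .free, .cnt, .pos, .un, .ind], a ∉ B) :
    Repr H col s' := by
  obtain ⟨hf1, hf2⟩ := hf
  have a1 := hf1 _ (hA .m (by decide))
  have a2 := hf1 _ (hA .maxDeg (by decide))
  have a3 := hf1 _ (hA .l (by decide))
  have b1 := hf2 _ (hB .ends (by decide))
  have b2 := hf2 _ (hB .color (by decide))
  have b3 := hf2 _ (hB .deg (by decide))
  have b4 := hf2 _ (hB .tab (by decide))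
  have b5 := hf2 _ (hB .free (by decide))
  have b6 := hf2 _ (hB .cnt (by decide))
  have b7 := hf2 _ (hB .pos (by decide))
  have b8 := hf2 _ (hB .un (by decide))
  have b9 := hf2 _ (hB .ind (by decide))
  obtain ⟨h1, h2, h3, h4, h5, h6, h7, h8, h9, h10⟩ := h
  exact ⟨h1, a1 ▸ h2, a2 ▸ h3, b1 ▸ h4, b1 ▸ h5, b3 ▸ h6, b2 ▸ h7, b4 ▸ h8, by
    rw [b5, b6, b7]; exact h9, by rw [a3, b8, b9]; exact h10⟩

theorem Repr.tab_eq (h : Repr H col s) {v c : ℕ} (hc : c ≠ 0) (hh : H.Has col v c) :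
    s.arr .tab v c = H.edgeAt col v c := by
  obtain ⟨h1, h2, h3⟩ := edgeAt_spec hh
  have := h.tab _ h1 (by omega) v h2
  rwa [h3] at this

/-- The test `hasColor` is right even though cells of `tab` may be uninitialized or outdated: the
edge found there is compared with `color` and `ends`, and the cells of colors that are present are
up to date. -/
theorem Repr.holds_hasColor (h : Repr H col s) {v c : Expr} (hc : c.eval s ≠ 0) :
    (hasColor v c).holds s = true ↔ H.Has col (v.eval s) (c.eval s) := by
  simp only [hasColor, Test.holds_and, Test.holds_or, Test.holds_lt, Test.holds_eq, Expr.eval, h.m]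
  constructor
  · rintro ⟨h1, h2, h3⟩
    rw [h.color _ h1] at h2
    rw [h.fst _ h1, h.snd _ h1] at h3
    exact ⟨_, h1, by rcases h3 with h3 | h3 <;> simp [Inc, h3], h2⟩
  · intro hh
    rw [h.tab_eq hc hh]
    obtain ⟨h1, h2, h3⟩ := edgeAt_spec hh
    rw [h.color _ h1, h.fst _ h1, h.snd _ h1]
    exact ⟨h1, h3, by rcases h2 with h2 | h2 <;> simp [← h2]⟩

theorem Repr.exec_otherEnd (h : Repr H col s) {w : Var} {f v : Expr} (hf : f.eval s < H.m) :
    (otherEnd w f v).exec s = s.setVar w (H.other (f.eval s) (v.eval s)) := by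
  simp only [otherEnd, Cmd.exec, Test.holds, Expr.eval, h.fst _ hf, h.snd _ hf, other,
    decide_eq_true_eq]
  split_ifs <;> rfl

/-- The list of a vertex is never empty, so its first entry is a missing color. -/
theorem Repr.free_zero (h : Repr H col s) {v : ℕ} (hv : v ∈ H.verts) :
    (1 ≤ s.arr .free v 0 ∧ s.arr .free v 0 ≤ H.maxDeg + 1) ∧ ¬ H.Has col v (s.arr .free v 0) := by
  obtain ⟨c, hc⟩ := exists_missing (H := H) col v
  have hl := h.free v hv
  have h1 := (hl.of_mem c hc).1
  have h2 := (hl.of_lt 0 (by omega)).1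
  have h3 := H.deg_le_maxDeg v
  exact ⟨⟨h2.1.1, by omega⟩, h2.2⟩

theorem frame_dropMissing (s : State) :
    Frame [.k, .last] [.cnt, .free, .pos] s (dropMissing.exec s) :=
  (Cmd.frame_exec dropMissing s).mono (by decide) (by decide)

theorem frame_addMissing (s : State) : Frame [] [.cnt, .free, .pos] s (addMissing.exec s) :=
  (Cmd.frame_exec addMissing s).mono (by decide) (by decide)

theorem exec_dropMissing {P : ℕ → Prop} {z c d : ℕ} (hz : s.var .z = z) (hc : s.var .c = c)
    (hd : s.arr .deg z 0 = d) (h1 : 1 ≤ c) (hP : ¬ P c)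
    (hl : Lists (fun c => (1 ≤ c ∧ c ≤ d + 1) ∧ ¬ P c)
      (s.arr .cnt z 0) (s.arr .free z) (s.arr .pos z)) :
    Lists (fun c' => (1 ≤ c' ∧ c' ≤ d + 1) ∧ ¬ (P c' ∨ c' = c)) ((dropMissing.exec s).arr .cnt z 0)
        ((dropMissing.exec s).arr .free z) ((dropMissing.exec s).arr .pos z) ∧
      ∀ v, v ≠ z → (dropMissing.exec s).arr .cnt v 0 = s.arr .cnt v 0 ∧
        (dropMissing.exec s).arr .free v = s.arr .free v ∧
        (dropMissing.exec s).arr .pos v = s.arr .pos v := by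
  by_cases hcd : c ≤ d + 1
  · have hdel := hl.delete (c := c) ⟨⟨h1, hcd⟩, hP⟩
    simp only [dropMissing, Cmd.exec, Test.holds, Expr.eval, hz, hc, hd, hcd, decide_true, if_true]
    refine ⟨?_, fun v hv => ⟨by simp [hz, hv], ?_, ?_⟩⟩
    · refine Lists.congr (P := fun c' => ((1 ≤ c' ∧ c' ≤ d + 1) ∧ ¬ P c') ∧ c' ≠ c) ?_
        (fun c' => by tauto)
      convert hdel using 1
      · simp [hz]
      · funext j; simp [hz, Function.update_apply]
      · funext j; simp [hz, Function.update_apply]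
    · funext j; simp [hz, hv]
    · funext j; simp [hz, hv]
  · simp only [dropMissing, Cmd.exec, Test.holds, Expr.eval, hz, hc, hd, hcd, decide_false]
    refine ⟨hl.congr fun c' => ?_, fun v _ => ⟨rfl, rfl, rfl⟩⟩
    constructor
    · rintro ⟨⟨h2, h3⟩, h4⟩
      exact ⟨⟨h2, h3⟩, by rintro (h | rfl); exacts [h4 h, hcd h3]⟩
    · tauto

theorem exec_addMissing {P : ℕ → Prop} {z c d : ℕ} (hz : s.var .z = z) (hc : s.var .c = c)
    (hd : s.arr .deg z 0 = d) (h1 : 1 ≤ c) (hP : P c)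
    (hl : Lists (fun c => (1 ≤ c ∧ c ≤ d + 1) ∧ ¬ P c)
      (s.arr .cnt z 0) (s.arr .free z) (s.arr .pos z)) :
    Lists (fun c' => (1 ≤ c' ∧ c' ≤ d + 1) ∧ ¬ (P c' ∧ c' ≠ c)) ((addMissing.exec s).arr .cnt z 0)
        ((addMissing.exec s).arr .free z) ((addMissing.exec s).arr .pos z) ∧
      ∀ v, v ≠ z → (addMissing.exec s).arr .cnt v 0 = s.arr .cnt v 0 ∧
        (addMissing.exec s).arr .free v = s.arr .free v ∧
        (addMissing.exec s).arr .pos v = s.arr .pos v := by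
  by_cases hcd : c ≤ d + 1
  · have hins := hl.insert (c := c) fun h => h.2 hP
    simp only [addMissing, Cmd.exec, Test.holds, Expr.eval, hz, hc, hd, hcd, decide_true, if_true]
    refine ⟨?_, fun v hv => ⟨by simp [hz, hv], ?_, ?_⟩⟩
    · refine Lists.congr (P := fun c' => ((1 ≤ c' ∧ c' ≤ d + 1) ∧ ¬ P c') ∨ c' = c) ?_
        (fun c' => ?_)
      · convert hins using 1
        · simp [hz]
        · funext j; simp [hz, hc, Function.update_apply]
        · funext j; simp [hz, hc, Function.update_apply]
      · by_cases h : c' = c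
        · subst h; simp [h1, hcd]
        · simp [h]
    · funext j; simp [hz, hv]
    · funext j; simp [hz, hv]
  · simp only [addMissing, Cmd.exec, Test.holds, Expr.eval, hz, hc, hd, hcd, decide_false]
    refine ⟨hl.congr fun c' => ?_, fun v _ => ⟨rfl, rfl, rfl⟩⟩
    constructor
    · tauto
    · rintro ⟨⟨h2, h3⟩, h4⟩
      exact ⟨⟨h2, h3⟩, fun h => h4 ⟨h, by rintro rfl; exact hcd h3⟩⟩

theorem frame_assignColor (s : State) : Frame [.k, .z, .last, .l]
    [.color, .tab, .cnt, .free, .pos, .un, .ind] s (assignColor.exec s) :=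
  (Cmd.frame_exec assignColor s).mono (by decide) (by decide)

theorem frame_removeColor (s : State) : Frame [.c, .z, .l]
    [.color, .cnt, .free, .pos, .un, .ind] s (removeColor.exec s) :=
  (Cmd.frame_exec removeColor s).mono (by decide) (by decide)

theorem Repr.exec_assignColor (h : Repr H col s) {g c : ℕ} (hg : s.var .g = g) (hc : s.var .c = c)
    (hgm : g < H.m) (hg0 : col g = 0) (hc1 : 1 ≤ c) (hcD : c ≤ H.maxDeg + 1)
    (hm : ∀ v, H.Inc g v → ¬ H.Has col v c) :
    Repr H (Function.update col g c) (assignColor.exec s) ∧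
      (assignColor.exec s).var .l = s.var .l - 1 := by
  have hv1 : H.fst g ∈ H.verts := mem_verts.2 ⟨g, hgm, Or.inl rfl⟩
  have hv2 : H.snd g ∈ H.verts := mem_verts.2 ⟨g, hgm, Or.inr rfl⟩
  have hne := H.fst_ne_snd g hgm
  -- the lists of the two ends
  obtain ⟨s1, hs1⟩ : ∃ s1, s1 = ((s.setCell .color g 0 c).setVar .z (H.fst g)).setCell .tab
    (H.fst g) c g := ⟨_, rfl⟩
  obtain ⟨l1, r1⟩ := exec_dropMissing (s := s1) (P := H.Has col (H.fst g)) (z := H.fst g) (c := c)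
    (d := H.deg (H.fst g)) (by simp [hs1]) (by simp [hs1, hc]) (by simp [hs1, h.deg _ hv1]) hc1
    (hm _ (Or.inl rfl)) (by simpa [hs1] using h.free _ hv1)
  have f1 := frame_dropMissing s1
  obtain ⟨s2, hs2⟩ : ∃ s2, s2 = dropMissing.exec s1 := ⟨_, rfl⟩
  rw [← hs2] at l1 r1 f1
  obtain ⟨s3, hs3⟩ : ∃ s3, s3 = (s2.setVar .z (H.snd g)).setCell .tab (H.snd g) c g := ⟨_, rfl⟩
  obtain ⟨l2, r2⟩ := exec_dropMissing (s := s3) (P := H.Has col (H.snd g)) (z := H.snd g) (c := c)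
    (d := H.deg (H.snd g)) (by simp [hs3]) (by simp [hs3, f1.1 .c (by decide), hs1, hc])
    (by simp [hs3, f1.2 .deg (by decide), hs1, h.deg _ hv2]) hc1
    (hm _ (Or.inr rfl)) (by
      obtain ⟨q1, q2, q3⟩ := r1 _ hne.symm
      simpa [hs3, q1, q2, q3, hs1] using h.free _ hv2)
  have f2 := frame_dropMissing s3
  obtain ⟨s4, hs4⟩ : ∃ s4, s4 = dropMissing.exec s3 := ⟨_, rfl⟩
  rw [← hs4] at l2 r2 f2
  have e2 : s2.arr .ends = s.arr .ends := by rw [f1.2 _ (by decide)]; simp [hs1]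
  have e4 : s4.arr .ends = s.arr .ends := by rw [f2.2 _ (by decide)]; simp [hs3, e2]
  have g2 : s2.var .g = g := by rw [f1.1 _ (by decide)]; simp [hs1, hg]
  have c2 : s2.var .c = c := by rw [f1.1 _ (by decide)]; simp [hs1, hc]
  have g4 : s4.var .g = g := by rw [f2.1 _ (by decide)]; simp [hs3, g2]
  have l4 : s4.var .l = s.var .l := by
    rw [f2.1 _ (by decide)]; simp [hs3, f1.1 .l (by decide), hs1]
  have un4 : s4.arr .un = s.arr .un := by
    rw [f2.2 _ (by decide)]; simp [hs3, f1.2 .un (by decide), hs1]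
  have ind4 : s4.arr .ind = s.arr .ind := by
    rw [f2.2 _ (by decide)]; simp [hs3, f1.2 .ind (by decide), hs1]
  have hexec : assignColor.exec s = ((((s4.setVar .k (s.arr .ind g 0)).setVar .l
    (s.var .l - 1)).setVar
      .last (s.arr .un (s.var .l - 1) 0)).setCell .un (s.arr .ind g 0) 0
      (s.arr .un (s.var .l - 1) 0)).setCell .ind (s.arr .un (s.var .l - 1) 0) 0
      (s.arr .ind g 0) := by
    simp [assignColor, Cmd.exec, Expr.eval, hg, hc, h.fst g hgm, h.snd g hgm, ← hs1, ← hs2, e2, g2,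
      c2, ← hs3, ← hs4, g4, l4, un4, ind4]
  have hdel := h.un.delete (c := g) ⟨hgm, hg0⟩
  obtain ⟨s5, hs5⟩ : ∃ s5, s5 = assignColor.exec s := ⟨_, rfl⟩
  have tab5 : s5.arr .tab = s4.arr .tab := by simp [hs5, hexec]
  have ff := frame_assignColor s
  rw [← hs5] at ff ⊢
  rw [← hs5] at hexec
  refine ⟨⟨h.proper.update hcD hm, ?_, ?_, ?_, ?_, ?_, ?_, ?_, ?_, ?_⟩, ?_⟩
  · rw [ff.1 _ (by decide), h.m]
  · rw [ff.1 _ (by decide), h.maxDeg]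
  · rw [ff.2 _ (by decide)]; exact h.fst
  · rw [ff.2 _ (by decide)]; exact h.snd
  · rw [ff.2 _ (by decide)]; exact h.deg
  · intro e he
    have := h.color e he
    simp [hexec, f2.2 .color (by decide), hs3, f1.2 .color (by decide), hs1, Function.update_apply,
      this]
  · intro e he hce v hv
    simp only [tab5, f2.2 .tab (by decide), hs3, f1.2 .tab (by decide), hs1, State.setCell_arr_self,
      State.setVar_arr]
    by_cases heg : e = g
    · subst heg
      rcases hv with rfl | rfl <;> simp
    · rw [Function.update_of_ne heg] at hce ⊢
      have h1 := h.tab e he hce v hv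
      have h2 : H.Inc g v → col e ≠ c := fun hgv hec => hm v hgv ⟨e, he, hv, hec⟩
      rw [if_neg (by rintro ⟨rfl, h'⟩; exact h2 (Or.inr rfl) h'),
        if_neg (by rintro ⟨rfl, h'⟩; exact h2 (Or.inl rfl) h'),
          State.setCell_arr_ne _ _ _ _ (by decide), h1]
  · intro v hv
    have hcell (a : Arr) (ha1 : a ≠ .un) (ha2 : a ≠ .ind) : s5.arr a = s4.arr a := by
      simp [hexec, ha1, ha2]
    rw [hcell .cnt (by decide) (by decide), hcell .free (by decide) (by decide),
      hcell .pos (by decide) (by decide)]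
    by_cases hvs : v = H.snd g
    · subst hvs
      refine l2.congr fun c' => and_congr_right fun hc' => not_congr ?_
      rw [has_update hgm hg0 hc'.1]
      simp [Inc]
    · obtain ⟨q1, q2, q3⟩ := r2 v hvs
      rw [q1, q2, q3]
      simp only [hs3]
      rw [State.setCell_arr_ne _ _ _ _ (by decide), State.setCell_arr_ne _ _ _ _ (by decide),
        State.setCell_arr_ne _ _ _ _ (by decide)]
      simp only [State.setVar_arr]
      by_cases hvf : v = H.fst g
      · subst hvf
        refine l1.congr fun c' => and_congr_right fun hc' => not_congr ?_
        rw [has_update hgm hg0 hc'.1]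
        simp [Inc]
      · obtain ⟨q1, q2, q3⟩ := r1 v hvf
        rw [q1, q2, q3]
        simp only [hs1]
        rw [State.setCell_arr_ne _ _ _ _ (by decide), State.setCell_arr_ne _ _ _ _ (by decide),
          State.setCell_arr_ne _ _ _ _ (by decide)]
        simp only [State.setVar_arr]
        rw [State.setCell_arr_ne _ _ _ _ (by decide), State.setCell_arr_ne _ _ _ _ (by decide),
          State.setCell_arr_ne _ _ _ _ (by decide)]
        refine (h.free v hv).congr fun c' => and_congr_right fun hc' => not_congr ?_
        rw [has_update hgm hg0 hc'.1]
        simp [Inc, hvs, hvf]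
  · refine Lists.congr (P := fun e => (e < H.m ∧ col e = 0) ∧ e ≠ g) ?_ (fun e => ?_)
    · convert hdel using 1
      · simp [hexec]
      · funext i; simp [hexec, un4, Function.update_apply]
      · funext i; simp [hexec, ind4, Function.update_apply]
    · by_cases heg : e = g
      · subst heg; simp; omega
      · simp [heg]
  · simp [hexec]

theorem Repr.exec_removeColor (h : Repr H col s) {g : ℕ} (hg : s.var .g = g) (hgm : g < H.m)
    (hg0 : col g ≠ 0) :
    Repr H (Function.update col g 0) (removeColor.exec s) ∧
      (removeColor.exec s).var .l = s.var .l + 1 ∧ (removeColor.exec s).var .c = col g := by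
  have hv1 : H.fst g ∈ H.verts := mem_verts.2 ⟨g, hgm, Or.inl rfl⟩
  have hv2 : H.snd g ∈ H.verts := mem_verts.2 ⟨g, hgm, Or.inr rfl⟩
  have hne := H.fst_ne_snd g hgm
  have hcg := h.color g hgm
  obtain ⟨s1, hs1⟩ : ∃ s1, s1 = ((s.setVar .c (col g)).setCell .color g 0 0).setVar .z (H.fst g) :=
    ⟨_, rfl⟩
  obtain ⟨l1, r1⟩ := exec_addMissing (s := s1) (P := H.Has col (H.fst g)) (z := H.fst g)
    (c := col g) (d := H.deg (H.fst g)) (by simp [hs1]) (by simp [hs1])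
    (by simp [hs1, h.deg _ hv1]) (by omega) ⟨g, hgm, Or.inl rfl, rfl⟩
    (by simpa [hs1] using h.free _ hv1)
  have f1 := frame_addMissing s1
  obtain ⟨s2, hs2⟩ : ∃ s2, s2 = addMissing.exec s1 := ⟨_, rfl⟩
  rw [← hs2] at l1 r1 f1
  obtain ⟨s3, hs3⟩ : ∃ s3, s3 = s2.setVar .z (H.snd g) := ⟨_, rfl⟩
  obtain ⟨l2, r2⟩ := exec_addMissing (s := s3) (P := H.Has col (H.snd g)) (z := H.snd g)
    (c := col g) (d := H.deg (H.snd g)) (by simp [hs3]) (by simp [hs3, f1.1 .c (by decide), hs1])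
    (by simp [hs3, f1.2 .deg (by decide), hs1, h.deg _ hv2]) (by omega) ⟨g, hgm, Or.inr rfl, rfl⟩
    (by
      obtain ⟨q1, q2, q3⟩ := r1 _ hne.symm
      simpa [hs3, q1, q2, q3, hs1] using h.free _ hv2)
  have f2 := frame_addMissing s3
  obtain ⟨s4, hs4⟩ : ∃ s4, s4 = addMissing.exec s3 := ⟨_, rfl⟩
  rw [← hs4] at l2 r2 f2
  have e2 : s2.arr .ends = s.arr .ends := by rw [f1.2 _ (by decide)]; simp [hs1]
  have g2 : s2.var .g = g := by rw [f1.1 _ (by decide)]; simp [hs1, hg]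
  have g4 : s4.var .g = g := by rw [f2.1 _ (by decide)]; simp [hs3, g2]
  have l4 : s4.var .l = s.var .l := by
    rw [f2.1 _ (by decide)]; simp [hs3, f1.1 .l (by decide), hs1]
  have c4 : s4.var .c = col g := by
    rw [f2.1 _ (by decide)]; simp [hs3, f1.1 .c (by decide), hs1]
  have un4 : s4.arr .un = s.arr .un := by
    rw [f2.2 _ (by decide)]; simp [hs3, f1.2 .un (by decide), hs1]
  have ind4 : s4.arr .ind = s.arr .ind := by
    rw [f2.2 _ (by decide)]; simp [hs3, f1.2 .ind (by decide), hs1]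
  have hexec : removeColor.exec s = ((s4.setCell .un (s.var .l) 0 g).setCell .ind g 0
      (s.var .l)).setVar .l (s.var .l + 1) := by
    simp [removeColor, Cmd.exec, Expr.eval, hg, hcg, h.fst g hgm, h.snd g hgm, ← hs1, ← hs2, e2, g2,
      ← hs3, ← hs4, g4, l4]
  have hins := h.un.insert (c := g) fun h' => hg0 h'.2
  obtain ⟨s5, hs5⟩ : ∃ s5, s5 = removeColor.exec s := ⟨_, rfl⟩
  have ff := frame_removeColor s
  rw [← hs5] at ff ⊢
  rw [← hs5] at hexec
  refine ⟨⟨h.proper.update_zero g, ?_, ?_, ?_, ?_, ?_, ?_, ?_, ?_, ?_⟩, ?_, ?_⟩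
  · rw [ff.1 _ (by decide), h.m]
  · rw [ff.1 _ (by decide), h.maxDeg]
  · rw [ff.2 _ (by decide)]; exact h.fst
  · rw [ff.2 _ (by decide)]; exact h.snd
  · rw [ff.2 _ (by decide)]; exact h.deg
  · intro e he
    have := h.color e he
    simp [hexec, f2.2 .color (by decide), hs3, f1.2 .color (by decide), hs1, Function.update_apply,
      this]
  · intro e he hce v hv
    have heg : e ≠ g := by rintro rfl; simp at hce
    rw [Function.update_of_ne heg] at hce ⊢
    rw [ff.2 _ (by decide)]
    exact h.tab e he hce v hv
  · intro v hv
    have hcell (a : Arr) (ha1 : a ≠ .un) (ha2 : a ≠ .ind) : s5.arr a = s4.arr a := by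
      simp [hexec, ha1, ha2]
    rw [hcell .cnt (by decide) (by decide), hcell .free (by decide) (by decide),
      hcell .pos (by decide) (by decide)]
    by_cases hvs : v = H.snd g
    · subst hvs
      refine l2.congr fun c' => and_congr_right fun hc' => not_congr ?_
      rw [has_update_zero h.proper hgm hc'.1]
      simp [Inc]
    · obtain ⟨q1, q2, q3⟩ := r2 v hvs
      rw [q1, q2, q3]
      simp only [hs3, State.setVar_arr]
      by_cases hvf : v = H.fst g
      · subst hvf
        refine l1.congr fun c' => and_congr_right fun hc' => not_congr ?_
        rw [has_update_zero h.proper hgm hc'.1]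
        simp [Inc]
      · obtain ⟨q1, q2, q3⟩ := r1 v hvf
        rw [q1, q2, q3]
        simp only [hs1, State.setVar_arr]
        rw [State.setCell_arr_ne _ _ _ _ (by decide), State.setCell_arr_ne _ _ _ _ (by decide),
          State.setCell_arr_ne _ _ _ _ (by decide)]
        simp only [State.setVar_arr]
        refine (h.free v hv).congr fun c' => and_congr_right fun hc' => not_congr ?_
        rw [has_update_zero h.proper hgm hc'.1]
        simp [Inc, hvs, hvf]
  · refine Lists.congr (P := fun e => (e < H.m ∧ col e = 0) ∨ e = g) ?_ (fun e => ?_)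
    · convert hins using 1
      · simp [hexec]
      · funext i; simp [hexec, un4, Function.update_apply]
      · funext i; simp [hexec, ind4, Function.update_apply]
    · by_cases heg : e = g
      · subst heg; simp [hgm]
      · simp [heg]
  · simp [hexec]
  · simp [hexec, c4]

end ColorEdges

/-! ### The fan -/

namespace ColorEdges

open IndexedGraph

variable {H : IndexedGraph} {col : ℕ → ℕ} {s s' : State} {u t c₀ c₁ : ℕ} {f : ℕ → ℕ}

/-- A fan that is primed by the color `c₁`: this color is missing at the last leaf, and it is
missing at the center or the color of an edge of the fan. -/
structure IndexedGraph.PrimedFan (H : IndexedGraph) (col : ℕ → ℕ) (u t : ℕ) (f : ℕ → ℕ) (c₁ : ℕ) :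
    Prop extends H.Fan col u t f where
  one_le : 1 ≤ c₁
  le : c₁ ≤ H.maxDeg + 1
  miss_last : ¬ H.Has col (H.other (f t) u) c₁
  primed : ¬ H.Has col u c₁ ∨ ∃ j, 1 ≤ j ∧ j ≤ t ∧ col (f j) = c₁

theorem IndexedGraph.Fan.snoc (h : H.Fan col u t f) {g : ℕ} (hg : g < H.m) (hgu : H.Inc g u)
    (h0 : col g ≠ 0) (hm : ¬ H.Has col (H.other (f t) u) (col g)) (hne : ∀ i ≤ t, f i ≠ g) :
    H.Fan col u (t + 1) (Function.update f (t + 1) g) where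
  inc i hi := by
    rcases eq_or_ne i (t + 1) with rfl | h'
    · simpa using ⟨hg, hgu⟩
    · rw [Function.update_of_ne h']; exact h.inc i (by omega)
  ne j hj i hi := by
    rw [Function.update_of_ne (show i ≠ t + 1 by omega)]
    rcases eq_or_ne j (t + 1) with rfl | h'
    · simpa using hne i (by omega)
    · rw [Function.update_of_ne h']; exact h.ne j (by omega) i hi
  zero := by simpa using h.zero
  pos i hi := by
    rcases eq_or_ne (i + 1) (t + 1) with h' | h'
    · rw [h']; simpa using h0
    · rw [Function.update_of_ne h']; exact h.pos i (by omega)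
  miss i hi := by
    rw [Function.update_of_ne (show i ≠ t + 1 by omega)]
    rcases eq_or_ne (i + 1) (t + 1) with h' | h'
    · obtain rfl : i = t := by omega
      simpa using hm
    · rw [Function.update_of_ne h']; exact h.miss i (by omega)

/-- The memory holds the fan `f 0, …, f t`, with the positions of its edges. -/
structure FanRepr (t : ℕ) (f : ℕ → ℕ) (s : State) : Prop where
  length : s.var .t = t
  fan : ∀ i ≤ t, s.arr .fan i 0 = f i
  fpos : ∀ i ≤ t, s.arr .fpos (f i) 0 = i

/-- There are at most `deg u` iterations, as the edges of a fan are distinct edges at `u`.  An edge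
is recognized as an edge of the fan by comparing `fan[fpos[f]]` with `f`, so outdated positions do
no harm. -/
theorem Repr.runs_makePrimedFan (h : Repr H col s) {e : ℕ} (he : s.var .e = e) (hem : e < H.m)
    (he0 : col e = 0) (hu : s.var .u = u) (heu : H.Inc e u) :
    Runs makePrimedFan s (9 + H.deg u * 41) fun s' =>
      Frame [.t, .primed, .x, .c1, .f] [.fan, .fpos] s s' ∧
        ∃ t f, H.PrimedFan col u t f (s'.var .c1) ∧ FanRepr t f s' := by
  have key : ∀ s', Frame [.t, .primed, .x, .c1, .f] [.fan, .fpos] s s' → s'.var .primed = 0 →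
      H.Fan col u 0 (fun _ => e) ∧ FanRepr 0 (fun _ => e) s' →
      Runs (.loop (.eq (.var .primed) (.lit 0))
        (otherEnd .x (cell1 .fan (.var .t)) (.var .u) ;;
         .set .c1 (.cell .free (.var .x) (.lit 0)) ;;
         .ite (.not (hasColor (.var .u) (.var .c1)))
           (.set .primed (.lit 1))
           (.set .f (.cell .tab (.var .u) (.var .c1)) ;;
            .ite (.and (.le (cell1 .fpos (.var .f)) (.var .t))
                (.eq (cell1 .fan (cell1 .fpos (.var .f))) (.var .f)))
              (.set .primed (.lit 1))
              (.set .t (.succ (.var .t)) ;;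
               store1 .fan (.var .t) (.var .f) ;;
               store1 .fpos (.var .f) (.var .t))))) s' (1 + H.deg u * (40 + 1)) fun s' =>
      Frame [.t, .primed, .x, .c1, .f] [.fan, .fpos] s s' ∧
        ∃ t f, H.PrimedFan col u t f (s'.var .c1) ∧ FanRepr t f s' := by
    intro s0 hf0 hp0 hI0
    refine Runs.loop (I := fun j s' => Frame [.t, .primed, .x, .c1, .f] [.fan, .fpos] s s' ∧
      ((s'.var .primed = 0 ∧ ∃ f, H.Fan col u j f ∧ FanRepr j f s') ∨
        (s'.var .primed = 1 ∧ ∃ t f, H.PrimedFan col u t f (s'.var .c1) ∧ FanRepr t f s')))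
      ?_ ⟨hf0, Or.inl ⟨hp0, _, hI0⟩⟩
    rintro j s1 hj ⟨hf1, ⟨hp1, f, hfan, hrep⟩ | ⟨hp1, hQ⟩⟩
    swap
    · left
      exact ⟨by simp [Test.holds, Expr.eval, hp1], hf1, hQ⟩
    right
    refine ⟨by simp [Test.holds, Expr.eval, hp1], hfan.lt_deg, Runs.straight
      (by simp [Cmd.Straight, otherEnd]) ?_ (by decide)⟩
    have r1 : Repr H col s1 := h.frame hf1 (by decide) (by decide)
    have hft := hfan.inc j le_rfl
    have u1 : s1.var .u = u := by rw [hf1.1 _ (by decide), hu]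
    obtain ⟨x, hx⟩ : ∃ x, x = H.other (f j) u := ⟨_, rfl⟩
    obtain ⟨c₁, hc₁⟩ : ∃ c₁, c₁ = s1.arr .free x 0 := ⟨_, rfl⟩
    obtain ⟨⟨hc1, hc2⟩, hc3⟩ :=
      r1.free_zero (v := x) (hx ▸ mem_verts.2 ⟨f j, hft.1, inc_other⟩)
    rw [← hc₁] at hc1 hc2 hc3
    obtain ⟨s2, hs2⟩ : ∃ s2, s2 = (s1.setVar .x x).setVar .c1 c₁ := ⟨_, rfl⟩
    have f12 : Frame [.x, .c1] [] s1 s2 := by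
      rw [hs2]; exact ((Frame.refl _ _ _).setVar (by decide) _).setVar (by decide) _
    have hf2 : Frame [.t, .primed, .x, .c1, .f] [.fan, .fpos] s s2 :=
      hf1.trans (f12.mono (by decide) (by decide))
    have r2 : Repr H col s2 := r1.frame f12 (by decide) (by decide)
    have u2 : s2.var .u = u := by rw [f12.1 _ (by decide), u1]
    have c2 : s2.var .c1 = c₁ := by simp [hs2]
    have t2 : s2.var .t = j := by rw [f12.1 _ (by decide), hrep.length]
    have a2 : s2.arr = s1.arr := by simp [hs2]
    have hrep2 : FanRepr j f s2 := ⟨t2, by rw [a2]; exact hrep.fan, by rw [a2]; exact hrep.fpos⟩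
    have hEf : (cell1 .fan (.var .t)).eval s1 = f j := by
      simp [Expr.eval, hrep.length, hrep.fan j le_rfl]
    have hcolor := r2.holds_hasColor (v := .var .u) (c := .var .c1)
      (by simp only [Expr.eval, c2]; omega)
    simp only [Expr.eval, u2, c2] at hcolor
    rw [Cmd.exec_seq, r1.exec_otherEnd (by rw [hEf]; exact hft.1), hEf, Cmd.exec_seq, Cmd.exec_set]
    rw [show (s1.setVar .x (H.other (f j) ((Expr.var .u).eval s1))).setVar .c1
      ((Expr.cell .free (.var .x) (.lit 0)).eval
        (s1.setVar .x (H.other (f j) ((Expr.var .u).eval s1)))) = s2 by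
      simp [Expr.eval, u1, hs2, hc₁, hx]]
    by_cases hh : H.Has col u c₁
    swap
    · rw [Cmd.exec_ite_true (Test.holds_not.2 (hcolor.not.2 hh)), Cmd.exec_set]
      refine ⟨hf2.setVar (by decide) _, Or.inr ⟨by simp [Expr.eval], j, f, ?_, ?_⟩⟩
      · simpa [c2] using
          (⟨hfan, hc1, hc2, hx ▸ hc3, Or.inl hh⟩ : H.PrimedFan col u j f c₁)
      · exact ⟨by simp [t2], hrep2.fan, hrep2.fpos⟩
    rw [Cmd.exec_ite_false (fun h => Test.holds_not.1 h (hcolor.2 hh)), Cmd.exec_seq, Cmd.exec_set]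
    obtain ⟨g, hg⟩ : ∃ g, g = H.edgeAt col u c₁ := ⟨_, rfl⟩
    obtain ⟨g1, g2, g3⟩ := edgeAt_spec hh
    rw [← hg] at g1 g2 g3
    have htab : (Expr.cell .tab (.var .u) (.var .c1)).eval s2 = g := by
      simp only [Expr.eval]
      rw [u2, c2, r2.tab_eq (by omega) hh, hg]
    rw [htab]
    have hf3 : Frame [.t, .primed, .x, .c1, .f] [.fan, .fpos] s (s2.setVar .f g) :=
      hf2.setVar (by decide) _
    have htest : Test.holds (s2.setVar .f g) (.and (.le (cell1 .fpos (.var .f)) (.var .t))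
        (.eq (cell1 .fan (cell1 .fpos (.var .f))) (.var .f))) = true ↔
          s2.arr .fpos g 0 ≤ j ∧ s2.arr .fan (s2.arr .fpos g 0) 0 = g := by
      simp [Test.holds_and, Test.holds_le, Test.holds_eq, Expr.eval, t2]
    by_cases hin : s2.arr .fpos g 0 ≤ j ∧ s2.arr .fan (s2.arr .fpos g 0) 0 = g
    · rw [Cmd.exec_ite_true (htest.2 hin), Cmd.exec_set]
      refine ⟨hf3.setVar (by decide) _, Or.inr ⟨by simp [Expr.eval], j, f, ?_, ?_⟩⟩
      · have hfg : f (s2.arr .fpos g 0) = g := by rw [← hrep2.fan _ hin.1, hin.2]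
        have hpos : s2.arr .fpos g 0 ≠ 0 := by
          intro h0
          rw [h0] at hfg
          have := hfan.zero
          rw [hfg] at this
          omega
        simpa [c2] using
          (⟨hfan, hc1, hc2, hx ▸ hc3, Or.inr ⟨_, by omega, hin.1, by rw [hfg, g3]⟩⟩ :
            H.PrimedFan col u j f c₁)
      · exact ⟨by simp [t2], hrep2.fan, hrep2.fpos⟩
    · rw [Cmd.exec_ite_false (htest.not.2 hin), Cmd.exec_seq, Cmd.exec_set, Cmd.exec_seq,
        Cmd.exec_store, Cmd.exec_store]
      have hne : ∀ i ≤ j, f i ≠ g := by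
        rintro i hi rfl
        rw [hrep2.fpos i hi, hrep2.fan i hi] at hin
        exact hin ⟨hi, rfl⟩
      refine ⟨((hf3.setVar (by decide) _).setCell (by decide) _ _ _).setCell (by decide) _ _ _,
        Or.inl ⟨?_, Function.update f (j + 1) g,
          hfan.snoc g1 g2 (by omega) (by rw [g3, ← hx]; exact hc3) hne, ?_, ?_, ?_⟩⟩
      · simpa [hs2] using hp1
      · simp [Expr.eval, t2]
      · intro i hi
        have := hrep2.fan i
        simp only [State.setVar_var, State.setVar_arr, State.setCell_var, reduceCtorEq, if_false,
          if_true, t2, Expr.eval, ne_eq, not_false_eq_true, State.setCell_arr_ne,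
            State.setCell_arr_self,
          and_true, Function.update_apply]
        split_ifs
        · rfl
        · exact this (by omega)
      · intro i hi
        have := hrep2.fpos i
        have := hne i
        simp only [State.setVar_var, State.setVar_arr, State.setCell_var, reduceCtorEq, if_false,
          if_true, t2, Expr.eval, ne_eq, not_false_eq_true, State.setCell_arr_ne,
            State.setCell_arr_self,
          and_true, Function.update_apply]
        split_ifs with q1 q2 q2
        · exact q1.symm
        · exact absurd rfl q2
        · exact absurd q2 (hne i (by omega))
        · exact hrep2.fpos i (by omega)
  unfold makePrimedFan
  refine (Runs.store_seq (Runs.store_seq (Runs.set_seq (Runs.set_seq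
      (key _ ?_ ?_ ⟨⟨?_, ?_, ?_, ?_, ?_⟩, ⟨?_, ?_, ?_⟩⟩))))).mono (by omega) fun _ h => h
  · exact ((((Frame.refl _ _ _).setCell (by decide) _ _ _).setCell (by decide) _ _ _).setVar
      (by decide) _).setVar (by decide) _
  · simp [Expr.eval]
  · exact fun _ _ => ⟨hem, heu⟩
  · intro j hj i hi; omega
  · exact he0
  · intro i hi; omega
  · intro i hi; omega
  · simp [Expr.eval]
  · intro i hi; simp [Expr.eval, he]; omega
  · intro i hi; simp [Expr.eval, he]; omega

/-- A color that the fan edge `f j` carries is looked up in the fan. -/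
theorem Repr.fpos_tab (h : Repr H col s) (hfan : H.Fan col u t f) (hrep : FanRepr t f s) {j : ℕ}
    (hj : j ≤ t) (hc : col (f j) ≠ 0) : s.arr .fpos (s.arr .tab u (col (f j))) 0 = j := by
  rw [h.tab _ (hfan.inc j hj).1 hc u (hfan.inc j hj).2, hrep.fpos j hj]

/-! ### The alternating path -/

/-- The memory holds the alternating path, and the colors that its edges shall receive. -/
structure PathRepr (H : IndexedGraph) (col : ℕ → ℕ) (u c₀ c₁ : ℕ) (s : State) : Prop where
  len : s.var .len = H.pathLen col u c₀ c₁
  y : s.var .y = H.walk col u c₀ c₁ (H.pathLen col u c₀ c₁)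
  path : ∀ i < H.pathLen col u c₀ c₁, s.arr .path i 0 = H.walkEdge col u c₀ c₁ i
  pnew : ∀ i < H.pathLen col u c₀ c₁, s.arr .pnew i 0 = alt c₀ c₁ (i + 1)

theorem Repr.runs_alternatingPath (h : Repr H col s) (hu : s.var .u = u) (hc₀ : s.var .c0 = c₀)
    (hc₁ : s.var .c1 = c₁) (h0 : ¬ H.Has col u c₀) (h0c₀ : c₀ ≠ 0) (h0c₁ : c₁ ≠ 0) :
    Runs alternatingPath s (7 + H.pathLen col u c₀ c₁ * 41) fun s' =>
      Frame [.y, .yc, .len, .f, .x] [.path, .pnew] s s' ∧ PathRepr H col u c₀ c₁ s' := by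
  unfold alternatingPath
  refine (Runs.set_seq (Runs.set_seq (Runs.set_seq (Runs.loop (N := 40) (L := H.pathLen col u c₀ c₁)
      (I := fun j s' => Frame [.y, .yc, .len, .f, .x] [.path, .pnew] s s' ∧
        s'.var .y = H.walk col u c₀ c₁ j ∧ s'.var .yc = alt c₀ c₁ j ∧ s'.var .len = j ∧
        ∀ i < j, s'.arr .path i 0 = H.walkEdge col u c₀ c₁ i ∧ s'.arr .pnew i 0 = alt c₀ c₁ (i + 1))
      ?_ ?_)))).mono (by omega) fun _ h => h
  · rintro j s1 hj ⟨hf1, hy, hyc, hlen, hpath⟩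
    have r1 : Repr H col s1 := h.frame hf1 (by decide) (by decide)
    have halt : alt c₀ c₁ j ≠ 0 := by rcases alt_cases c₀ c₁ j with h | h <;> omega
    have hcolor := r1.holds_hasColor (v := .var .y) (c := .var .yc)
      (by simpa only [Expr.eval, hyc] using halt)
    simp only [Expr.eval, hy, hyc] at hcolor
    rcases lt_or_eq_of_le hj with hj' | rfl
    swap
    · left
      refine ⟨?_, hf1, hlen, hy, fun i hi => (hpath i hi).1, fun i hi => (hpath i hi).2⟩
      rw [Bool.eq_false_iff, ne_eq, hcolor]
      exact not_has_walk_pathLen h.proper h0 h0c₀ h0c₁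
    right
    have hh := has_walk hj'
    refine ⟨hcolor.2 hh, hj', Runs.straight (by simp [Cmd.Straight, otherEnd]) ?_
      (by decide)⟩
    have hE := walkEdge_spec (fun _ h => has_walk h) hj'
    obtain ⟨s2, hs2⟩ : ∃ s2, s2 = ((((s1.setVar .f (H.walkEdge col u c₀ c₁ j)).setVar .yc
      (alt c₀ c₁ (j + 1))).setCell .path j 0 (H.walkEdge col u c₀ c₁ j)).setCell .pnew j 0
        (alt c₀ c₁ (j + 1))).setVar .len (j + 1) := ⟨_, rfl⟩
    have hf12 : Frame [.y, .yc, .len, .f, .x] [.path, .pnew] s1 s2 := by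
      rw [hs2]
      exact (((((Frame.refl _ _ _).setVar (by decide) _).setVar (by decide) _).setCell
        (by decide) _ _ _).setCell (by decide) _ _ _).setVar (by decide) _
    have r2 : Repr H col s2 := r1.frame hf12 (by decide) (by decide)
    have e0 : s1.var .c0 = c₀ := by rw [hf1.1 _ (by decide), hc₀]
    have e1 : s1.var .c1 = c₁ := by rw [hf1.1 _ (by decide), hc₁]
    have htab : s1.arr .tab (s1.var .y) (s1.var .yc) = H.walkEdge col u c₀ c₁ j := by
      rw [hy, hyc, r1.tab_eq halt hh]; rfl
    have hite : (Cmd.ite (.eq (.var .yc) (.var .c1)) (.set .yc (.var .c0)) (.set .yc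
      (.var .c1))).exec
        (s1.setVar .f (H.walkEdge col u c₀ c₁ j)) =
        (s1.setVar .f (H.walkEdge col u c₀ c₁ j)).setVar .yc (alt c₀ c₁ (j + 1)) := by
      by_cases hyc' : alt c₀ c₁ j = c₁
      · rw [Cmd.exec_ite_true (by simpa [Test.holds_eq, Expr.eval, hyc, e1] using hyc'),
        Cmd.exec_set]
        congr 1
        simp only [Expr.eval, State.setVar_var, reduceCtorEq, if_false, e0]
        rcases alt_cases c₀ c₁ j with h' | h' <;> omega
      · rw [Cmd.exec_ite_false (by simpa [Test.holds_eq, Expr.eval, hyc, e1] using hyc'),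
        Cmd.exec_set]
        congr 1
        simp only [Expr.eval, State.setVar_var, reduceCtorEq, if_false, e1]
        rcases alt_cases c₀ c₁ j with h' | h' <;> omega
    rw [Cmd.exec_seq, Cmd.exec_seq, Cmd.exec_set,
      show (Expr.cell .tab (.var .y) (.var .yc)).eval s1 = _ from htab, hite, Cmd.exec_seq,
      Cmd.exec_store, Cmd.exec_seq, Cmd.exec_store, Cmd.exec_seq, Cmd.exec_set]
    simp only [Expr.eval, State.setVar_var, State.setCell_var, reduceCtorEq, if_false, if_true,
      hlen,
      ← hs2]
    rw [Cmd.exec_seq, r2.exec_otherEnd (by simpa [Expr.eval, hs2] using hE.1), Cmd.exec_set]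
    simp only [Expr.eval]
    refine ⟨((hf1.trans hf12).setVar (by decide) _).setVar (by decide) _, ?_, ?_, ?_, ?_⟩
    · simp [hs2, hy, walk_succ]
    · simp [hs2]
    · simp [hs2]
    · intro i hi
      rcases eq_or_ne i j with rfl | hij
      · simp [hs2]
      · simpa [hs2, hij] using hpath i (by omega)
  · refine ⟨(((Frame.refl _ _ _).setVar (by decide) _).setVar (by decide) _).setVar (by decide) _,
      ?_, ?_, ?_, ?_⟩
    · simp [Expr.eval, hu, walk]
    · simp [Expr.eval, hc₁, alt]
    · simp [Expr.eval]
    · intro i hi; omega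

end ColorEdges

/-! ### Recoloring -/

namespace ColorEdges

open IndexedGraph

variable {H : IndexedGraph} {col : ℕ → ℕ} {s s' : State} {u t q c₀ c₁ : ℕ} {f : ℕ → ℕ}

/-- The registers that the recoloring programs write. -/
abbrev recolorVars : List Var := [.i, .g, .c, .k, .z, .last, .l]

/-- The arrays that the recoloring programs write. -/
abbrev recolorArrs : List Arr := [.color, .tab, .cnt, .free, .pos, .un, .ind]

/-- All edges of the path are uncolored before the first of them receives its new color; hence all
intermediate colorings are proper. -/
theorem Repr.runs_flipPath (h : Repr H col s) (h0 : ¬ H.Has col u c₀) (h0c₀ : c₀ ≠ 0)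
    (h0c₁ : c₁ ≠ 0) (hle₀ : c₀ ≤ H.maxDeg + 1) (hle₁ : c₁ ≤ H.maxDeg + 1) (h01 : c₀ ≠ c₁)
    (hP : PathRepr H col u c₀ c₁ s) :
    Runs flipPath s (9 + H.pathLen col u c₀ c₁ * 162) fun s' =>
      Frame recolorVars recolorArrs s s' ∧ s'.var .l = s.var .l ∧
        Repr H (H.flip col u c₀ c₁) s' := by
  classical
  obtain ⟨L, hL⟩ : ∃ L, L = H.pathLen col u c₀ c₁ := ⟨_, rfl⟩
  obtain ⟨E, hE⟩ : ∃ E, E = H.walkEdge col u c₀ c₁ := ⟨_, rfl⟩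
  have hpath := hP.path
  have hpnew := hP.pnew
  have hlen := hP.len
  rw [← hL] at hpath hpnew hlen ⊢
  rw [← hE] at hpath
  have hspec : ∀ i < L, E i < H.m ∧ col (E i) ≠ 0 := by
    intro i hi
    have := walkEdge_spec (fun _ h => has_walk h) (hL ▸ hi)
    rw [← hE] at this
    refine ⟨this.1, ?_⟩
    rw [this.2.2.2]
    rcases alt_cases c₀ c₁ i with h | h <;> omega
  have hne : ∀ j < L, ∀ i < j, E i ≠ E j := by
    intro j hj
    rw [hE]
    exact walkEdge_ne h.proper h0 h0c₀ h0c₁ (fun _ h => has_walk h) j (hL ▸ hj)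
  have hflip : ∀ i < L, H.flip col u c₀ c₁ (E i) = alt c₀ c₁ (i + 1) := by
    intro i hi
    rw [hE]
    exact flip_walkEdge (hL ▸ hi) h01
  have hproper := h.proper.flip h0 h0c₀ h0c₁ hle₀ hle₁
  -- the coloring while the edges of the path are being uncolored
  obtain ⟨A, hA⟩ : ∃ A : ℕ → ℕ → ℕ, A = fun j e => if ∃ i < j, e = E i then 0 else col e := ⟨_, rfl⟩
  -- the coloring while the edges of the path receive their new colors
  obtain ⟨B, hB⟩ : ∃ B : ℕ → ℕ → ℕ, B = fun j e =>
    if (∃ i < L, e = E i) ∧ ¬ ∃ i < j, e = E i then 0 else H.flip col u c₀ c₁ e := ⟨_, rfl⟩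
  have hA0 : A 0 = col := by funext e; simp [hA]
  have hAB : A L = B 0 := by
    funext e
    simp only [hA, hB]
    by_cases he : ∃ i < L, e = E i
    · rw [if_pos he, if_pos ⟨he, by simp⟩]
    · rw [if_neg he, if_neg (fun h => he h.1), flip_of_not (by rw [← hL, ← hE]; exact he)]
  have hBL : B L = H.flip col u c₀ c₁ := by
    funext e
    simp only [hB, and_not_self, if_false]
  have hAs : ∀ j < L, Function.update (A j) (E j) 0 = A (j + 1) := by
    intro j hj
    funext e
    simp only [hA, Function.update_apply, Nat.lt_succ_iff_lt_or_eq, or_and_right, exists_or,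
      exists_eq_left]
    by_cases e = E j <;> simp_all
  have hBs : ∀ j < L, Function.update (B j) (E j) (alt c₀ c₁ (j + 1)) = B (j + 1) := by
    intro j hj
    funext e
    have := hflip j hj
    simp only [hB, Function.update_apply, Nat.lt_succ_iff_lt_or_eq, or_and_right, exists_or,
      exists_eq_left]
    by_cases e = E j <;> simp_all
  have first : ∀ s1, s1 = s.setVar .i 0 → Runs (.loop (.lt (.var .i) (.var .len))
      (.set .g (cell1 .path (.var .i)) ;; removeColor ;; .set .i (.succ (.var .i)))) s1
      (1 + L * (60 + 1)) fun s' =>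
      Frame recolorVars recolorArrs s s' ∧ s'.var .l = s.var .l + L ∧ Repr H (B 0) s' := by
    intro s1 hs1
    refine Runs.loop (I := fun j s' => Frame recolorVars recolorArrs s s' ∧ s'.var .i = j ∧
      s'.var .l = s.var .l + j ∧ Repr H (A j) s') ?_
      ⟨?_, by simp [hs1], by simp [hs1], ?_⟩
    · rintro j s2 hj ⟨f2, i2, l2, r2⟩
      have hlen2 : s2.var .len = L := by rw [f2.1 _ (by decide), hlen]
      rcases lt_or_eq_of_le hj with hj' | rfl
      swap
      · left
        refine ⟨?_, f2, l2, hAB ▸ r2⟩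
        rw [Bool.eq_false_iff, ne_eq, Test.holds_lt]
        simp [Expr.eval, i2, hlen2]
      right
      refine ⟨Test.holds_lt.2 (by simpa [Expr.eval, i2, hlen2] using hj'), hj', Runs.straight
        (by simp [Cmd.Straight, removeColor, addMissing]) ?_ (by decide)⟩
      rw [Cmd.exec_seq, Cmd.exec_set, Cmd.exec_seq]
      have hg : (cell1 .path (.var .i)).eval s2 = E j := by
        simp only [Expr.eval]
        rw [f2.2 _ (by decide), i2, hpath j hj']
      rw [hg]
      have f3 := f2.setVar (v := .g) (by decide) (E j)
      have r3 : Repr H (A j) (s2.setVar .g (E j)) :=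
        r2.frame ((Frame.refl [.g] [] _).setVar (by decide) _) (by decide) (by decide)
      have f4 := f3.trans ((frame_removeColor (s2.setVar .g (E j))).mono (by decide) (by decide))
      obtain ⟨r4, l4, -⟩ := r3.exec_removeColor (g := E j) (by simp) (hspec j hj').1 (by
        rw [hA]
        simp only
        rw [if_neg (by rintro ⟨i, hi, h'⟩; exact hne j hj' i hi h'.symm)]
        exact (hspec j hj').2)
      rw [hAs j hj'] at r4
      rw [Cmd.exec_set]
      refine ⟨f4.setVar (by decide) _, ?_, ?_,
        r4.frame ((Frame.refl [.i] [] _).setVar (by decide) _) (by decide) (by decide)⟩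
      · simp [Expr.eval, (frame_removeColor (s2.setVar .g (E j))).1 .i (by decide), i2]
      · simp [l4, l2, add_assoc]
    · rw [hs1]; exact (Frame.refl _ _ _).setVar (by decide) _
    · rw [hA0, hs1]
      exact h.frame ((Frame.refl [.i] [] _).setVar (by decide) _) (by decide) (by decide)
  have second : ∀ s0 s1, Frame recolorVars recolorArrs s s0 → s0.var .l = s.var .l + L →
      Repr H (B 0) s0 → s1 = s0.setVar .i 0 → Runs (.loop (.lt (.var .i) (.var .len))
      (.set .g (cell1 .path (.var .i)) ;; .set .c (cell1 .pnew (.var .i)) ;; assignColor ;;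
        .set .i (.succ (.var .i)))) s1
      (1 + L * (100 + 1)) fun s' =>
      Frame recolorVars recolorArrs s s' ∧ s'.var .l = s.var .l ∧
        Repr H (H.flip col u c₀ c₁) s' := by
    intro s0 s1 hf0 hl0 hr0 hs1
    refine Runs.loop (I := fun j s' => Frame recolorVars recolorArrs s s' ∧ s'.var .i = j ∧
      s'.var .l = s.var .l + L - j ∧ Repr H (B j) s') ?_
      ⟨?_, by simp [hs1], by simp [hs1, hl0], ?_⟩
    · rintro j s2 hj ⟨f2, i2, l2, r2⟩
      have hlen2 : s2.var .len = L := by rw [f2.1 _ (by decide), hlen]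
      rcases lt_or_eq_of_le hj with hj' | rfl
      swap
      · left
        refine ⟨?_, f2, by rw [l2]; omega, hBL ▸ r2⟩
        rw [Bool.eq_false_iff, ne_eq, Test.holds_lt]
        simp [Expr.eval, i2, hlen2]
      right
      refine ⟨Test.holds_lt.2 (by simpa [Expr.eval, i2, hlen2] using hj'), hj', Runs.straight
        (by simp [Cmd.Straight, assignColor, dropMissing]) ?_ (by decide)⟩
      rw [Cmd.exec_seq, Cmd.exec_set, Cmd.exec_seq, Cmd.exec_set, Cmd.exec_seq]
      have hg : (cell1 .path (.var .i)).eval s2 = E j := by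
        simp only [Expr.eval]
        rw [f2.2 _ (by decide), i2, hpath j hj']
      rw [hg]
      have hc : (cell1 .pnew (.var .i)).eval (s2.setVar .g (E j)) = alt c₀ c₁ (j + 1) := by
        simp only [Expr.eval, State.setVar_var, State.setVar_arr, reduceCtorEq, if_false]
        rw [f2.2 _ (by decide), i2, hpnew j hj']
      rw [hc]
      obtain ⟨s3, hs3⟩ : ∃ s3, s3 = (s2.setVar .g (E j)).setVar .c (alt c₀ c₁ (j + 1)) := ⟨_, rfl⟩
      rw [← hs3]
      have f23 : Frame [.g, .c] [] s2 s3 := by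
        rw [hs3]; exact ((Frame.refl _ _ _).setVar (by decide) _).setVar (by decide) _
      have f3 := f2.trans (f23.mono (A' := recolorVars) (B' := recolorArrs) (by decide) (by decide))
      have r3 : Repr H (B j) s3 := r2.frame f23 (by decide) (by decide)
      have f4 := f3.trans ((frame_assignColor s3).mono (by decide) (by decide))
      have halt : (1 ≤ alt c₀ c₁ (j + 1)) ∧ alt c₀ c₁ (j + 1) ≤ H.maxDeg + 1 := by
        rcases alt_cases c₀ c₁ j with h | h <;> omega
      have hB0 : B j (E j) = 0 := by
        rw [hB]
        simp only
        rw [if_pos ⟨⟨j, hj', rfl⟩, by rintro ⟨i, hi, h'⟩; exact hne j hj' i hi h'.symm⟩]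
      -- all edges that are colored at this stage have their final colors, which are proper
      have hmiss : ∀ v, H.Inc (E j) v → ¬ H.Has (B j) v (alt c₀ c₁ (j + 1)) := by
        rintro v hv ⟨e, he, hev, hec⟩
        have hBe : B j e = H.flip col u c₀ c₁ e := by
          rw [hB] at hec ⊢
          simp only at hec ⊢
          split_ifs at hec ⊢
          · omega
          · rfl
        have : e = E j := hproper.inj v e (E j) he (hspec j hj').1 hev hv
          (by rw [← hBe, hec, hflip j hj']) (by omega)
        rw [this] at hec
        omega
      obtain ⟨r4, l4⟩ := r3.exec_assignColor (g := E j) (by simp [hs3]) (by simp [hs3])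
        (hspec j hj').1 hB0 halt.1 halt.2 hmiss
      rw [hBs j hj'] at r4
      rw [Cmd.exec_set]
      refine ⟨f4.setVar (by decide) _, ?_, ?_,
        r4.frame ((Frame.refl [.i] [] _).setVar (by decide) _) (by decide) (by decide)⟩
      · simp only [State.setVar_var, if_true, Expr.eval]
        rw [(frame_assignColor s3).1 .i (by decide), f23.1 _ (by decide), i2]
      · have l3 : s3.var .l = s2.var .l := f23.1 _ (by decide)
        simp [l4, l3, l2]; omega
    · rw [hs1]; exact hf0.setVar (by decide) _
    · rw [hs1]
      exact hr0.frame ((Frame.refl [.i] [] _).setVar (by decide) _) (by decide) (by decide)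
  unfold flipPath
  refine (Runs.set_seq (Runs.seq (first _ rfl) fun s' hs' => Runs.set_seq
    (second s' _ hs'.1 hs'.2.1 hs'.2.2 rfl))).mono (by omega) fun _ h => h

theorem Repr.runs_shiftFan (h : Repr H col s) (hfan : H.Fan col u q f) (hq : s.var .q = q)
    (hf : ∀ i ≤ q, s.arr .fan i 0 = f i) :
    Runs shiftFan s (3 + q * 151) fun s' =>
      Frame recolorVars recolorArrs s s' ∧ s'.var .l = s.var .l ∧ Repr H (shift col f q) s' := by
  unfold shiftFan
  refine (Runs.set_seq (Runs.loop (N := 150) (L := q)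
    (I := fun j s' => Frame recolorVars recolorArrs s s' ∧ s'.var .i = j ∧
      s'.var .l = s.var .l ∧ Repr H (shift col f j) s') ?_ ?_)).mono (by omega) fun _ h => h
  · rintro j s2 hj ⟨f2, i2, l2, r2⟩
    have hq2 : s2.var .q = q := by rw [f2.1 _ (by decide), hq]
    rcases lt_or_eq_of_le hj with hj' | rfl
    swap
    · left
      refine ⟨?_, f2, l2, r2⟩
      rw [Bool.eq_false_iff, ne_eq, Test.holds_lt]
      simp [Expr.eval, i2, hq2]
    right
    refine ⟨Test.holds_lt.2 (by simpa [Expr.eval, i2, hq2] using hj'), hj', Runs.straight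
      (by simp [Cmd.Straight, assignColor, dropMissing, removeColor, addMissing]) ?_ (by decide)⟩
    rw [Cmd.exec_seq, Cmd.exec_set, Cmd.exec_seq, Cmd.exec_seq, Cmd.exec_set, Cmd.exec_seq,
      Cmd.exec_set]
    have hg : (cell1 .fan (.succ (.var .i))).eval s2 = f (j + 1) := by
      simp only [Expr.eval]
      rw [f2.2 _ (by decide), i2, hf _ hj']
    rw [hg]
    obtain ⟨s3, hs3⟩ : ∃ s3, s3 = s2.setVar .g (f (j + 1)) := ⟨_, rfl⟩
    rw [← hs3]
    have f23 : Frame [.g] [] s2 s3 := by rw [hs3]; exact (Frame.refl _ _ _).setVar (by decide) _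
    have f3 := f2.trans (f23.mono (A' := recolorVars) (B' := recolorArrs) (by decide) (by decide))
    have r3 : Repr H (shift col f j) s3 := r2.frame f23 (by decide) (by decide)
    have f34 := frame_removeColor s3
    have f4 := f3.trans (f34.mono (by decide) (by decide))
    have hfj1 := hfan.inc (j + 1) hj'
    have hfj := hfan.inc j hj'.le
    have hpos := hfan.pos j hj'
    obtain ⟨r4, l4, c4⟩ := r3.exec_removeColor (g := f (j + 1)) (by simp [hs3]) hfj1.1
      (by rw [hfan.shift_succ hj']; exact hpos)
    rw [hfan.shift_succ hj'] at c4
    obtain ⟨s4, hs4⟩ : ∃ s4, s4 = removeColor.exec s3 := ⟨_, rfl⟩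
    rw [← hs4] at r4 l4 c4 f4 f34 ⊢
    have i4 : s4.var .i = j := by rw [f34.1 _ (by decide), f23.1 _ (by decide), i2]
    have hg4 : (cell1 .fan (.var .i)).eval s4 = f j := by
      simp only [Expr.eval]
      rw [f4.2 _ (by decide), i4, hf _ hj'.le]
    rw [hg4]
    obtain ⟨s5, hs5⟩ : ∃ s5, s5 = s4.setVar .g (f j) := ⟨_, rfl⟩
    rw [← hs5]
    have f45 : Frame [.g] [] s4 s5 := by rw [hs5]; exact (Frame.refl _ _ _).setVar (by decide) _
    have f5 := f4.trans (f45.mono (A' := recolorVars) (B' := recolorArrs) (by decide) (by decide))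
    have r5 := r4.frame f45 (by decide) (by decide)
    have f56 := frame_assignColor s5
    have f6 := f5.trans (f56.mono (by decide) (by decide))
    obtain ⟨r6, l6⟩ := r5.exec_assignColor (g := f j) (c := col (f (j + 1))) (by simp [hs5])
      (by simp [hs5, c4]) hfj.1
      (by
        rw [Function.update_of_ne (hfan.ne (j + 1) hj' j (by omega))]
        exact (hfan.shift_spec hj'.le).2.1)
      (by omega) (h.proper.le _ hfj1.1)
      (fun v hv => hfan.not_has_shift_update hj' r3.proper hv)
    refine ⟨f6.setVar (by decide) _, ?_, ?_,
      r6.frame ((Frame.refl [.i] [] _).setVar (by decide) _) (by decide) (by decide)⟩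
    · simp [Expr.eval, f56.1 .i (by decide), f45.1 .i (by decide), i4]
    · have l5 : s5.var .l = s4.var .l := f45.1 _ (by decide)
      have l3 : s3.var .l = s2.var .l := f23.1 _ (by decide)
      simp [l6, l5, l4, l3, l2]
  · exact ⟨(Frame.refl _ _ _).setVar (by decide) _, by simp [Expr.eval], by simp,
      h.frame ((Frame.refl [.i] [] _).setVar (by decide) _) (by decide) (by decide)⟩

/-- Shifting the fan, and coloring the last edge that it uncolors. -/
theorem Repr.runs_shiftFan_assignColor (h : Repr H col s) (hfan : H.Fan col u q f)
    (hq : s.var .q = q) (hf : ∀ i ≤ q, s.arr .fan i 0 = f i) (hc : s.var .c1 = c₁) (h1 : 1 ≤ c₁)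
    (hle : c₁ ≤ H.maxDeg + 1) (hu : ¬ H.Has col u c₁) (hx : ¬ H.Has col (H.other (f q) u) c₁) :
    Runs (shiftFan ;; .set .g (cell1 .fan (.var .q)) ;; .set .c (.var .c1) ;; assignColor) s
      (69 + q * 151) fun s' => s'.var .l = s.var .l - 1 ∧ ∃ col', Repr H col' s' := by
  refine (Runs.seq (h.runs_shiftFan hfan hq hf) (N' := 65) ?_).mono (by omega) fun _ h => h
  rintro s1 ⟨f1, l1, r1⟩
  refine Runs.straight (by simp [Cmd.Straight, assignColor, dropMissing]) ?_ (by decide)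
  rw [Cmd.exec_seq, Cmd.exec_set, Cmd.exec_seq, Cmd.exec_set]
  have hg : (cell1 .fan (.var .q)).eval s1 = f q := by
    simp only [Expr.eval]
    rw [f1.2 _ (by decide), f1.1 _ (by decide), hq, hf q le_rfl]
  rw [hg]
  obtain ⟨s2, hs2⟩ : ∃ s2, s2 = (s1.setVar .g (f q)).setVar .c
    ((Expr.var .c1).eval (s1.setVar .g (f q))) := ⟨_, rfl⟩
  have f2 : Frame [.g, .c] [] s1 s2 := by
    rw [hs2]; exact ((Frame.refl _ _ _).setVar (by decide) _).setVar (by decide) _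
  rw [← hs2]
  have r2 := r1.frame f2 (by decide) (by decide)
  have hfq := hfan.inc q le_rfl
  obtain ⟨r3, l3⟩ := r2.exec_assignColor (g := f q) (c := c₁) (by simp [hs2])
    (by simp [hs2, Expr.eval, f1.1 .c1 (by decide), hc]) hfq.1 (hfan.shift_spec le_rfl).2.1 h1 hle
    (fun v hv => by
      rcases eq_or_eq_other hfq.2 hv with rfl | rfl
      · exact hfan.not_has_shift_center le_rfl (by omega) hu
      · exact hfan.not_has_shift_leaf le_rfl (by omega) hx)
  exact ⟨by rw [l3, f2.1 _ (by decide), l1], _, r3⟩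

/-- Vizing's argument.  If `c₁` is missing at the center, the whole fan is shifted.  Otherwise `c₁`
becomes missing at the center by the exchange of colors on the path.  If the path ends at the leaf
`x` whose successor in the fan has color `c₁`, the whole fan remains a fan, and its last leaf, which
is not on the path, still misses `c₁`; if not, this holds for the fan that ends with `x`. -/
theorem Repr.runs_extendColoring (h : Repr H col s) (hfan : H.PrimedFan col u t f c₁)
    (hrep : FanRepr t f s) (hu : s.var .u = u) (hc₁ : s.var .c1 = c₁)
    (hc₀ : c₀ ∈ H.missing col u) (hP : PathRepr H col u c₀ c₁ s) :
    Runs extendColoring s (100 + H.pathLen col u c₀ c₁ * 162 + t * 151) fun s' =>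
      s'.var .l = s.var .l - 1 ∧ ∃ col', Repr H col' s' := by
  obtain ⟨⟨h0c₀, hle₀⟩, h0⟩ := mem_missing.1 hc₀
  have h0c₁ := hfan.one_le
  have hcolor := h.holds_hasColor (v := .var .u) (c := .var .c1)
    (by simp only [Expr.eval, hc₁]; omega)
  simp only [Expr.eval, hu, hc₁] at hcolor
  unfold extendColoring
  by_cases hh : H.Has col u c₁
  swap
  · refine (Runs.seq (Runs.ite_true (Test.holds_not.2 (hcolor.not.2 hh)) (N := 1)
      (Q := fun s' => s' = s.setVar .q t) (Runs.straight (by trivial) ?_ (by decide)))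
        (N' := 69 + t * 151)
      ?_).mono (by omega) fun _ h => h
    · simp [Cmd.exec_set, Expr.eval, hrep.length]
    · rintro s1 rfl
      have h' : Repr H col (s.setVar .q t) :=
        h.frame ((Frame.refl [.q] [] _).setVar (by decide) _) (by decide) (by decide)
      refine (h'.runs_shiftFan_assignColor hfan.toFan (by simp) hrep.fan (by simp [hc₁])
        hfan.one_le hfan.le hh hfan.miss_last).mono le_rfl ?_
      simp
  -- the edge `f (j + 1)` has the color `c₁`
  obtain ⟨j, hj, hcj⟩ : ∃ j, j + 1 ≤ t ∧ col (f (j + 1)) = c₁ := by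
    obtain ⟨j, h1, h2, h3⟩ := hfan.primed.resolve_left (not_not.2 hh)
    exact ⟨j - 1, by omega, by rw [Nat.sub_add_cancel h1, h3]⟩
  have h01 : c₀ ≠ c₁ := by rintro rfl; exact h0 hh
  have hfj := hfan.inc j (by omega)
  have hfj1 := hfan.inc (j + 1) hj
  have hft := hfan.inc t le_rfl
  obtain ⟨x, hx⟩ : ∃ x, x = H.other (f j) u := ⟨_, rfl⟩
  obtain ⟨y, hy⟩ : ∃ y, y = H.walk col u c₀ c₁ (H.pathLen col u c₀ c₁) := ⟨_, rfl⟩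
  have hxu : x ≠ u := hx ▸ other_ne hfj.1
  have hmx : ¬ H.Has col x c₁ := by rw [hx, ← hcj]; exact hfan.miss j (by omega)
  have hmu := not_has_flip_self h.proper h0 (by omega) (by omega : c₁ ≠ 0)
  -- only the edge `f (j + 1)` of the fan has one of the two colors
  have huniq : ∀ i < t, col (f (i + 1)) = c₁ → i = j := by
    intro i hi hc
    by_contra hij
    refine hfan.ne' (i := i + 1) (j := j + 1) (by omega) hj (by omega) ?_
    have := hfan.inc (i + 1) hi
    exact h.proper.inj u _ _ this.1 hfj1.1 this.2 hfj1.2 (by omega) (by omega)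
  have main : Runs (.set .q (cell1 .fpos (.cell .tab (.var .u) (.var .c1))).pred ;;
      flipPath ;;
      otherEnd .x (cell1 .fan (.var .q)) (.var .u) ;;
      .ite (.eq (.var .y) (.var .x)) (.set .q (.var .t)) .skip) s
      (29 + H.pathLen col u c₀ c₁ * 162) fun s' => Repr H (H.flip col u c₀ c₁) s' ∧
        s'.var .l = s.var .l ∧ s'.var .c1 = c₁ ∧ s'.arr .fan = s.arr .fan ∧
        s'.var .q = if y = x then t else j := by
    have hq : ((cell1 .fpos (.cell .tab (.var .u) (.var .c1))).pred).eval s = j := by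
      have := h.fpos_tab hfan.toFan hrep hj (by omega)
      rw [hcj] at this
      simp [Expr.eval, hu, hc₁, this]
    refine (Runs.set_seq (N := 27 + H.pathLen col u c₀ c₁ * 162) ?_).mono (by omega) fun _ h => h
    rw [hq]
    have h' : Repr H col (s.setVar .q j) :=
      h.frame ((Frame.refl [.q] [] _).setVar (by decide) _) (by decide) (by decide)
    refine (Runs.seq (h'.runs_flipPath h0 (by omega) (by omega) hle₀ hfan.le h01
      ⟨by simp [hP.len], by simp [hP.y], hP.path, hP.pnew⟩) (N' := 10) ?_).mono (by omega)
      fun _ h => h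
    rintro s1 ⟨f1, l1, r1⟩
    refine Runs.straight (by simp [Cmd.Straight, otherEnd]) ?_ (by decide)
    have hfq : (cell1 .fan (.var .q)).eval s1 = f j := by
      simp only [Expr.eval]
      rw [f1.2 _ (by decide), f1.1 _ (by decide)]
      simp [hrep.fan j (by omega)]
    have u1 : (Expr.var .u).eval s1 = u := by simp [Expr.eval, f1.1 .u (by decide), hu]
    rw [Cmd.exec_seq, r1.exec_otherEnd (by rw [hfq]; exact hfj.1), hfq, u1, ← hx]
    have htest : Test.holds (s1.setVar .x x) (.eq (.var .y) (.var .x)) = true ↔ y = x := by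
      simp [Test.holds_eq, Expr.eval, f1.1 .y (by decide), hP.y, hy]
    have r2 : Repr H (H.flip col u c₀ c₁) (s1.setVar .x x) :=
      r1.frame ((Frame.refl [.x] [] _).setVar (by decide) _) (by decide) (by decide)
    by_cases hyx : y = x
    · rw [Cmd.exec_ite_true (htest.2 hyx), if_pos hyx, Cmd.exec_set]
      refine ⟨r2.frame ((Frame.refl [.q] [] _).setVar (by decide) _) (by decide) (by decide), ?_⟩
      simp [l1, f1.1 .c1 (by decide), hc₁, f1.2 .fan (by decide), Expr.eval, f1.1 .t (by decide),
        hrep.length]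
    · rw [Cmd.exec_ite_false (htest.not.2 hyx), if_neg hyx]
      refine ⟨r2, ?_⟩
      simp [Cmd.exec, l1, f1.1 .c1 (by decide), hc₁, f1.2 .fan (by decide), f1.1 .q (by decide)]
  refine (Runs.seq (Runs.ite_false (by simpa [Test.holds] using hcolor.2 hh) main)
    (N' := 69 + t * 151) ?_).mono (by omega) fun _ h => h
  rintro s1 ⟨r1, l1, c1, fan1, q1⟩
  by_cases hyx : y = x
  · rw [if_pos hyx] at q1
    have hfan' : H.Fan (H.flip col u c₀ c₁) u t f := hfan.toFan.flip h.proper h0 (by omega)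
      (by omega) fun i hi hc => by rw [huniq i hi hc, ← hx, ← hyx, hy]
    refine (r1.runs_shiftFan_assignColor hfan' q1 (by rw [fan1]; exact hrep.fan) c1 hfan.one_le
      hfan.le hmu ?_).mono le_rfl (by rw [l1]; exact fun _ h => h)
    refine not_has_flip_of_ne_ends (other_ne hft.1) ?_ hfan.miss_last
    rw [← hy, hyx, hx]
    -- different edges at `u` lead to different leaves
    intro heq
    refine hfan.ne t le_rfl j hj (H.simple _ hfj.1 _ hft.1 u _ (other_ne hfj.1).symm hfj.2 inc_other
      hft.2 (heq ▸ inc_other))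
  · rw [if_neg hyx] at q1
    have hfan' : H.Fan (H.flip col u c₀ c₁) u j f :=
      (hfan.toFan.mono (show j ≤ t by omega)).flip h.proper h0 (by omega) (by omega)
        fun i hi hc => absurd (huniq i (by omega) hc) (by omega)
    refine (r1.runs_shiftFan_assignColor hfan' q1 (fun i hi => by
      rw [fan1]; exact hrep.fan i (by omega)) c1 hfan.one_le hfan.le hmu ?_).mono
      (by omega) (by rw [l1]; exact fun _ h => h)
    rw [← hx]
    exact not_has_flip_of_ne_ends hxu (fun h => hyx (hy.trans h.symm)) hmx

end ColorEdges

/-! ### The random missing color -/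

namespace ColorEdges

open IndexedGraph

open scoped ENNReal

variable {H : IndexedGraph} {col : ℕ → ℕ} {s s' : State} {u : ℕ}

theorem ert_set_seq (v : Var) (p : Expr) (P : Cmd) (f : State → ℝ≥0∞) (s : State) :
    ert (.set v p ;; P) f s = 2 + ert P f (s.setVar v (p.eval s)) := by
  rw [ert_seq, ert_set, ← add_assoc, one_add_one_eq_two]

/-- The average of `g` over the set `M` of colors. -/
noncomputable def average (M : Finset ℕ) (g : ℕ → ℝ≥0∞) : ℝ≥0∞ := (∑ c ∈ M, g c) / M.card

theorem card_mul_average {M : Finset ℕ} (hM : M.card ≠ 0) (g : ℕ → ℝ≥0∞) :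
    M.card * average M g = ∑ c ∈ M, g c :=
  ENNReal.mul_div_cancel (by exact_mod_cast hM) (ENNReal.natCast_ne_top _)

theorem average_const_add {M : Finset ℕ} (hM : M.card ≠ 0) (g : ℕ → ℝ≥0∞) (a : ℝ≥0∞) :
    average M (fun c => a + g c) = a + average M g := by
  have h : (M.card : ℝ≥0∞) ≠ 0 := by exact_mod_cast hM
  rw [average, Finset.sum_add_distrib, Finset.sum_const, nsmul_eq_mul, ENNReal.add_div, mul_comm,
    ENNReal.mul_div_cancel_right h (ENNReal.natCast_ne_top _), average]

theorem average_const_mul {M : Finset ℕ} (g : ℕ → ℝ≥0∞) (a : ℝ≥0∞) :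
    average M (fun c => a * g c) = a * average M g := by
  rw [average, ← Finset.mul_sum, mul_div_assoc, average]

theorem card_missing_ne_zero : (H.missing col u).card ≠ 0 := by
  have := card_uncolored_lt_card_missing (H := H) col u
  omega

theorem sum_range_add_one (N : ℕ) (φ : ℕ → ℝ≥0∞) :
    ∑ w ∈ Finset.range N, φ (w + 1) = ∑ c ∈ Finset.Icc 1 N, φ c := by
  rw [Finset.range_eq_Ico, Finset.sum_Ico_add' φ 0 N 1, zero_add]
  rfl

/-- Listing all missing colors takes time proportional to the degree if the degree is large. -/
theorem Repr.ert_listing_le (h : Repr H col s) (hu : s.var .u = u)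
    (hd : H.maxDeg < 2 * H.deg u) {f : State → ℝ≥0∞} {g : ℕ → ℝ≥0∞}
    (hfg : ∀ c₀ ∈ H.missing col u, ∀ s', Frame [.k, .c, .r, .c0] [.aux] s s' →
      s'.var .c0 = c₀ → f s' ≤ g c₀) :
    ert (.set .k (.lit 0) ;;
      .set .c (.lit 1) ;;
      .loop (.le (.var .c) (.succ (.var .maxDeg)))
        (.ite (.not (hasColor (.var .u) (.var .c)))
            (store1 .aux (.var .k) (.var .c) ;;
             .set .k (.succ (.var .k)))
            .skip ;;
          .set .c (.succ (.var .c))) ;;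
      .rand .r (Expr.var .k).pred ;;
      .set .c0 (cell1 .aux (.var .r))) f s ≤
      ((10 + 82 * H.deg u : ℕ) : ℝ≥0∞) + average (H.missing col u) g := by
  classical
  have hloop : Runs (.loop (.le (.var .c) (.succ (.var .maxDeg)))
        (.ite (.not (hasColor (.var .u) (.var .c)))
            (store1 .aux (.var .k) (.var .c) ;;
             .set .k (.succ (.var .k)))
            .skip ;;
          .set .c (.succ (.var .c)))) ((s.setVar .k 0).setVar .c 1) (1 + (H.maxDeg + 1) * (40 + 1))
      fun s' => Frame [.k, .c, .r, .c0] [.aux] s s' ∧ s'.var .k = (H.missing col u).card ∧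
        (Finset.range (s'.var .k)).image (fun i => s'.arr .aux i 0) = H.missing col u := by
    refine Runs.loop (I := fun j s' => Frame [.k, .c, .r, .c0] [.aux] s s' ∧
      s'.var .c = j + 1 ∧ s'.var .k = ((H.missing col u).filter (· < j + 1)).card ∧
      (Finset.range (s'.var .k)).image (fun i => s'.arr .aux i 0) =
        (H.missing col u).filter (· < j + 1)) ?_ ⟨?_, ?_, ?_, ?_⟩
    · rintro j s1 hj ⟨f1, c1, k1, a1⟩
      have r1 : Repr H col s1 := h.frame f1 (by decide) (by decide)
      rcases lt_or_eq_of_le hj with hj' | rfl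
      swap
      · left
        have hfil : (H.missing col u).filter (· < H.maxDeg + 1 + 1) = H.missing col u :=
          Finset.filter_true_of_mem fun c hc => by
            have := (mem_missing.1 hc).1.2
            omega
        rw [hfil] at k1 a1
        refine ⟨?_, f1, k1, a1⟩
        rw [Bool.eq_false_iff, ne_eq, Test.holds_le]
        simp [Expr.eval, c1, r1.maxDeg]
      right
      refine ⟨Test.holds_le.2 (by simp [Expr.eval, c1, r1.maxDeg]; omega), hj', Runs.straight
        (by simp [Cmd.Straight]) ?_ (by decide)⟩
      have u1 : s1.var .u = u := by rw [f1.1 _ (by decide), hu]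
      have hcolor := r1.holds_hasColor (v := .var .u) (c := .var .c) (by simp [Expr.eval, c1])
      simp only [Expr.eval, u1, c1] at hcolor
      rw [Cmd.exec_seq]
      by_cases hh : H.Has col u (j + 1)
      · rw [Cmd.exec_ite_false (fun h => Test.holds_not.1 h (hcolor.2 hh)), Cmd.exec_set, Cmd.exec]
        have hfil : (H.missing col u).filter (· < j + 1 + 1) =
            (H.missing col u).filter (· < j + 1) := by
          refine Finset.filter_congr fun c hc => ?_
          have : c ≠ j + 1 := by rintro rfl; exact (mem_missing.1 hc).2 hh
          omega
        refine ⟨f1.setVar (by decide) _, by simp [Expr.eval, c1], ?_, ?_⟩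
        · rw [hfil]; simpa using k1
        · rw [hfil]; simpa using a1
      · rw [Cmd.exec_ite_true (Test.holds_not.2 (hcolor.not.2 hh)), Cmd.exec_seq, Cmd.exec_store,
          Cmd.exec_set, Cmd.exec_set]
        have hmem : j + 1 ∈ H.missing col u := mem_missing.2 ⟨⟨by omega, by omega⟩, hh⟩
        have hfil : (H.missing col u).filter (· < j + 1 + 1) =
            insert (j + 1) ((H.missing col u).filter (· < j + 1)) := by
          ext c
          simp only [Finset.mem_filter, Finset.mem_insert]
          constructor
          · rintro ⟨h1, h2⟩
            rcases eq_or_ne c (j + 1) with h3 | h3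
            · exact Or.inl h3
            · exact Or.inr ⟨h1, by omega⟩
          · rintro (rfl | ⟨h1, h2⟩)
            · exact ⟨hmem, by omega⟩
            · exact ⟨h1, by omega⟩
        have hnot : j + 1 ∉ (H.missing col u).filter (· < j + 1) := by simp
        refine ⟨((f1.setCell (by decide) _ _ _).setVar (by decide) _).setVar (by decide) _,
          by simp [Expr.eval, c1], ?_, ?_⟩
        · rw [hfil, Finset.card_insert_of_notMem hnot]
          simpa [Expr.eval] using k1
        · rw [hfil, ← a1]
          simp only [Expr.eval, State.setVar_var, State.setCell_var, State.setVar_arr, reduceCtorEq,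
            if_false, if_true, c1, State.setCell_arr_self, and_true]
          rw [Finset.range_add_one, Finset.image_insert, if_pos rfl]
          congr 1
          refine Finset.image_congr fun i hi => ?_
          simp only [Finset.coe_range, Set.mem_Iio] at hi
          rw [if_neg (by omega)]
    · exact ((Frame.refl _ _ _).setVar (by decide) _).setVar (by decide) _
    · simp
    · rw [Finset.filter_false_of_mem fun c hc => by
        have := (mem_missing.1 hc).1.1
        omega]
      simp
    · rw [Finset.filter_false_of_mem fun c hc => by
        have := (mem_missing.1 hc).1.1
        omega]
      simp
  rw [ert_set_seq, ert_set_seq]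
  simp only [Expr.eval]
  have hle := hloop.ert_seq_le (P' := .rand .r (Expr.var .k).pred ;; .set .c0 (cell1 .aux
    (.var .r)))
    (f := f) (b := 3 + average (H.missing col u) g) (by
      rintro s1 ⟨f1, k1, a1⟩
      have hM := card_missing_ne_zero (H := H) (col := col) (u := u)
      obtain ⟨k, hk⟩ : ∃ k, s1.var .k = k + 1 := ⟨s1.var .k - 1, by omega⟩
      rw [hk] at a1 k1
      have hinj : Set.InjOn (fun i => s1.arr .aux i 0) (Finset.range (k + 1)) := by
        rw [← Finset.card_image_iff, a1, Finset.card_range, k1]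
      rw [ert_seq, ert_rand]
      simp only [ert_set, Expr.eval, hk, Nat.add_sub_cancel]
      have hs : ∑ w ∈ Finset.range (k + 1), (1 + f ((s1.setVar .r w).setVar .c0
          ((s1.setVar .r w).arr .aux ((s1.setVar .r w).var .r) 0))) ≤
          ∑ w ∈ Finset.range (k + 1), (1 + g (s1.arr .aux w 0)) := by
        refine Finset.sum_le_sum fun w hw => ?_
        gcongr
        refine hfg _ ?_ _ ((f1.setVar (by decide) _).setVar (by decide) _) (by simp)
        rw [← a1]
        exact Finset.mem_image_of_mem _ hw
      have hs' : ∑ w ∈ Finset.range (k + 1), (1 + g (s1.arr .aux w 0)) =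
          ∑ c ∈ H.missing col u, (1 + g c) := by
        rw [← a1, Finset.sum_image hinj]
      rw [hs'] at hs
      calc _ ≤ 1 + (1 + (∑ c ∈ H.missing col u, (1 + g c)) / ((k + 1 : ℕ) : ℝ≥0∞)) := by gcongr
        _ = 1 + (1 + (1 + average (H.missing col u) g)) := by
          rw [k1, ← average_const_add hM]; rfl
        _ = 3 + average (H.missing col u) g := by ring)
  calc _ ≤ 2 + (2 + (((1 + (1 + (H.maxDeg + 1) * (40 + 1)) : ℕ) : ℝ≥0∞) +
        (3 + average (H.missing col u) g))) := by gcongr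
    _ = ((9 + (H.maxDeg + 1) * 41 : ℕ) : ℝ≥0∞) + average (H.missing col u) g := by
        push_cast; ring
    _ ≤ _ := by gcongr ?_ + _; exact_mod_cast (by omega)

/-- If at least half of the colors are missing, then sampling finds a missing color after a bounded
expected number of attempts. -/
theorem Repr.ert_sampling_le (h : Repr H col s) (hu : s.var .u = u)
    (hd : H.maxDeg + 1 ≤ 2 * (H.missing col u).card) {f : State → ℝ≥0∞} {g : ℕ → ℝ≥0∞}
    (hfg : ∀ c₀ ∈ H.missing col u, ∀ s', Frame [.k, .c, .r, .c0] [.aux] s s' →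
      s'.var .c0 = c₀ → f s' ≤ g c₀) :
    ert (.rand .r (.var .maxDeg) ;;
      .set .c0 (.succ (.var .r)) ;;
      .loop (hasColor (.var .u) (.var .c0))
        (.rand .r (.var .maxDeg) ;;
         .set .c0 (.succ (.var .r)))) f s ≤ 10 + average (H.missing col u) g := by
  classical
  have hM := card_missing_ne_zero (H := H) (col := col) (u := u)
  obtain ⟨a, ha⟩ : ∃ a, a = average (H.missing col u) g := ⟨_, rfl⟩
  rw [← ha]
  -- the cost of the loop when the color `c` has been drawn; `10 + a` works for a color that is not
  -- missing, as a new draw costs `4` and fails again with probability at most one half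
  obtain ⟨φ, hφ⟩ : ∃ φ : ℕ → ℝ≥0∞,
      φ = fun c => if H.Has col u c then 10 + a else 1 + g c := ⟨_, rfl⟩
  have hsum :
      (∑ w ∈ Finset.range (H.maxDeg + 1), φ (w + 1)) / ((H.maxDeg + 1 : ℕ) : ℝ≥0∞) ≤ 6 + a := by
    rw [ENNReal.div_le_iff (by simp) (ENNReal.natCast_ne_top _), sum_range_add_one, hφ,
      Finset.sum_ite, Finset.sum_const, nsmul_eq_mul]
    have hcard := Finset.card_filter_add_card_filter_not (fun c => H.Has col u c)
      (s := Finset.Icc 1 (H.maxDeg + 1))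
    rw [Nat.card_Icc] at hcard
    change _ + (H.missing col u).card = _ at hcard
    change _ + ∑ c ∈ H.missing col u, (1 + g c) ≤ _
    generalize (Finset.filter (fun c => H.Has col u c) (Finset.Icc 1 (H.maxDeg + 1))).card = A at *
    rw [Finset.sum_add_distrib, Finset.sum_const, nsmul_eq_mul, mul_one, ← card_mul_average hM,
      ← ha]
    rw [Nat.add_sub_cancel] at hcard
    rw [← hcard] at hd ⊢
    generalize (H.missing col u).card = M at *
    have h1 : ((10 * A + M : ℕ) : ℝ≥0∞) ≤ ((6 * (A + M) : ℕ) : ℝ≥0∞) := Nat.cast_le.2 (by omega)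
    push_cast at h1 ⊢
    calc _ = (10 * A + M) + a * (A + M) := by ring
      _ ≤ 6 * (A + M) + a * (A + M) := by gcongr
      _ = _ := by ring
  obtain ⟨I, hI⟩ : ∃ I : State → ℝ≥0∞, I = fun s' => if Frame [.k, .c, .r, .c0] [.aux] s s' ∧
    1 ≤ s'.var .c0 ∧ s'.var .c0 ≤ H.maxDeg + 1 then φ (s'.var .c0) else ⊤ := ⟨_, rfl⟩
  have hdraw (s' : State) (hs' : Frame [.k, .c, .r, .c0] [.aux] s s') {w : ℕ}
      (hw : w ∈ Finset.range (H.maxDeg + 1)) :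
      I ((s'.setVar .r w).setVar .c0 ((Expr.succ (.var .r)).eval (s'.setVar .r w))) =
        φ (w + 1) := by
    rw [hI]
    simp only
    rw [Finset.mem_range] at hw
    rw [if_pos ⟨(hs'.setVar (by decide) _).setVar (by decide) _, by simp [Expr.eval],
      by simp [Expr.eval]; omega⟩]
    simp [Expr.eval]
  have hN : ((H.maxDeg + 1 : ℕ) : ℝ≥0∞) ≠ 0 := by simp
  have hsum' (k : ℝ≥0∞) : (∑ w ∈ Finset.range (H.maxDeg + 1), (k + φ (w + 1))) /
      ((H.maxDeg + 1 : ℕ) : ℝ≥0∞) ≤ k + (6 + a) := by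
    rw [Finset.sum_add_distrib, Finset.sum_const, nsmul_eq_mul, ENNReal.add_div, Finset.card_range,
      mul_comm, ENNReal.mul_div_cancel_right hN (ENNReal.natCast_ne_top _)]
    gcongr
  have hloop : ert (.loop (hasColor (.var .u) (.var .c0)) (.rand .r (.var .maxDeg) ;;
      .set .c0 (.succ (.var .r)))) f ≤ I := by
    refine ert_loop_le fun s' => ?_
    by_cases hs' : Frame [.k, .c, .r, .c0] [.aux] s s' ∧
      1 ≤ s'.var .c0 ∧ s'.var .c0 ≤ H.maxDeg + 1
    swap
    · have : I s' = ⊤ := by rw [hI]; exact if_neg hs'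
      rw [this]; exact le_top
    obtain ⟨f1, h1, h2⟩ := hs'
    have r1 : Repr H col s' := h.frame f1 (by decide) (by decide)
    have hIs : I s' = φ (s'.var .c0) := by rw [hI]; exact if_pos ⟨f1, h1, h2⟩
    have u1 : s'.var .u = u := by rw [f1.1 _ (by decide), hu]
    have hcolor := r1.holds_hasColor (v := .var .u) (c := .var .c0)
      (by simp only [Expr.eval]; omega)
    simp only [Expr.eval, u1] at hcolor
    rw [hIs, hφ]
    by_cases hh : H.Has col u (s'.var .c0)
    · rw [if_pos (hcolor.2 hh)]
      simp only [if_pos hh]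
      rw [ert_seq, ert_rand]
      simp only [ert_set, show (Expr.var .maxDeg).eval s' = H.maxDeg from r1.maxDeg]
      rw [Finset.sum_congr rfl fun w hw => by rw [hdraw _ f1 hw]]
      calc _ ≤ 1 + (1 + (1 + (1 + (6 + a)))) := by gcongr; exact hsum' 1
        _ = 10 + a := by ring
    · rw [if_neg (hcolor.not.2 hh)]
      simp only [if_neg hh]
      gcongr
      exact hfg _ (mem_missing.2 ⟨⟨h1, h2⟩, hh⟩) s' f1 rfl
  rw [ert_seq, ert_rand]
  simp only [ert_set_seq, show (Expr.var .maxDeg).eval s = H.maxDeg from h.maxDeg]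
  calc _ ≤ 1 + (1 + (∑ w ∈ Finset.range (H.maxDeg + 1), (2 + φ (w + 1))) /
          ((H.maxDeg + 1 : ℕ) : ℝ≥0∞)) := by
        gcongr with w hw
        exact (hloop _).trans_eq (hdraw s (Frame.refl _ _ _) hw)
    _ ≤ 1 + (1 + (2 + (6 + a))) := by gcongr; exact hsum' 2
    _ = 10 + a := by ring

/-- The cost `f` of what follows may depend on the color; its average over the missing colors
counts. -/
theorem Repr.ert_randomMissingColor_le (h : Repr H col s) (hu : s.var .u = u) (hv : u ∈ H.verts)
    {f : State → ℝ≥0∞} {g : ℕ → ℝ≥0∞}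
    (hfg : ∀ c₀ ∈ H.missing col u, ∀ s', Frame [.k, .c, .r, .c0] [.aux] s s' →
      s'.var .c0 = c₀ → f s' ≤ g c₀) :
    ert randomMissingColor f s ≤
      ((11 + 82 * H.deg u : ℕ) : ℝ≥0∞) + average (H.missing col u) g := by
  have htest : (Test.lt (.sub (.var .maxDeg) (cell1 .deg (.var .u))) (cell1 .deg
    (.var .u))).holds s =
      true ↔ H.maxDeg < 2 * H.deg u := by
    rw [Test.holds_lt]
    simp only [Expr.eval, h.maxDeg, hu, h.deg u hv]
    omega
  rw [randomMissingColor, ert_ite]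
  by_cases hd : H.maxDeg < 2 * H.deg u
  · rw [if_pos (htest.2 hd)]
    calc _ ≤ 1 + (((10 + 82 * H.deg u : ℕ) : ℝ≥0∞) + average (H.missing col u) g) := by
          gcongr; exact h.ert_listing_le hu hd hfg
      _ = _ := by push_cast; ring
  · rw [if_neg (htest.not.2 hd)]
    have hm := maxDeg_lt_card_missing_add_deg (H := H) col u
    calc _ ≤ 1 + (10 + average (H.missing col u) g) := by
          gcongr; exact h.ert_sampling_le hu (by omega) hfg
      _ = ((11 : ℕ) : ℝ≥0∞) + average (H.missing col u) g := by push_cast; ring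
      _ ≤ _ := by gcongr; omega

end ColorEdges

/-! ### One round, and all rounds -/

namespace ColorEdges

open IndexedGraph

open scoped ENNReal

variable {H : IndexedGraph} {col : ℕ → ℕ} {s s' : State} {u t : ℕ}

/-- The part of a round that follows the random choice of a position in the list of uncolored
edges. -/
def colorChosenEdge : Cmd :=
  .set .e (cell1 .un (.var .r)) ;;
  .ite (.le (cell1 .deg (.cell .ends (.var .e) (.lit 0)))
      (cell1 .deg (.cell .ends (.var .e) (.lit 1))))
    (.set .u (.cell .ends (.var .e) (.lit 0)))
    (.set .u (.cell .ends (.var .e) (.lit 1))) ;;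
  makePrimedFan ;;
  randomMissingColor ;;
  alternatingPath ;;
  extendColoring

/-- A bound for the expected cost of coloring the edge `e` with a fan that is primed by `c₁`. -/
noncomputable def edgeCost (H : IndexedGraph) (col : ℕ → ℕ) (e c₁ : ℕ) : ℝ≥0∞ :=
  300 + 300 * H.deg (H.center e) +
    300 * average (H.missing col (H.center e))
      (fun c₀ => (H.pathLen col (H.center e) c₀ c₁ : ℝ≥0∞))

/-- The cost of a round after the edge has been chosen.  The color `c₁` does not depend on the
random color `c₀`, as the fan is built before `c₀` is drawn. -/
theorem Repr.exists_ert_colorChosenEdge_le (h : Repr H col s) {r : ℕ} (hr : s.var .r = r)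
    (hrl : r < s.var .l) {f : State → ℝ≥0∞} {b : ℝ≥0∞}
    (hf : ∀ s', s'.var .l = s.var .l - 1 → (∃ col', Repr H col' s') → f s' ≤ b) :
    ∃ c₁ ∈ Finset.Icc 1 (H.maxDeg + 1),
      ert colorChosenEdge f s ≤ edgeCost H col (s.arr .un r 0) c₁ + b := by
  rw [colorChosenEdge]
  obtain ⟨e, he⟩ : ∃ e, e = s.arr .un r 0 := ⟨_, rfl⟩
  obtain ⟨u, hu⟩ : ∃ u, u = H.center e := ⟨_, rfl⟩
  simp only [edgeCost, ← he, ← hu]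
  obtain ⟨⟨hem, he0⟩, -⟩ := h.un.of_lt r hrl
  rw [← he] at hem he0
  have heu : H.Inc e u := hu ▸ inc_center
  have huv : u ∈ H.verts := mem_verts.2 ⟨e, hem, heu⟩
  -- the choice of the center
  obtain ⟨s1, hs1⟩ : ∃ s1, s1 = s.setVar .e e := ⟨_, rfl⟩
  have hset : (s.setVar .e ((cell1 .un (.var .r)).eval s)) = s1 := by
    simp [Expr.eval, hr, hs1, he]
  have f1 : Frame [.e] [] s s1 := by rw [hs1]; exact (Frame.refl _ _ _).setVar (by decide) _
  have r1 := h.frame f1 (by decide) (by decide)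
  have e1 : s1.var .e = e := by simp [hs1]
  have hcenter : Runs (.ite (.le (cell1 .deg (.cell .ends (.var .e) (.lit 0)))
            (cell1 .deg (.cell .ends (.var .e) (.lit 1))))
          (.set .u (.cell .ends (.var .e) (.lit 0)))
          (.set .u (.cell .ends (.var .e) (.lit 1)))) s1 2 (fun s' => s' = s1.setVar .u u) := by
    refine Runs.straight (by simp [Cmd.Straight]) ?_ (by decide)
    have htest : (Test.le (cell1 .deg (.cell .ends (.var .e) (.lit 0)))
        (cell1 .deg (.cell .ends (.var .e) (.lit 1)))).holds s1 = true ↔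
          H.deg (H.fst e) ≤ H.deg (H.snd e) := by
      rw [Test.holds_le]
      simp only [Expr.eval, e1, r1.fst e hem, r1.snd e hem,
        r1.deg _ (mem_verts.2 ⟨e, hem, Or.inl rfl⟩), r1.deg _ (mem_verts.2 ⟨e, hem, Or.inr rfl⟩)]
    by_cases hd : H.deg (H.fst e) ≤ H.deg (H.snd e)
    · rw [Cmd.exec_ite_true (htest.2 hd), Cmd.exec_set, hu, center, if_pos hd]
      simp only [Expr.eval, e1, r1.fst e hem]
    · rw [Cmd.exec_ite_false (htest.not.2 hd), Cmd.exec_set, hu, center, if_neg hd]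
      simp only [Expr.eval, e1, r1.snd e hem]
  obtain ⟨s2, hs2⟩ : ∃ s2, s2 = s1.setVar .u u := ⟨_, rfl⟩
  have f2 : Frame [.u] [] s1 s2 := by rw [hs2]; exact (Frame.refl _ _ _).setVar (by decide) _
  have r2 := r1.frame f2 (by decide) (by decide)
  have u2 : s2.var .u = u := by simp [hs2]
  obtain ⟨s3, ⟨f3, t, F, hF, hFr⟩, h3⟩ := r2.runs_makePrimedFan (e := e) (u := u)
    (by simp [hs2, e1]) hem he0 u2 heu
  have r3 := r2.frame f3 (by decide) (by decide)
  have u3 : s3.var .u = u := by rw [f3.1 _ (by decide), u2]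
  have l3 : s3.var .l = s.var .l := by
    rw [f3.1 _ (by decide), f2.1 _ (by decide), f1.1 _ (by decide)]
  obtain ⟨c₁, hc₁⟩ : ∃ c₁, c₁ = s3.var .c1 := ⟨_, rfl⟩
  rw [← hc₁] at hF
  have ht := hF.lt_deg
  have h1 := hF.one_le
  have hrest := r3.ert_randomMissingColor_le u3 huv (f := ert (alternatingPath ;; extendColoring) f)
    (g := fun c₀ => ((108 + 151 * H.deg u : ℕ) + b : ℝ≥0∞) +
      203 * (H.pathLen col u c₀ c₁ : ℝ≥0∞)) (by
    intro c₀ hc₀ s4 f4 c4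
    have r4 := r3.frame f4 (by decide) (by decide)
    obtain ⟨⟨hc₀1, hc₀2⟩, hc₀3⟩ := mem_missing.1 hc₀
    have u4 : s4.var .u = u := by rw [f4.1 _ (by decide), u3]
    have hc4 : s4.var .c1 = c₁ := by rw [f4.1 _ (by decide), hc₁]
    refine ((r4.runs_alternatingPath u4 c4 hc4 hc₀3 (by omega) (by omega)).ert_seq_le
      (b := ((100 + H.pathLen col u c₀ c₁ * 162 + t * 151 : ℕ) : ℝ≥0∞) + b) ?_).trans ?_
    · rintro s5 ⟨f5, hP⟩
      have r5 := r4.frame f5 (by decide) (by decide)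
      refine (r5.runs_extendColoring hF ⟨?_, ?_, ?_⟩ ?_ ?_ hc₀ hP).ert_le ?_
      · rw [f5.1 _ (by decide), f4.1 _ (by decide), hFr.length]
      · rw [f5.2 _ (by decide), f4.2 _ (by decide)]; exact hFr.fan
      · rw [f5.2 _ (by decide), f4.2 _ (by decide)]; exact hFr.fpos
      · rw [f5.1 _ (by decide), u4]
      · rw [f5.1 _ (by decide), hc4]
      · rintro s6 ⟨l6, r6⟩
        refine hf s6 ?_ r6
        rw [l6, f5.1 _ (by decide), f4.1 _ (by decide), l3]
    · calc _ = ((108 + t * 151 + 203 * H.pathLen col u c₀ c₁ : ℕ) : ℝ≥0∞) + b := by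
            push_cast; ring
        _ ≤ ((108 + 151 * H.deg u + 203 * H.pathLen col u c₀ c₁ : ℕ) : ℝ≥0∞) + b := by
            gcongr ?_ + _; exact_mod_cast (by omega)
        _ = _ := by push_cast; ring)
  rw [average_const_add card_missing_ne_zero, average_const_mul] at hrest
  refine ⟨c₁, Finset.mem_Icc.2 ⟨hF.one_le, hF.le⟩, ?_⟩
  obtain ⟨X, hX⟩ : ∃ X, X = average (H.missing col u) fun c₀ => (H.pathLen col u c₀ c₁ : ℝ≥0∞) :=
    ⟨_, rfl⟩
  rw [← hX] at hrest ⊢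
  rw [ert_set_seq, hset]
  refine (add_le_add_right (hcenter.ert_seq_le (fun s' hs' => ?_)) _).trans (b := 2 +
    (((1 + 2 : ℕ) : ℝ≥0∞) + (1 + (((9 + H.deg u * 41 : ℕ) : ℝ≥0∞) +
      (1 + (((11 + 82 * H.deg u : ℕ) : ℝ≥0∞) +
        (((108 + 151 * H.deg u : ℕ) + b : ℝ≥0∞) + 203 * X))))))) ?_
  · rw [hs', ← hs2, ert_seq]
    refine add_le_add_right ((h3 _).trans (add_le_add_right ?_ _)) _
    rw [ert_seq]
    exact add_le_add_right hrest _
  · calc _ = ((135 + 274 * H.deg u : ℕ) : ℝ≥0∞) + 203 * X + b := by push_cast; ring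
      _ ≤ ((300 + 300 * H.deg u : ℕ) : ℝ≥0∞) + 300 * X + b := by
          gcongr <;> norm_num
      _ = _ := by push_cast; ring

/-- Each uncolored edge occurs exactly once in the list of uncolored edges. -/
theorem Repr.sum_un (h : Repr H col s) (φ : ℕ → ℝ≥0∞) :
    ∑ w ∈ Finset.range (s.var .l), φ (s.arr .un w 0) = ∑ e ∈ H.uncolored col, φ e := by
  refine Finset.sum_bij' (fun w _ => s.arr .un w 0) (fun e _ => s.arr .ind e 0) ?_ ?_ ?_ ?_ ?_
  · intro w hw; exact mem_uncolored.2 (h.un.of_lt w (Finset.mem_range.1 hw)).1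
  · intro e he; exact Finset.mem_range.2 (h.un.of_mem e (mem_uncolored.1 he)).1
  · intro w hw; exact (h.un.of_lt w (Finset.mem_range.1 hw)).2
  · intro e he; exact (h.un.of_mem e (mem_uncolored.1 he)).2
  · intro w hw; rfl

theorem Repr.card_uncolored (h : Repr H col s) : (H.uncolored col).card = s.var .l := by
  have := h.sum_un fun _ => 1
  simp only [Finset.sum_const, Finset.card_range, nsmul_eq_mul, mul_one] at this
  exact_mod_cast this.symm

theorem card_uncolored_le (col : ℕ → ℕ) : (H.uncolored col).card ≤ H.m := by
  rw [uncolored]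
  exact (Finset.card_le_card (Finset.filter_subset _ _)).trans_eq (Finset.card_range _)

/-- The expected cost of a round with `l` uncolored edges is at most proportional to
`weight / l`. -/
theorem Repr.ert_colorOneEdge_le (h : Repr H col s) (hl : s.var .l ≠ 0) {f : State → ℝ≥0∞}
    {b : ℝ≥0∞} (hf : ∀ s', s'.var .l = s.var .l - 1 → (∃ col', Repr H col' s') → f s' ≤ b) :
    ert colorOneEdge f s ≤ 1802 * H.weight / s.var .l + b := by
  obtain ⟨l, hl'⟩ : ∃ l, s.var .l = l + 1 := ⟨s.var .l - 1, by omega⟩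
  have hround : ∀ w, ∃ c₁, w < l + 1 → c₁ ∈ Finset.Icc 1 (H.maxDeg + 1) ∧
      ert colorChosenEdge f (s.setVar .r w) ≤ edgeCost H col (s.arr .un w 0) c₁ + b := fun w => by
    by_cases hw : w < l + 1
    · have hr : Repr H col (s.setVar .r w) :=
        h.frame ((Frame.refl [.r] [] s).setVar (by decide) w) (by decide) (by decide)
      obtain ⟨c₁, h1, h2⟩ := hr.exists_ert_colorChosenEdge_le (r := w) (f := f) (b := b) (by simp)
        (by simpa [hl', Nat.lt_succ_iff] using hw) (fun s' hs' => hf s' (by simpa using hs'))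
      exact ⟨c₁, fun _ => ⟨h1, h2⟩⟩
    · exact ⟨0, fun h => absurd h hw⟩
  choose c₁ hc₁ using hround
  have hlw : l + 1 ≤ H.weight := by
    have h1 := H.m_le_weight
    have h2 := card_uncolored_le (H := H) col
    rw [h.card_uncolored, hl'] at h2
    omega
  obtain ⟨ψ, hψ⟩ : ∃ ψ : ℕ → ℝ≥0∞, ψ = fun e => edgeCost H col e (c₁ (s.arr .ind e 0)) := ⟨_, rfl⟩
  have hcard := h.card_uncolored
  rw [hl'] at hcard
  have hsum : ∑ e ∈ H.uncolored col, ψ e ≤ 1800 * H.weight := by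
    have h1 := sum_expected_pathLen_le h.proper (fun e => c₁ (s.arr .ind e 0)) fun e he => by
      have := (h.un.of_mem e (mem_uncolored.1 he)).1
      exact (hc₁ _ (by omega)).1
    have h2 : (∑ e ∈ H.uncolored col, (H.deg (H.center e) : ℝ≥0∞)) ≤ H.weight := by
      exact_mod_cast sum_deg_center_le (H := H) (col := col)
    have h3 : ((l + 1 : ℕ) : ℝ≥0∞) ≤ H.weight := by exact_mod_cast hlw
    simp only [hψ, edgeCost]
    rw [Finset.sum_add_distrib, Finset.sum_add_distrib, Finset.sum_const, ← Finset.mul_sum,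
      ← Finset.mul_sum, nsmul_eq_mul]
    rw [hcard] at h1 ⊢
    calc _ ≤ (H.weight : ℝ≥0∞) * 300 + 300 * H.weight + 300 * (2 * H.weight + 2 * H.weight) := by
          gcongr
          exact h1.trans (by gcongr)
      _ = _ := by ring
  have hl0 : ((l + 1 : ℕ) : ℝ≥0∞) ≠ 0 := by simp
  have hlt : ((l + 1 : ℕ) : ℝ≥0∞) ≠ ⊤ := ENNReal.natCast_ne_top _
  have hp : (Expr.var .l).pred.eval s + 1 = l + 1 := by simp [Expr.eval, hl']
  rw [colorOneEdge, ert_seq, ert_rand, hp, hl']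
  change 1 + (1 + (∑ w ∈ Finset.range (l + 1), ert colorChosenEdge f (s.setVar .r w)) / _) ≤ _
  have hle : ∀ w ∈ Finset.range (l + 1),
      ert colorChosenEdge f (s.setVar .r w) ≤ ψ (s.arr .un w 0) + b := fun w hw => by
    have h1 := (hc₁ w (Finset.mem_range.1 hw)).2
    rw [hψ]
    simp only
    rwa [(h.un.of_lt w (by rw [hl']; exact Finset.mem_range.1 hw)).2]
  have hsum' := Finset.sum_le_sum hle
  rw [Finset.sum_add_distrib, Finset.sum_const, Finset.card_range, nsmul_eq_mul, ← hl', h.sum_un,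
    hl'] at hsum'
  have h1 : (1 : ℝ≥0∞) ≤ H.weight / ((l + 1 : ℕ) : ℝ≥0∞) := by
    rw [ENNReal.le_div_iff_mul_le (Or.inl hl0) (Or.inl hlt), one_mul]
    exact_mod_cast hlw
  calc _ ≤ 1 + (1 + (1800 * H.weight + ((l + 1 : ℕ) : ℝ≥0∞) * b) / ((l + 1 : ℕ) : ℝ≥0∞)) := by
        gcongr
        exact hsum'.trans (by gcongr)
    _ = 2 * 1 + 1800 * (H.weight / ((l + 1 : ℕ) : ℝ≥0∞)) + b := by
        rw [ENNReal.add_div, mul_comm _ b, ENNReal.mul_div_cancel_right hl0 hlt, mul_div_assoc]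
        ring
    _ ≤ 2 * (H.weight / ((l + 1 : ℕ) : ℝ≥0∞)) + 1800 * (H.weight / ((l + 1 : ℕ) : ℝ≥0∞)) + b := by
        gcongr
    _ = _ := by rw [mul_div_assoc]; ring

/-- The rounds with `l`, `l - 1`, …, `1` uncolored edges take expected time proportional to
`weight` times a harmonic sum. -/
theorem Repr.ert_rounds_le (h : Repr H col s) {f : State → ℝ≥0∞}
    (hf : ∀ s', s'.var .l = 0 → (∃ col', Repr H col' s') → f s' = 0) :
    ert (.loop (.not (.eq (.var .l) (.lit 0))) colorOneEdge) f s ≤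
      1 + ∑ k ∈ Finset.range (s.var .l), 1803 * (H.weight : ℝ≥0∞) / ((k + 1 : ℕ) : ℝ≥0∞) := by
  classical
  obtain ⟨B, hB⟩ : ∃ B : ℕ → ℝ≥0∞, B = fun l =>
    1 + ∑ k ∈ Finset.range l, 1803 * (H.weight : ℝ≥0∞) / ((k + 1 : ℕ) : ℝ≥0∞) := ⟨_, rfl⟩
  -- infinite cost at memories that represent no coloring: they do not occur
  obtain ⟨I, hI⟩ : ∃ I : State → ℝ≥0∞, I = fun s' =>
    if ∃ col', Repr H col' s' then B (s'.var .l) else ⊤ := ⟨_, rfl⟩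
  have hle : ert (.loop (.not (.eq (.var .l) (.lit 0))) colorOneEdge) f ≤ I := by
    refine ert_loop_le fun s' => ?_
    by_cases hr : ∃ col', Repr H col' s'
    swap
    · have : I s' = ⊤ := by rw [hI]; exact if_neg hr
      rw [this]; exact le_top
    have hIs : I s' = B (s'.var .l) := by rw [hI]; exact if_pos hr
    have htest : (Test.not (.eq (.var .l) (.lit 0))).holds s' = true ↔ s'.var .l ≠ 0 := by
      rw [Test.holds_not, Test.holds_eq]; rfl
    rw [hIs]
    by_cases hl : s'.var .l = 0
    · rw [if_neg (htest.not.2 (not_not.2 hl)), hf s' hl hr, hl, hB]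
      simp
    rw [if_pos (htest.2 hl)]
    obtain ⟨col', r'⟩ := hr
    refine (add_le_add_right (r'.ert_colorOneEdge_le hl (b := B (s'.var .l - 1)) ?_) 1).trans ?_
    · intro s'' hl'' hr''
      rw [hI]
      simp only
      rw [if_pos hr'', hl'']
    obtain ⟨l, hl'⟩ : ∃ l, s'.var .l = l + 1 := ⟨s'.var .l - 1, by omega⟩
    have h1 := H.m_le_weight
    have h2 := card_uncolored_le (H := H) col'
    rw [r'.card_uncolored] at h2
    rw [hl'] at h2 ⊢
    have h3 : (1 : ℝ≥0∞) ≤ H.weight / ((l + 1 : ℕ) : ℝ≥0∞) := by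
      rw [ENNReal.le_div_iff_mul_le (Or.inl (by simp)) (Or.inl (ENNReal.natCast_ne_top _)), one_mul]
      exact_mod_cast h2.trans h1
    rw [hB]
    simp only [Nat.add_sub_cancel]
    rw [Finset.sum_range_succ, mul_div_assoc, mul_div_assoc]
    calc _ ≤ H.weight / ((l + 1 : ℕ) : ℝ≥0∞) + (1802 * (H.weight / ((l + 1 : ℕ) : ℝ≥0∞)) + _) := by
          gcongr
      _ = _ := by ring
  refine (hle s).trans_eq ?_
  rw [hI, hB]
  exact if_pos ⟨col, h⟩

end ColorEdges

/-! ### The set-up -/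

namespace ColorEdges

open IndexedGraph

open scoped ENNReal

variable {H : IndexedGraph} {s s' : State}

/-- The vertex `v` has been counted `d` times, and its list of missing colors is
`1, …, d + 1`. -/
structure Counted (s : State) (v d : ℕ) : Prop where
  deg : s.arr .deg v 0 = d
  cnt : s.arr .cnt v 0 = d + 1
  free : ∀ k ≤ d, s.arr .free v k = k + 1
  pos : ∀ k ≤ d, s.arr .pos v (k + 1) = k

theorem Counted.frame {v d : ℕ} (h : Counted s v d) {A : List Var} {B : List Arr}
    (hf : Frame A B s s') (hB : ∀ a ∈ [Arr.deg, .cnt, .free, .pos], a ∉ B) : Counted s' v d := by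
  obtain ⟨h1, h2, h3, h4⟩ := h
  rw [← hf.2 _ (hB .deg (by decide))] at h1
  rw [← hf.2 _ (hB .cnt (by decide))] at h2
  rw [← hf.2 _ (hB .free (by decide))] at h3
  rw [← hf.2 _ (hB .pos (by decide))] at h4
  exact ⟨h1, h2, h3, h4⟩

theorem frame_resetVertex (s : State) : Frame [] [.deg, .free, .pos, .cnt] s (resetVertex.exec s) :=
  (Cmd.frame_exec resetVertex s).mono (by decide) (by decide)

theorem frame_countAtVertex (s : State) :
    Frame [.c, .maxDeg] [.deg, .free, .pos, .cnt] s (countAtVertex.exec s) :=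
  (Cmd.frame_exec countAtVertex s).mono (by decide) (by decide)

theorem counted_exec_resetVertex {z : ℕ} (hz : s.var .z = z) :
    Counted (resetVertex.exec s) z 0 ∧
      ∀ v d, v ≠ z → Counted s v d → Counted (resetVertex.exec s) v d := by
  constructor
  · constructor <;> simp [resetVertex, Cmd.exec, Expr.eval, hz]
  · rintro v d hv ⟨h1, h2, h3, h4⟩
    constructor <;> simpa [resetVertex, Cmd.exec, Expr.eval, hz, hv]

theorem exec_countAtVertex {z d : ℕ} (hz : s.var .z = z) (h : Counted s z d) :
    Counted (countAtVertex.exec s) z (d + 1) ∧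
      (∀ v d, v ≠ z → Counted s v d → Counted (countAtVertex.exec s) v d) ∧
      (countAtVertex.exec s).var .maxDeg = max (s.var .maxDeg) (d + 1) := by
  obtain ⟨h1, h2, h3, h4⟩ := h
  obtain ⟨s1, hs1⟩ : ∃ s1, s1 = ((((s.setCell .deg z 0 (d + 1)).setVar .c (d + 2)).setCell .free z
    (d + 1) (d + 2)).setCell .pos z (d + 2) (d + 1)).setCell .cnt z 0 (d + 2) := ⟨_, rfl⟩
  have hadd : addMissing.exec ((s.setCell .deg z 0 (d + 1)).setVar .c (d + 2)) = s1 := by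
    rw [addMissing, Cmd.exec_ite_true (Test.holds_le.2 (by simp [Expr.eval, hz])), hs1]
    simp [Cmd.exec, Expr.eval, hz, h2]
  have hexec : countAtVertex.exec s = s1.setVar .maxDeg (max (s.var .maxDeg) (d + 1)) := by
    rw [countAtVertex, Cmd.exec_seq, Cmd.exec_store, Cmd.exec_seq, Cmd.exec_set, Cmd.exec_seq]
    have : (((s.setCell .deg ((Expr.var .z).eval s) ((Expr.lit 0).eval s)
        ((Expr.succ (cell1 .deg (.var .z))).eval s))).setVar .c
        ((Expr.succ (cell1 .deg (.var .z))).eval (s.setCell .deg ((Expr.var .z).eval s)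
          ((Expr.lit 0).eval s) ((Expr.succ (cell1 .deg (.var .z))).eval s)))) =
        (s.setCell .deg z 0 (d + 1)).setVar .c (d + 2) := by
      simp [Expr.eval, hz, h1]
    rw [this, hadd]
    have htest : (Test.lt (.var .maxDeg) (cell1 .deg (.var .z))).holds s1 = true ↔
        s.var .maxDeg < d + 1 := by
      rw [Test.holds_lt]; simp [Expr.eval, hs1, hz]
    by_cases hlt : s.var .maxDeg < d + 1
    · rw [Cmd.exec_ite_true (htest.2 hlt), Cmd.exec_set, max_eq_right hlt.le]
      simp [Expr.eval, hs1, hz]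
    · rw [Cmd.exec_ite_false (htest.not.2 hlt), max_eq_left (by omega)]
      have : s1.var .maxDeg = s.var .maxDeg := by simp [hs1]
      rw [← this, State.setVar, Function.update_eq_self]
      rfl
  rw [hexec]
  refine ⟨⟨?_, ?_, ?_, ?_⟩, ?_, by simp⟩
  · simp [hs1]
  · simp [hs1]
  · intro k hk
    have := h3 k
    simp [hs1]; grind
  · intro k hk
    have := h4 k
    simp [hs1]; grind
  · rintro v d' hv ⟨h1, h2, h3, h4⟩
    constructor <;> simpa [hs1, hv]

/-- The number of edges at `v` among the first `j` edges. -/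
def IndexedGraph.degUpTo (H : IndexedGraph) (j v : ℕ) : ℕ :=
  ((Finset.range j).filter fun e => H.Inc e v).card

theorem degUpTo_succ (j v : ℕ) :
    H.degUpTo (j + 1) v = H.degUpTo j v + if H.Inc j v then 1 else 0 := by
  rw [degUpTo, Finset.range_add_one, Finset.filter_insert]
  split_ifs
  · rw [Finset.card_insert_of_notMem (by simp)]; rfl
  · rfl

theorem degUpTo_le_deg {j : ℕ} (hj : j ≤ H.m) (v : ℕ) : H.degUpTo j v ≤ H.deg v :=
  Finset.card_le_card (Finset.filter_subset_filter _ (Finset.range_subset_range.2 hj))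

/-- The registers and arrays that the set-up writes. -/
abbrev setupVars : List Var := [.i, .z, .c, .maxDeg, .l]

/-- The arrays that the set-up writes. -/
abbrev setupArrs : List Arr := [.deg, .free, .pos, .cnt, .color, .un, .ind]

/-- The first loop visits every vertex, the second one counts the edges at every vertex. -/
theorem runs_emptyColoring (hm : s.var .m = H.m) (hfst : ∀ e < H.m, s.arr .ends e 0 = H.fst e)
    (hsnd : ∀ e < H.m, s.arr .ends e 1 = H.snd e) :
    Runs emptyColoring s (30 + H.m * 182) fun s' =>
      Repr H (fun _ => 0) s' ∧ s'.var .l = H.m := by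
  have first : Runs (.loop (.lt (.var .i) (.var .m))
      (.set .z (.cell .ends (.var .i) (.lit 0)) ;;
       resetVertex ;;
       .set .z (.cell .ends (.var .i) (.lit 1)) ;;
       resetVertex ;;
       .set .i (.succ (.var .i)))) (s.setVar .i 0) (1 + H.m * (60 + 1)) fun s' =>
      Frame setupVars setupArrs s s' ∧ ∀ v ∈ H.verts, Counted s' v 0 := by
    refine Runs.loop (I := fun j s' => Frame setupVars setupArrs s s' ∧ s'.var .i = j ∧
      ∀ e < j, ∀ v, H.Inc e v → Counted s' v 0) ?_
      ⟨(Frame.refl _ _ _).setVar (by decide) _, by simp, by simp⟩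
    rintro j s1 hj ⟨f1, i1, hc1⟩
    have m1 : s1.var .m = H.m := by rw [f1.1 _ (by decide), hm]
    rcases lt_or_eq_of_le hj with hj' | rfl
    swap
    · left
      refine ⟨?_, f1, fun v hv => ?_⟩
      · rw [Bool.eq_false_iff, ne_eq, Test.holds_lt]
        simp [Expr.eval, i1, m1]
      · obtain ⟨e, he, hev⟩ := mem_verts.1 hv
        exact hc1 e he v hev
    right
    refine ⟨Test.holds_lt.2 (by simpa [Expr.eval, i1, m1] using hj'), hj', Runs.straight
      (by simp [Cmd.Straight, resetVertex]) ?_ (by decide)⟩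
    have e1 : (Expr.cell .ends (.var .i) (.lit 0)).eval s1 = H.fst j := by
      simp only [Expr.eval, i1]; rw [f1.2 _ (by decide), hfst j hj']
    rw [Cmd.exec_seq, Cmd.exec_set, e1, Cmd.exec_seq, Cmd.exec_seq, Cmd.exec_set]
    obtain ⟨s2, hs2⟩ : ∃ s2, s2 = s1.setVar .z (H.fst j) := ⟨_, rfl⟩
    rw [← hs2]
    have f12 : Frame [.z] [] s1 s2 := by rw [hs2]; exact (Frame.refl _ _ _).setVar (by decide) _
    have f2 := f1.trans (f12.mono (A' := setupVars) (B' := setupArrs) (by decide) (by decide))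
    obtain ⟨a2, b2⟩ := counted_exec_resetVertex (s := s2) (z := H.fst j) (by simp [hs2])
    have f23 := frame_resetVertex s2
    obtain ⟨s3, hs3⟩ : ∃ s3, s3 = resetVertex.exec s2 := ⟨_, rfl⟩
    rw [← hs3] at a2 b2 f23 ⊢
    have f3 := f2.trans (f23.mono (A' := setupVars) (B' := setupArrs) (by decide) (by decide))
    have i3 : s3.var .i = j := by rw [f23.1 _ (by decide), f12.1 _ (by decide), i1]
    have e3 : (Expr.cell .ends (.var .i) (.lit 1)).eval s3 = H.snd j := by
      simp only [Expr.eval, i3]; rw [f3.2 _ (by decide), hsnd j hj']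
    rw [e3, Cmd.exec_seq, Cmd.exec_set]
    obtain ⟨s4, hs4⟩ : ∃ s4, s4 = s3.setVar .z (H.snd j) := ⟨_, rfl⟩
    rw [← hs4]
    have f34 : Frame [.z] [] s3 s4 := by rw [hs4]; exact (Frame.refl _ _ _).setVar (by decide) _
    have f4 := f3.trans (f34.mono (A' := setupVars) (B' := setupArrs) (by decide) (by decide))
    obtain ⟨a4, b4⟩ := counted_exec_resetVertex (s := s4) (z := H.snd j) (by simp [hs4])
    have f45 := frame_resetVertex s4
    have f5 := f4.trans (f45.mono (A' := setupVars) (B' := setupArrs) (by decide) (by decide))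
    refine ⟨f5.setVar (by decide) _, ?_, fun e he v hv => ?_⟩
    · simp [Expr.eval, f45.1 .i (by decide), f34.1 .i (by decide), i3]
    · refine Counted.frame (A := [.i]) (B := []) ?_ ((Frame.refl _ _ _).setVar (by decide) _)
        (by decide)
      by_cases hvs : v = H.snd j
      · rw [hvs]; exact a4
      refine b4 v 0 hvs (Counted.frame ?_ f34 (by decide))
      by_cases hvf : v = H.fst j
      · rw [hvf]; exact a2
      refine b2 v 0 hvf (Counted.frame ?_ f12 (by decide))
      rcases Nat.lt_succ_iff_lt_or_eq.1 he with he' | rfl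
      · exact hc1 e he' v hv
      · exact absurd hv (not_or.2 ⟨hvf, hvs⟩)
  have second : ∀ s0, Frame setupVars setupArrs s s0 → (∀ v ∈ H.verts, Counted s0 v 0) →
      Runs (.loop (.lt (.var .i) (.var .m))
      (.set .z (.cell .ends (.var .i) (.lit 0)) ;;
       countAtVertex ;;
       .set .z (.cell .ends (.var .i) (.lit 1)) ;;
       countAtVertex ;;
       store1 .color (.var .i) (.lit 0) ;;
       store1 .un (.var .i) (.var .i) ;;
       store1 .ind (.var .i) (.var .i) ;;
       .set .i (.succ (.var .i)))) ((s0.setVar .maxDeg 0).setVar .i 0) (1 + H.m * (120 + 1))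
      fun s' => Frame setupVars setupArrs s s' ∧ (∀ v ∈ H.verts, Counted s' v (H.deg v)) ∧
        s'.var .maxDeg = H.maxDeg ∧
        ∀ e < H.m, s'.arr .color e 0 = 0 ∧ s'.arr .un e 0 = e ∧ s'.arr .ind e 0 = e := by
    intro s0 f0 h0
    refine Runs.loop (I := fun j s' => Frame setupVars setupArrs s s' ∧ s'.var .i = j ∧
      (∀ v ∈ H.verts, Counted s' v (H.degUpTo j v) ∧ H.degUpTo j v ≤ s'.var .maxDeg) ∧
      s'.var .maxDeg ≤ H.maxDeg ∧
      ∀ e < j, s'.arr .color e 0 = 0 ∧ s'.arr .un e 0 = e ∧ s'.arr .ind e 0 = e) ?_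
      ⟨(f0.setVar (by decide) _).setVar (by decide) _, by simp, fun v hv => ⟨?_, by simp [degUpTo]⟩,
        by simp, by simp⟩
    swap
    · refine Counted.frame (A := [.maxDeg, .i]) (B := []) ?_ (((Frame.refl _ _ _).setVar
        (by decide) _).setVar (by decide) _) (by decide)
      simpa [degUpTo] using h0 v hv
    rintro j s1 hj ⟨f1, i1, hc1, hD1, hl1⟩
    have m1 : s1.var .m = H.m := by rw [f1.1 _ (by decide), hm]
    rcases lt_or_eq_of_le hj with hj' | rfl
    swap
    · left
      refine ⟨?_, f1, fun v hv => (hc1 v hv).1, le_antisymm hD1 ?_, hl1⟩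
      · rw [Bool.eq_false_iff, ne_eq, Test.holds_lt]
        simp [Expr.eval, i1, m1]
      · refine Finset.sup_le fun e he => ?_
        rw [Finset.mem_range] at he
        exact max_le (hc1 _ (mem_verts.2 ⟨e, he, Or.inl rfl⟩)).2
          (hc1 _ (mem_verts.2 ⟨e, he, Or.inr rfl⟩)).2
    right
    refine ⟨Test.holds_lt.2 (by simpa [Expr.eval, i1, m1] using hj'), hj', Runs.straight
      (by simp [Cmd.Straight, countAtVertex, addMissing]) ?_ (by decide)⟩
    have hvf : H.fst j ∈ H.verts := mem_verts.2 ⟨j, hj', Or.inl rfl⟩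
    have hvs : H.snd j ∈ H.verts := mem_verts.2 ⟨j, hj', Or.inr rfl⟩
    have hne := H.fst_ne_snd j hj'
    have e1 : (Expr.cell .ends (.var .i) (.lit 0)).eval s1 = H.fst j := by
      simp only [Expr.eval, i1]; rw [f1.2 _ (by decide), hfst j hj']
    rw [Cmd.exec_seq, Cmd.exec_set, e1, Cmd.exec_seq, Cmd.exec_seq, Cmd.exec_set]
    obtain ⟨s2, hs2⟩ : ∃ s2, s2 = s1.setVar .z (H.fst j) := ⟨_, rfl⟩
    rw [← hs2]
    have f12 : Frame [.z] [] s1 s2 := by rw [hs2]; exact (Frame.refl _ _ _).setVar (by decide) _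
    have f2 := f1.trans (f12.mono (A' := setupVars) (B' := setupArrs) (by decide) (by decide))
    obtain ⟨a2, b2, D2⟩ := exec_countAtVertex (s := s2) (z := H.fst j) (by simp [hs2])
      ((hc1 _ hvf).1.frame f12 (by decide))
    have f23 := frame_countAtVertex s2
    obtain ⟨s3, hs3⟩ : ∃ s3, s3 = countAtVertex.exec s2 := ⟨_, rfl⟩
    rw [← hs3] at a2 b2 f23 D2 ⊢
    have f3 := f2.trans (f23.mono (A' := setupVars) (B' := setupArrs) (by decide) (by decide))
    have i3 : s3.var .i = j := by rw [f23.1 _ (by decide), f12.1 _ (by decide), i1]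
    have e3 : (Expr.cell .ends (.var .i) (.lit 1)).eval s3 = H.snd j := by
      simp only [Expr.eval, i3]; rw [f3.2 _ (by decide), hsnd j hj']
    rw [e3, Cmd.exec_seq]
    obtain ⟨s4, hs4⟩ : ∃ s4, s4 = s3.setVar .z (H.snd j) := ⟨_, rfl⟩
    rw [← hs4]
    have f34 : Frame [.z] [] s3 s4 := by rw [hs4]; exact (Frame.refl _ _ _).setVar (by decide) _
    have f4 := f3.trans (f34.mono (A' := setupVars) (B' := setupArrs) (by decide) (by decide))
    obtain ⟨a4, b4, D4⟩ := exec_countAtVertex (s := s4) (z := H.snd j) (by simp [hs4])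
      ((b2 _ _ hne.symm ((hc1 _ hvs).1.frame f12 (by decide))).frame f34 (by decide))
    have f45 := frame_countAtVertex s4
    obtain ⟨s5, hs5⟩ : ∃ s5, s5 = countAtVertex.exec s4 := ⟨_, rfl⟩
    rw [← hs5] at a4 b4 f45 D4 ⊢
    have f5 := f4.trans (f45.mono (A' := setupVars) (B' := setupArrs) (by decide) (by decide))
    have i5 : s5.var .i = j := by rw [f45.1 _ (by decide), f34.1 _ (by decide), i3]
    have D2' : s2.var .maxDeg = s1.var .maxDeg := f12.1 _ (by decide)
    have D4' : s4.var .maxDeg = s3.var .maxDeg := f34.1 _ (by decide)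
    rw [D4', D2, D2'] at D4
    have hcell (a : Arr) (ha1 : a ∉ setupArrs ∨ a = .color ∨ a = .un ∨ a = .ind) :
        s5.arr a = s1.arr a := by
      have : a ∉ [Arr.deg, .free, .pos, .cnt] := by
        rcases ha1 with h | rfl | rfl | rfl
        · simp at h ⊢; tauto
        all_goals decide
      rw [f45.2 _ this, f34.2 _ (by simp), f23.2 _ this, f12.2 _ (by simp)]
    rw [Cmd.exec_seq, Cmd.exec_store, Cmd.exec_seq, Cmd.exec_store, Cmd.exec_seq, Cmd.exec_store,
      Cmd.exec_set]
    simp only [Expr.eval, State.setCell_var, i5]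
    have hd1 := degUpTo_le_deg (H := H) (j := j + 1) hj' (H.fst j)
    have hd2 := degUpTo_le_deg (H := H) (j := j + 1) hj' (H.snd j)
    rw [degUpTo_succ, if_pos (Or.inl rfl)] at hd1
    rw [degUpTo_succ, if_pos (Or.inr rfl)] at hd2
    have hd3 := H.deg_le_maxDeg (H.fst j)
    have hd4 := H.deg_le_maxDeg (H.snd j)
    refine ⟨(((f5.setCell (by decide) _ _ _).setCell (by decide) _ _ _).setCell
      (by decide) _ _ _).setVar (by decide) _, by simp, fun v hv => ⟨?_, ?_⟩, ?_, fun e he => ?_⟩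
    · refine Counted.frame (A := [.i]) (B := [.color, .un, .ind]) (s := s5) ?_
        (((((Frame.refl _ _ _).setCell (by decide) _ _ _).setCell (by decide) _ _ _).setCell
        (by decide) _ _ _).setVar (by decide) _) (by decide)
      rw [degUpTo_succ]
      by_cases h1 : v = H.snd j
      · rw [if_pos (Or.inr h1), h1]; exact a4
      refine b4 v _ h1 (Counted.frame ?_ f34 (by decide))
      by_cases h2 : v = H.fst j
      · rw [if_pos (Or.inl h2), h2]; exact a2
      rw [if_neg (not_or.2 ⟨h2, h1⟩)]
      exact b2 v _ h2 ((hc1 v hv).1.frame f12 (by decide))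
    · have := (hc1 v hv).2
      simp only [State.setVar_var, State.setCell_var, reduceCtorEq, if_false, D4]
      rw [degUpTo_succ]
      split_ifs with h1
      · rcases h1 with rfl | rfl <;> omega
      · omega
    · simp only [State.setVar_var, State.setCell_var, reduceCtorEq, if_false, D4]
      omega
    · have := hl1 e
      simp [hcell]; grind
  unfold emptyColoring
  refine (Runs.set_seq (Runs.seq first fun s0 h0 => Runs.set_seq (Runs.set_seq (Runs.seq
    (second s0 h0.1 h0.2) (N' := 1) ?_)))).mono (by omega) fun _ h => h
  rintro s1 ⟨f1, hc1, D1, hl1⟩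
  refine Runs.straight trivial ?_ le_rfl
  have m1 : s1.var .m = H.m := by rw [f1.1 _ (by decide), hm]
  rw [Cmd.exec_set]
  refine ⟨⟨⟨by simp, by simp⟩, by simp [m1], by simp [D1], ?_, ?_, ?_, ?_, by simp, ?_, ?_⟩,
    by simp [Expr.eval, m1]⟩
  · simp only [State.setVar_arr]; rw [f1.2 _ (by decide)]; exact hfst
  · simp only [State.setVar_arr]; rw [f1.2 _ (by decide)]; exact hsnd
  · exact fun v hv => (hc1 v hv).deg
  · exact fun e he => (hl1 e he).1
  · intro v hv
    obtain ⟨d1, d2, d3, d4⟩ := hc1 v hv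
    simp only [State.setVar_arr, d2]
    constructor
    · rintro c ⟨⟨h1, h2⟩, -⟩
      obtain ⟨c, rfl⟩ : ∃ k, c = k + 1 := ⟨c - 1, by omega⟩
      rw [d4 c (by omega), d3 c (by omega)]
      exact ⟨by omega, rfl⟩
    · intro i hi
      rw [d3 i (by omega), d4 i (by omega)]
      refine ⟨⟨⟨by omega, by omega⟩, ?_⟩, rfl⟩
      rintro ⟨e, -, -, h⟩
      change 0 = _ at h
      omega
  · simp only [State.setVar_var, State.setVar_arr, if_true, Expr.eval, m1]
    constructor
    · rintro e ⟨he, -⟩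
      rw [(hl1 e he).2.2, (hl1 e he).2.1]
      exact ⟨he, rfl⟩
    · intro i hi
      rw [(hl1 i hi).2.1, (hl1 i hi).2.2]
      exact ⟨⟨hi, trivial⟩, rfl⟩

/-- The expected cost of the whole algorithm, if the cost of the final memory vanishes when it
represents a coloring without uncolored edges. -/
theorem ert_colorEdges_le (hm : s.var .m = H.m) (hfst : ∀ e < H.m, s.arr .ends e 0 = H.fst e)
    (hsnd : ∀ e < H.m, s.arr .ends e 1 = H.snd e) {f : State → ℝ≥0∞}
    (hf : ∀ s', s'.var .l = 0 → (∃ col', Repr H col' s') → f s' = 0) :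
    ert colorEdges f s ≤ ((31 + H.m * 182 : ℕ) : ℝ≥0∞) +
      (1 + ∑ k ∈ Finset.range H.m, 1803 * (H.weight : ℝ≥0∞) / ((k + 1 : ℕ) : ℝ≥0∞)) := by
  rw [colorEdges]
  refine ((runs_emptyColoring hm hfst hsnd).ert_seq_le (fun s' hs' => ?_)).trans_eq
    (congrArg₂ _ (by push_cast; ring) rfl)
  have := hs'.1.ert_rounds_le hf
  rwa [hs'.2] at this

end ColorEdges

/-! ### Weight and arboricity -/

namespace ColorEdges

section Arboricity

variable {V : Type*} [Fintype V] (G : SimpleGraph V)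

theorem inducedEdges_le_arboricity_mul (S : Finset V) :
    inducedEdges G S ≤ arboricity G * (S.card - 1) := by
  classical
  refine Nat.sInf_mem (s := {α : ℕ | ∀ S : Finset V, inducedEdges G S ≤ α * (S.card - 1)})
    ⟨G.edgeFinset.card, fun S => ?_⟩ S
  by_cases hS : S.card ≤ 1
  · -- an edge has two distinct ends
    have : {e : Sym2 V | e ∈ G.edgeSet ∧ ∀ v ∈ e, v ∈ S} = ∅ := by
      refine Set.eq_empty_iff_forall_notMem.2 fun e => ?_
      induction e with
      | _ u v =>
        rintro ⟨h, hv⟩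
        exact G.ne_of_adj h (Finset.card_le_one.1 hS u (hv u (by simp)) v (hv v (by simp)))
    rw [inducedEdges, this]
    simp
  · calc inducedEdges G S ≤ (G.edgeFinset : Set (Sym2 V)).ncard :=
          Set.ncard_le_ncard (fun e he => by simpa using he.1) (Finset.finite_toSet _)
      _ = G.edgeFinset.card := Set.ncard_coe_finset _
      _ ≤ G.edgeFinset.card * (S.card - 1) := Nat.le_mul_of_pos_right _ (by omega)

variable [DecidableEq V] [DecidableRel G.Adj]

/-- An edge of weight more than `t` lies in the subgraph induced by the vertices of degree more than
`t`, which has at most `α` times as many edges as vertices.  Summing over `t` turns the numbers of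
these edges into the weight, and the numbers of these vertices into the degree sum. -/
theorem graphWeight_le_arboricity :
    graphWeight G ≤ 2 * (G.edgeFinset.card * arboricity G) := by
  have hcount (k : ℕ) (hk : k ≤ Fintype.card V) :
      k = ∑ t ∈ Finset.range (Fintype.card V), if t < k then 1 else 0 := by
    rw [← Finset.card_filter]
    have : (Finset.range (Fintype.card V)).filter (· < k) = Finset.range k := by
      ext; simp; omega
    rw [this, Finset.card_range]
  have hdeg (v : V) : G.degree v ≤ Fintype.card V := (G.degree_lt_card_verts v).le
  have hw (e : Sym2 V) : edgeWeight G e ≤ Fintype.card V := by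
    induction e with
    | _ u v => exact (min_le_left _ _).trans (hdeg u)
  calc graphWeight G
      = ∑ t ∈ Finset.range (Fintype.card V),
          (G.edgeFinset.filter fun e => t < edgeWeight G e).card := by
        simp only [Finset.card_filter]
        rw [Finset.sum_comm]
        exact Finset.sum_congr rfl fun e _ => hcount _ (hw e)
    _ ≤ ∑ t ∈ Finset.range (Fintype.card V),
          arboricity G * (Finset.univ.filter fun v => t < G.degree v).card := by
        refine Finset.sum_le_sum fun t _ => ?_
        refine le_trans ?_ ((inducedEdges_le_arboricity_mul G _).trans
          (Nat.mul_le_mul_left _ (Nat.sub_le _ 1)))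
        rw [← Set.ncard_coe_finset]
        refine Set.ncard_le_ncard (fun e he => ?_) (Set.toFinite _)
        simp only [Finset.coe_filter, SimpleGraph.mem_edgeFinset, Set.mem_ofPred_eq] at he
        refine ⟨he.1, fun x hx => ?_⟩
        obtain ⟨-, he⟩ := he
        induction e with
        | _ u v =>
          have he' : t < min (G.degree u) (G.degree v) := he
          rcases Sym2.mem_iff.1 hx with rfl | rfl <;> simp <;> omega
    _ = arboricity G * ∑ v, G.degree v := by
        rw [← Finset.mul_sum]
        simp only [Finset.card_filter]
        rw [Finset.sum_comm]
        exact congrArg _ (Finset.sum_congr rfl fun v _ => (hcount _ (hdeg v)).symm)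
    _ = 2 * (G.edgeFinset.card * arboricity G) := by
        rw [G.sum_degrees_eq_twice_card_edges]; ring

end Arboricity

/-! ### From edge lists to indexed graphs -/

namespace EdgeList

variable {n m : ℕ} {G : SimpleGraph (Fin n)} (L : EdgeList G m)

theorem adj (i : Fin m) : G.Adj (L.ends i).1 (L.ends i).2 := by
  have := (L.edge i).2
  rwa [L.edge_eq, SimpleGraph.mem_edgeSet] at this

theorem mem_edge {i : Fin m} {v : Fin n} :
    v ∈ (L.edge i : Sym2 (Fin n)) ↔ v = (L.ends i).1 ∨ v = (L.ends i).2 := by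
  rw [L.edge_eq, Sym2.mem_iff]

/-- The graph given by an edge list; the vertices keep their numbers. -/
def toIndexedGraph : IndexedGraph where
  m := m
  fst e := if h : e < m then (L.ends ⟨e, h⟩).1 else 0
  snd e := if h : e < m then (L.ends ⟨e, h⟩).2 else 0
  fst_ne_snd e he := by
    simp only [dif_pos he]
    exact fun h => G.ne_of_adj (L.adj ⟨e, he⟩) (Fin.ext h)
  simple e he f hf u v huv := by
    simp only [dif_pos he, dif_pos hf]
    intro hu hv hu' hv'
    have : L.edge ⟨e, he⟩ = L.edge ⟨f, hf⟩ := by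
      apply Subtype.ext
      rw [L.edge_eq, L.edge_eq, Sym2.eq_iff]
      simp only [Fin.ext_iff]
      omega
    simpa using L.edge.injective this

theorem toIndexedGraph_fst (i : Fin m) : L.toIndexedGraph.fst i = (L.ends i).1 := by
  simp [toIndexedGraph]

theorem toIndexedGraph_snd (i : Fin m) : L.toIndexedGraph.snd i = (L.ends i).2 := by
  simp [toIndexedGraph]

theorem inc_iff (i : Fin m) (v : Fin n) :
    L.toIndexedGraph.Inc i v ↔ v ∈ (L.edge i : Sym2 (Fin n)) := by
  rw [L.mem_edge, IndexedGraph.Inc, toIndexedGraph_fst, toIndexedGraph_snd, Fin.ext_iff,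
    Fin.ext_iff]

include L in
theorem card_edgeFinset [Fintype G.edgeSet] : G.edgeFinset.card = m := by
  rw [SimpleGraph.edgeFinset_card, ← Fintype.card_congr L.edge, Fintype.card_fin]

variable [DecidableRel G.Adj]

theorem deg_toIndexedGraph (v : Fin n) : L.toIndexedGraph.deg v = G.degree v := by
  rw [← G.card_incidenceFinset_eq_degree, IndexedGraph.deg]
  refine Finset.card_bij (fun e he => (L.edge ⟨e, Finset.mem_range.1 (Finset.mem_filter.1 he).1⟩ :
    Sym2 (Fin n))) (fun e he => ?_) (fun e he f hf h => ?_) (fun e he => ?_)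
  · rw [SimpleGraph.mem_incidenceFinset]
    exact ⟨Subtype.prop _, (L.inc_iff _ _).1 (Finset.mem_filter.1 he).2⟩
  · simpa using L.edge.injective (Subtype.ext h)
  · rw [SimpleGraph.mem_incidenceFinset] at he
    obtain ⟨i, hi⟩ := L.edge.surjective ⟨e, he.1⟩
    refine ⟨i, Finset.mem_filter.2 ⟨Finset.mem_range.2 i.2, (L.inc_iff _ _).2 ?_⟩, ?_⟩
    · rw [hi]; exact he.2
    · simp [hi]

theorem maxDeg_toIndexedGraph : L.toIndexedGraph.maxDeg = G.maxDegree := by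
  apply le_antisymm
  · refine Finset.sup_le fun e he => ?_
    have he : e < m := Finset.mem_range.1 he
    rw [L.toIndexedGraph_fst ⟨e, he⟩, L.toIndexedGraph_snd ⟨e, he⟩, L.deg_toIndexedGraph,
      L.deg_toIndexedGraph]
    exact max_le (G.degree_le_maxDegree _) (G.degree_le_maxDegree _)
  · refine G.maxDegree_le_of_forall_degree_le _ fun v => ?_
    rw [← L.deg_toIndexedGraph]
    exact IndexedGraph.deg_le_maxDeg _

theorem weight_toIndexedGraph : L.toIndexedGraph.weight = graphWeight G := by
  have h1 : graphWeight G = ∑ e : G.edgeSet, edgeWeight G e :=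
    (Finset.sum_subtype _ (fun e => SimpleGraph.mem_edgeFinset) _)
  rw [h1, ← Equiv.sum_comp L.edge, IndexedGraph.weight]
  refine (Fin.sum_univ_eq_sum_range (fun e => min (L.toIndexedGraph.deg (L.toIndexedGraph.fst e))
    (L.toIndexedGraph.deg (L.toIndexedGraph.snd e))) m).symm.trans
    (Finset.sum_congr rfl fun i _ => ?_)
  rw [toIndexedGraph_fst, toIndexedGraph_snd, L.deg_toIndexedGraph, L.deg_toIndexedGraph,
    L.edge_eq]
  rfl

/-- When the data structures record that no edge is uncolored, the colors of all edges are a proper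
coloring. -/
theorem isProperColoring {col : ℕ → ℕ} {s : State} (h : Repr L.toIndexedGraph col s)
    (hl : s.var .l = 0) : L.IsProperColoring (G.maxDegree + 1) s := by
  have hpos (i : Fin m) : col i ≠ 0 := fun h0 => by
    have := (h.un.of_mem i ⟨i.2, h0⟩).1
    omega
  refine ⟨SimpleGraph.Coloring.mk (fun e => ⟨col (L.edge.symm e), ?_⟩) ?_, fun i => ?_⟩
  · have h1 := hpos (L.edge.symm e)
    have h2 := h.proper.le (L.edge.symm e) (L.edge.symm e).2
    rw [L.maxDeg_toIndexedGraph] at h2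
    rw [Finset.mem_Icc]
    omega
  · intro e f hef heq
    obtain ⟨hne, v, hve, hvf⟩ := SimpleGraph.lineGraph_adj_iff_exists.1 hef
    refine hne (L.edge.symm.injective (Fin.ext ?_))
    refine h.proper.inj v _ _ (L.edge.symm e).2 (L.edge.symm f).2 ?_ ?_ (congrArg Subtype.val heq)
      (hpos _)
    · rw [L.inc_iff]; simpa using hve
    · rw [L.inc_iff]; simpa using hvf
  · refine (h.color i i.2).trans ?_
    change _ = col (L.edge.symm (L.edge i))
    rw [L.edge.symm_apply_apply]

open scoped ENNReal

open Classical in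
/-- The expected cost of the algorithm, with an infinite cost for a final memory that does not hold
a proper coloring. -/
theorem ert_colorEdges_le {s : State} (hs : L.IsInput s) :
    ert colorEdges (fun s' => if L.IsProperColoring (G.maxDegree + 1) s' then 0 else ⊤) s ≤
      ((31 + m * 182 : ℕ) : ℝ≥0∞) +
        (1 + ∑ k ∈ Finset.range m, 1803 * (graphWeight G : ℝ≥0∞) / ((k + 1 : ℕ) : ℝ≥0∞)) := by
  have h := ColorEdges.ert_colorEdges_le (H := L.toIndexedGraph) (s := s) hs.1
    (fun e he => (hs.2 ⟨e, he⟩).1.trans (L.toIndexedGraph_fst ⟨e, he⟩).symm)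
    (fun e he => (hs.2 ⟨e, he⟩).2.trans (L.toIndexedGraph_snd ⟨e, he⟩).symm)
    (f := fun s' => if L.IsProperColoring (G.maxDegree + 1) s' then 0 else ⊤)
    (fun s' hl ⟨col, hr⟩ => if_pos (L.isProperColoring hr hl))
  rwa [L.weight_toIndexedGraph] at h

end EdgeList

/-! ### The harmonic sum -/

open scoped ENNReal

/-- The sum over the rounds, as a real number. -/
theorem setup_add_rounds_eq_ofReal (m W : ℕ) :
    ((31 + m * 182 : ℕ) : ℝ≥0∞) +
        (1 + ∑ k ∈ Finset.range m, 1803 * (W : ℝ≥0∞) / ((k + 1 : ℕ) : ℝ≥0∞)) =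
      ENNReal.ofReal (32 + m * 182 + 1803 * W * (harmonic m : ℝ)) := by
  have h (k : ℕ) : 1803 * (W : ℝ≥0∞) / ((k + 1 : ℕ) : ℝ≥0∞) =
      ENNReal.ofReal (1803 * W * ((k + 1 : ℕ) : ℝ)⁻¹) := by
    rw [← div_eq_mul_inv, ENNReal.ofReal_div_of_pos (by positivity),
      ENNReal.ofReal_mul (by norm_num), ENNReal.ofReal_natCast, ENNReal.ofReal_natCast]
    norm_num
  simp only [h]
  rw [← ENNReal.ofReal_sum_of_nonneg (fun k _ => by positivity), ← ENNReal.ofReal_natCast,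
    ← ENNReal.ofReal_one, ← ENNReal.ofReal_add zero_le_one
      (Finset.sum_nonneg fun k _ => by positivity),
    ← ENNReal.ofReal_add (by positivity) (add_nonneg zero_le_one
      (Finset.sum_nonneg fun k _ => by positivity)), ← Finset.mul_sum, harmonic]
  congr 1
  push_cast
  ring

/-- The cost of the set-up and of all rounds is `O(W log n)`, if there are between `1` and `n ^ 2`
edges, of total weight `W ≥ m`. -/
theorem setup_add_rounds_le {n m W : ℕ} (hn : 2 ≤ n) (hm : 0 < m) (hmn : m ≤ n ^ 2) (hW : m ≤ W) :
    32 + m * 182 + 1803 * W * (harmonic m : ℝ) ≤ 10000 * (W * Real.log n) := by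
  have h2 : 0.69 < Real.log n :=
    (by norm_num : (0.69 : ℝ) < 0.6931471803).trans (Real.log_two_gt_d9.trans_le
      (Real.log_le_log (by norm_num) (by exact_mod_cast hn)))
  have hlog : Real.log m ≤ 2 * Real.log n := by
    rw [← Real.log_rpow (by positivity)]
    exact Real.log_le_log (by exact_mod_cast hm) (by exact_mod_cast hmn)
  have hh : (harmonic m : ℝ) ≤ 4 * Real.log n := by
    have := harmonic_le_one_add_log m
    linarith
  have hm1 : (1 : ℝ) ≤ m := by exact_mod_cast hm
  have hW1 : (m : ℝ) ≤ W := by exact_mod_cast hW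
  have h3 : 1803 * W * (harmonic m : ℝ) ≤ 1803 * W * (4 * Real.log n) := by gcongr
  have h4 : (W : ℝ) * 0.69 ≤ W * Real.log n := by gcongr
  linarith

end ColorEdges

theorem mainTheorem3 :
    ∃ C : ℝ, 0 < C ∧
      ∀ (n m : ℕ) (G : SimpleGraph (Fin n)) [DecidableRel G.Adj]
        (L : ColorEdges.EdgeList G m) (s : ColorEdges.State), L.IsInput s →
        -- every run that halts has computed a proper edge coloring with `Δ + 1` colors
        (∀ (t : ℕ) (s' : ColorEdges.State),
          ([], s') ∈ (ColorEdges.configAfter ColorEdges.colorEdges s t).support →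
            L.IsProperColoring (G.maxDegree + 1) s') ∧
        -- the expected time is finite; in particular, the program halts almost surely
        ColorEdges.expectedTime ColorEdges.colorEdges s < ⊤ ∧
        (0 < m →
          ColorEdges.expectedTime ColorEdges.colorEdges s ≤
              ENNReal.ofReal (C * (ColorEdges.graphWeight G * Real.log n)) ∧
          ColorEdges.graphWeight G * Real.log n ≤
              C * (m * ColorEdges.arboricity G * Real.log n) ∧
          ColorEdges.expectedTime ColorEdges.colorEdges s ≤
              ENNReal.ofReal (C * (m * ColorEdges.arboricity G * Real.log n))) := by
  classical
  refine ⟨20000, by norm_num, fun n m G _ L s hs => ?_⟩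
  have hert := L.ert_colorEdges_le hs
  rw [ColorEdges.setup_add_rounds_eq_ofReal] at hert
  have htime := (ColorEdges.expectedTime_le_ert _ _ _).trans hert
  refine ⟨fun t s' hs' => ?_, htime.trans_lt ENNReal.ofReal_lt_top, fun hm => ?_⟩
  · have h := ColorEdges.lt_top_of_mem_support (hert.trans_lt ENNReal.ofReal_lt_top) hs'
    by_contra hcol
    simp [hcol] at h
  have hW : m ≤ ColorEdges.graphWeight G := by
    rw [← L.weight_toIndexedGraph]
    exact ColorEdges.IndexedGraph.m_le_weight (H := L.toIndexedGraph)
  have hn : 2 ≤ n := by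
    have := (L.adj ⟨0, hm⟩).ne
    have h1 := (L.ends ⟨0, hm⟩).1.2
    have h2 := (L.ends ⟨0, hm⟩).2.2
    rw [Ne, Fin.ext_iff] at this
    omega
  have hmn : m ≤ n ^ 2 := by
    have h := G.card_edgeFinset_le_card_choose_two
    rw [L.card_edgeFinset, Fintype.card_fin] at h
    exact h.trans (Nat.choose_le_pow n 2)
  have hlog : 0 ≤ Real.log n := Real.log_natCast_nonneg n
  have hα : (ColorEdges.graphWeight G : ℝ) * Real.log n ≤
      2 * (m * ColorEdges.arboricity G * Real.log n) := by
    have h := ColorEdges.graphWeight_le_arboricity G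
    rw [L.card_edgeFinset] at h
    have h' : (ColorEdges.graphWeight G : ℝ) ≤ 2 * (m * ColorEdges.arboricity G) := by
      exact_mod_cast h
    calc _ ≤ 2 * (m * ColorEdges.arboricity G) * Real.log n := by gcongr
      _ = _ := by ring
  have hle := htime.trans (ENNReal.ofReal_le_ofReal (ColorEdges.setup_add_rounds_le hn hm hmn hW))
  have hX : 0 ≤ (ColorEdges.graphWeight G : ℝ) * Real.log n := by positivity
  have hY : 0 ≤ (m : ℝ) * ColorEdges.arboricity G * Real.log n := by positivity
  refine ⟨hle.trans (ENNReal.ofReal_le_ofReal ?_), ?_, hle.trans (ENNReal.ofReal_le_ofReal ?_)⟩ <;>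
    linarith
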